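/- Throughout, $z$ denotes a point of the Riemann surface of the logarithm (so $z\neq 0$ and $\arg z$ may be any real number), and $z^{1/2}=\exp\left(\frac12\log|z|+\frac i2\arg z\right)$. Let $J_\nu$ and $K_\nu$ be the Bessel function and the modified Bessel function of the second kind, and put $$a_n(\nu)=\frac{(4\nu^2-1^2)(4\nu^2-3^2)\cdots(4\nu^2-(2n-1)^2)}{8^n\,n!},\qquad a_0(\nu)=1 .$$ For a non-negative integer $N$, the remainder $R_N^{(K)}(z,\nu)$ is defined by $$K_\nu(z)=\left(\frac{\pi}{2z}\right)^{1/2}e^{-z}\left(\sum_{n=0}^{N-1}\frac{a_n(\nu)}{z^n}+R_N^{(K)}(z,\nu)\right),$$ and the remainders $R_N^{(J)}(z,\nu)$ are defined by $$2R_{2n}^{(J)}(z,\nu)=R_{2n}^{(K)}(ze^{\pi i/2},\nu)+R_{2n}^{(K)}(ze^{-\pi i/2},\nu),$$ $$2i\,R_{2m+1}^{(J)}(z,\nu)=R_{2m+1}^{(K)}(ze^{\pi i/2},\nu)-R_{2m+1}^{(K)}(ze^{-\pi i/2},\nu);$$ these are the remainders of the large-argument expansion of $J_\nu$: with $\omega=z-\frac{\pi}{2}\nu-\frac{\pi}{4}$,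 for all non-negative integers $N$ and $M$, $$J_\nu(z)=\left(\frac{2}{\pi z}\right)^{1/2}\left(\cos\omega\left(\sum_{n=0}^{N-1}(-1)^n\frac{a_{2n}(\nu)}{z^{2n}}+R_{2N}^{(J)}(z,\nu)\right)-\sin\omega\left(\sum_{m=0}^{M-1}(-1)^m\frac{a_{2m+1}(\nu)}{z^{2m+1}}-R_{2M+1}^{(J)}(z,\nu)\right)\right).$$ The basic terminants are $$\Lambda_p(w)=w^pe^w\,\Gamma(1-p,w),\qquad \Pi_p(w)=\tfrac12\left(\Lambda_p(we^{\pi i/2})+\Lambda_p(we^{-\pi i/2})\right),$$ where $w$ lies on the Riemann surface of the logarithm and $\Gamma(a,w)=\int_w^{+\infty}t^{a-1}e^{-t}\,dt$ is the incomplete gamma function. **Theorem.** Let $N$ be a non-negative integer and let $\nu$ be a real number with $|\nu|<N+\frac12$. Put $p=N+\max\left(0,\frac12-|\nu|\right)$. If $|\arg z|<\frac{3\pi}{2}$, then $\sup_{r\ge1}|\Lambda_p(2zr)|$ is finite and $$\left|R_N^{(K)}(z,\nu)\right|\le\frac{|a_N(\nu)|}{|z|^N}\,\sup_{r\ge1}\left|\Lambda_p(2zr)\right|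 .$$ If $|\arg z|<\pi$, then $\sup_{r\ge1}|\Pi_p(2zr)|$ is finite and $$\left|R_N^{(J)}(z,\nu)\right|\le\frac{|a_N(\nu)|}{|z|^N}\,\sup_{r\ge1}\left|\Pi_p(2zr)\right| .$$ -/

import Mathlib

/-!
Functions on the Riemann surface of the logarithm. A point `z` of this surface is represented by its
logarithm `ζ : ℂ`: its projection to the punctured plane is `exp ζ`, its modulus is `exp (Re ζ)`,
and its argument, an arbitrary real number, is `Im ζ`. Thus `z * exp (± π i / 2)` is represented by
`ζ ± I * π / 2`, and `c * z`, for real `c > 0`, by `ζ + log c`. A multivalued function of `z`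
is a function of `ζ : ℂ`; for instance `z ^ (1 / 2)` is `exp (ζ / 2)`.
-/

namespace HankelBessel

open Filter Topology

noncomputable section

/-- The Bessel function `J_ν(z)`, `z = exp ζ`, by its power series
`∑ (-1)^k (z/2)^(ν+2k) / (k! Γ(ν+k+1))`; here `1 / Γ = 0` at the poles of `Γ`. -/
def besselJ (ν ζ : ℂ) : ℂ :=
  ∑' k : ℕ, (-1) ^ k * ((k.factorial : ℂ)⁻¹ * (Complex.Gamma (ν + k + 1))⁻¹ *
    Complex.exp ((ν + 2 * k) * (ζ - Real.log 2)))

/-- The modified Bessel function of the first kind `I_ν(z)`, `z = exp ζ`, by its power series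
`∑ (z/2)^(ν+2k) / (k! Γ(ν+k+1))`. -/
def besselI (ν ζ : ℂ) : ℂ :=
  ∑' k : ℕ, (k.factorial : ℂ)⁻¹ * (Complex.Gamma (ν + k + 1))⁻¹ *
    Complex.exp ((ν + 2 * k) * (ζ - Real.log 2))

/-- The quotient `(π / 2) (I_{-ν}(z) - I_ν(z)) / sin (π ν)`. -/
def besselKQuot (ν ζ : ℂ) : ℂ :=
  Real.pi / 2 * (besselI (-ν) ζ - besselI ν ζ) / Complex.sin (Real.pi * ν)

open Classical in
/-- The modified Bessel function of the second kind `K_ν(z)`, `z = exp ζ`: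
`(π / 2) (I_{-ν}(z) - I_ν(z)) / sin (π ν)` if `ν` is not an integer, and the limit of this
expression in the order if `ν` is an integer. -/
def besselK (ν ζ : ℂ) : ℂ :=
  if ∃ n : ℤ, ν = n then limUnder (𝓝[≠] ν) (fun μ => besselKQuot μ ζ) else besselKQuot ν ζ

/-- The coefficient `a_n(ν) = (4ν² - 1²)(4ν² - 3²) ⋯ (4ν² - (2n-1)²) / (8^n n!)`. -/
def coeffA (n : ℕ) (ν : ℂ) : ℂ :=
  (∏ k ∈ Finset.range n, (4 * ν ^ 2 - (2 * k + 1) ^ 2)) / (8 ^ n * n.factorial)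

/-- The remainder `R_N^{(K)}(z, ν)`, `z = exp ζ`, determined by
`K_ν(z) = (π / (2 z))^(1/2) e^(-z) (∑_{n < N} a_n(ν) / z^n + R_N^{(K)}(z, ν))`. -/
def remK (N : ℕ) (ν ζ : ℂ) : ℂ :=
  besselK ν ζ /
      (Real.sqrt (Real.pi / 2) * Complex.exp (-ζ / 2) * Complex.exp (-Complex.exp ζ)) -
    ∑ n ∈ Finset.range N, coeffA n ν / Complex.exp ζ ^ n

/-- The remainder `R_N^{(J)}(z, ν)`, `z = exp ζ`, in the large-`z` expansion of `J_ν(z)`, with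
`2 R_N^{(J)}(z, ν) = R_N^{(K)}(z e^{πi/2}, ν) + R_N^{(K)}(z e^{-πi/2}, ν)` for even `N` and
`2 i R_N^{(J)}(z, ν) = R_N^{(K)}(z e^{πi/2}, ν) - R_N^{(K)}(z e^{-πi/2}, ν)` for odd `N`.
See `besselJ_eq` below for the expansion of `J_ν(z)` of which these are the remainders. -/
def remJ (N : ℕ) (ν ζ : ℂ) : ℂ :=
  if Even N then
    (remK N ν (ζ + Complex.I * Real.pi / 2) + remK N ν (ζ - Complex.I * Real.pi / 2)) / 2
  else
    (remK N ν (ζ + Complex.I * Real.pi / 2) - remK N ν (ζ - Complex.I * Real.pi / 2)) /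
      (2 * Complex.I)

/-- The (upper) incomplete gamma function `Γ(a, w) = ∫_w^{+∞} t^(a-1) e^(-t) dt`, `w = exp ω`,
on the Riemann surface of the logarithm. The path of integration goes from `w` along the arc of
modulus `|w|` to the point `|w|` of argument `0` (this is the second integral, with
`t = |w| e^{iθ} = exp (Re ω + i θ)` and `dt = i t dθ`), and then along the ray of argument `0`. -/
def incGamma (a ω : ℂ) : ℂ :=
  (∫ t in Set.Ioi (Real.exp ω.re), (t : ℂ) ^ (a - 1) * Complex.exp (-t)) -
    ∫ θ in (0 : ℝ)..ω.im, Complex.exp (a * (ω.re + Complex.I * θ)) *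
      Complex.exp (-Complex.exp (ω.re + Complex.I * θ)) * Complex.I

/-- The basic terminant `Λ_p(w) = w^p e^w Γ(1 - p, w)`, `w = exp ω`. -/
def terminantL (p ω : ℂ) : ℂ :=
  Complex.exp (p * ω) * Complex.exp (Complex.exp ω) * incGamma (1 - p) ω

/-- The basic terminant `Π_p(w) = (Λ_p(w e^{πi/2}) + Λ_p(w e^{-πi/2})) / 2`, `w = exp ω`. -/
def terminantP (p ω : ℂ) : ℂ :=
  (terminantL p (ω + Complex.I * Real.pi / 2) + terminantL p (ω - Complex.I * Real.pi / 2)) / 2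

/-! ### The limit defining `K_ν` at integers exists, and `remJ` are the remainders of `J_ν` -/

/-- On a bounded set of orders, the reciprocals `1 / Γ(ν + k + 1)` are bounded, uniformly in `k`. -/
theorem bounded_one_div_Gamma (R : ℝ) :
    ∃ C : ℝ, ∀ (k : ℕ) (ν : ℂ), ‖ν‖ ≤ R → ‖(Complex.Gamma (ν + k + 1))⁻¹‖ ≤ C := by
  have hb : ∀ k : ℕ, ∃ C : ℝ, ∀ ν : ℂ, ‖ν‖ ≤ R → ‖(Complex.Gamma (ν + k + 1))⁻¹‖ ≤ C := by
    intro k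
    have hc : Continuous fun ν : ℂ => (Complex.Gamma (ν + k + 1))⁻¹ :=
      Complex.differentiable_one_div_Gamma.continuous.comp (by fun_prop)
    obtain ⟨C, hC⟩ := (isCompact_closedBall (0 : ℂ) R).exists_bound_of_continuousOn hc.continuousOn
    exact ⟨C, fun ν hν => hC ν (by simpa using hν)⟩
  choose C hC using hb
  obtain ⟨K, hK⟩ := exists_nat_ge R
  refine ⟨∑ n ∈ Finset.range (K + 1), |C n|, ?_⟩
  have small : ∀ k ≤ K, ∀ ν : ℂ, ‖ν‖ ≤ R →
      ‖(Complex.Gamma (ν + k + 1))⁻¹‖ ≤ ∑ n ∈ Finset.range (K + 1), |C n| := by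
    intro k hk ν hν
    refine ((hC k ν hν).trans (le_abs_self _)).trans ?_
    exact Finset.single_le_sum (f := fun n => |C n|) (fun _ _ => abs_nonneg _)
      (Finset.mem_range.2 (by omega))
  intro k ν hν
  induction k with
  | zero => exact small 0 (Nat.zero_le _) ν hν
  | succ k ih =>
    by_cases hk : k + 1 ≤ K
    · exact small (k + 1) hk ν hν
    have h1 : (Complex.Gamma (ν + k + 1))⁻¹ =
        (ν + k + 1) * (Complex.Gamma (ν + (k + 1 : ℕ) + 1))⁻¹ := by
      rw [Complex.one_div_Gamma_eq_self_mul_one_div_Gamma_add_one]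
      push_cast
      ring_nf
    have h2 : (1 : ℝ) ≤ ‖ν + k + 1‖ := by
      have h3 : ‖((k : ℂ) + 1)‖ = k + 1 := by
        have : ((k : ℂ) + 1) = ((k + 1 : ℕ) : ℂ) := by push_cast; rfl
        rw [this, Complex.norm_natCast]; push_cast; rfl
      have h4 : ‖((k : ℂ) + 1)‖ ≤ ‖ν + k + 1‖ + ‖ν‖ := by
        have := norm_sub_le (ν + k + 1) ν
        have h5 : ν + k + 1 - ν = (k : ℂ) + 1 := by ring
        rwa [h5] at this
      have h6 : ‖ν‖ ≤ k := by
        refine hν.trans (hK.trans ?_)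
        exact_mod_cast (by omega : K ≤ k)
      linarith
    rw [h1, norm_mul] at ih
    have h7 := norm_nonneg (Complex.Gamma (ν + (k + 1 : ℕ) + 1))⁻¹
    nlinarith

/-- A summable bound for the terms of the series, uniform on bounded sets of orders. -/
theorem besselI_term_bound (R : ℝ) (ζ : ℂ) : ∃ u : ℕ → ℝ, Summable u ∧
    ∀ (k : ℕ) (ν : ℂ), ‖ν‖ ≤ R → ‖(k.factorial : ℂ)⁻¹ * (Complex.Gamma (ν + k + 1))⁻¹ *
      Complex.exp ((ν + 2 * k) * (ζ - Real.log 2))‖ ≤ u k := by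
  obtain ⟨C, hC⟩ := bounded_one_div_Gamma R
  set B : ℝ := ‖ζ - Real.log 2‖ with hB
  refine ⟨fun k => C * Real.exp (R * B) * (Real.exp (2 * B) ^ k / k.factorial),
    (Real.summable_pow_div_factorial _).mul_left _, ?_⟩
  intro k ν hν
  have hB0 : 0 ≤ B := norm_nonneg _
  have h1 : ‖Complex.exp ((ν + 2 * k) * (ζ - Real.log 2))‖ ≤
      Real.exp (R * B) * Real.exp (2 * B) ^ k := by
    rw [← Real.exp_nat_mul, ← Real.exp_add]
    refine (Complex.norm_exp_le_exp_norm _).trans (Real.exp_le_exp.2 ?_)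
    rw [norm_mul, ← hB]
    have h2 : ‖ν + 2 * k‖ ≤ R + 2 * k := by
      refine (norm_add_le _ _).trans ?_
      simpa using hν
    nlinarith
  have h3 : ‖(k.factorial : ℂ)⁻¹‖ = (k.factorial : ℝ)⁻¹ := by simp
  rw [norm_mul, norm_mul, h3]
  have h4 := hC k ν hν
  have h5 : (0 : ℝ) ≤ (k.factorial : ℝ)⁻¹ := by positivity
  calc (k.factorial : ℝ)⁻¹ * ‖(Complex.Gamma (ν + k + 1))⁻¹‖ *
        ‖Complex.exp ((ν + 2 * k) * (ζ - Real.log 2))‖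
      ≤ (k.factorial : ℝ)⁻¹ * C * (Real.exp (R * B) * Real.exp (2 * B) ^ k) := by
        have := (norm_nonneg _).trans h4
        gcongr
    _ = _ := by ring

theorem besselI_summable (ν ζ : ℂ) : Summable fun k : ℕ =>
    (k.factorial : ℂ)⁻¹ * (Complex.Gamma (ν + k + 1))⁻¹ *
      Complex.exp ((ν + 2 * k) * (ζ - Real.log 2)) := by
  obtain ⟨u, hu, h⟩ := besselI_term_bound ‖ν‖ ζ
  exact Summable.of_norm_bounded hu fun k => h k ν le_rfl

/-- `I_ν(z)` is an entire function of `ν`. -/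
theorem besselI_differentiable (ζ : ℂ) : Differentiable ℂ fun ν => besselI ν ζ := by
  intro ν
  obtain ⟨u, hu, h⟩ := besselI_term_bound (‖ν‖ + 1) ζ
  have hd : DifferentiableOn ℂ (fun ν => besselI ν ζ) (Metric.ball 0 (‖ν‖ + 1)) := by
    refine Complex.differentiableOn_tsum_of_summable_norm hu ?_ Metric.isOpen_ball ?_
    · intro k
      have h1 : Differentiable ℂ fun ν : ℂ => (Complex.Gamma (ν + k + 1))⁻¹ :=
        Complex.differentiable_one_div_Gamma.comp (by fun_prop)
      exact Differentiable.differentiableOn (by fun_prop)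
    · intro k w hw
      exact h k w (by simpa using (Metric.mem_ball.1 hw).le)
  exact hd.differentiableAt (Metric.isOpen_ball.mem_nhds (by simp))

theorem besselI_neg_nat (n : ℕ) (ζ : ℂ) : besselI (-n) ζ = besselI n ζ := by
  unfold besselI
  rw [← (besselI_summable (-n) ζ).sum_add_tsum_nat_add n, Finset.sum_eq_zero, zero_add]
  · refine tsum_congr fun k => ?_
    have h1 : (-(n : ℂ) + ((k + n : ℕ) : ℂ) + 1) = (k : ℂ) + 1 := by push_cast; ring
    have h2 : ((n : ℂ) + (k : ℂ) + 1) = ((k + n : ℕ) : ℂ) + 1 := by push_cast; ring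
    have h3 : (-(n : ℂ) + 2 * ((k + n : ℕ) : ℂ)) = n + 2 * k := by push_cast; ring
    rw [h1, h2, h3, Complex.Gamma_nat_eq_factorial, Complex.Gamma_nat_eq_factorial]
    ring
  · intro k hk
    have hk' := Finset.mem_range.1 hk
    have h1 : (-(n : ℂ) + k + 1) = -((n - 1 - k : ℕ) : ℂ) := by
      rw [Nat.cast_sub (by omega), Nat.cast_sub (by omega)]
      push_cast; ring
    rw [h1, Complex.Gamma_neg_nat_eq_zero]
    simp

theorem besselI_neg_int (n : ℤ) (ζ : ℂ) : besselI (-n) ζ = besselI n ζ := by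
  obtain ⟨m, rfl | rfl⟩ := n.eq_nat_or_neg
  · simpa using besselI_neg_nat m ζ
  · simpa using (besselI_neg_nat m ζ).symm

theorem sin_pi_int (n : ℤ) : Complex.sin (Real.pi * n) = 0 := by
  rw [mul_comm]; exact Complex.sin_int_mul_pi n

/-- At an integer order, the limit that defines `K_ν(z)` exists. -/
theorem besselK_tendsto_int (n : ℤ) (ζ : ℂ) :
    Tendsto (fun μ => besselKQuot μ ζ) (𝓝[≠] (n : ℂ)) (𝓝 (besselK n ζ)) := by
  have key : ∃ l : ℂ, Tendsto (fun μ => besselKQuot μ ζ) (𝓝[≠] (n : ℂ)) (𝓝 l) := by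
    let f : ℂ → ℂ := fun μ => Real.pi / 2 * (besselI (-μ) ζ - besselI μ ζ)
    let g : ℂ → ℂ := fun μ => Complex.sin (Real.pi * μ)
    have hf : DifferentiableAt ℂ f n := by
      have h1 := besselI_differentiable ζ
      have h2 : Differentiable ℂ fun μ => besselI (-μ) ζ := h1.comp differentiable_neg
      exact ((h2.sub h1).const_mul _) n
    have hg : HasDerivAt g (Complex.cos (Real.pi * n) * Real.pi) n := by
      have h1 : HasDerivAt (fun μ : ℂ => Real.pi * μ) (Real.pi : ℂ) n := by
        simpa using (hasDerivAt_id (n : ℂ)).const_mul (Real.pi : ℂ)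
      exact h1.csin
    have hg0 : Complex.cos (Real.pi * n) * Real.pi ≠ 0 := by
      refine mul_ne_zero ?_ (by exact_mod_cast Real.pi_ne_zero)
      intro h
      have := Complex.sin_sq_add_cos_sq (Real.pi * n)
      rw [h, sin_pi_int] at this
      norm_num at this
    refine ⟨_, ((hasDerivAt_iff_tendsto_slope.1 hf.hasDerivAt).div
      (hasDerivAt_iff_tendsto_slope.1 hg) hg0).congr' ?_⟩
    filter_upwards [self_mem_nhdsWithin] with μ hμ
    have hμ' : μ - n ≠ 0 := sub_ne_zero.2 hμ
    have hfn : f n = 0 := by simp only [f]; rw [besselI_neg_int]; ring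
    have hgn : g n = 0 := sin_pi_int n
    simp only [Pi.div_apply, slope_def_field, hfn, hgn, sub_zero]
    rw [div_div_div_cancel_right₀ hμ']
    rfl
  have : besselK n ζ = limUnder (𝓝[≠] (n : ℂ)) (fun μ => besselKQuot μ ζ) := by
    unfold besselK
    rw [if_pos ⟨n, rfl⟩]
  rw [this]
  exact tendsto_nhds_limUnder key

theorem exp_two_k (ν : ℂ) (k : ℕ) (s : ℂ) (hs : s = 1 ∨ s = -1) (x : ℂ) :
    Complex.exp ((ν + 2 * k) * (x + s * (Complex.I * Real.pi / 2))) =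
      Complex.exp (s * (Complex.I * Real.pi / 2) * ν) * ((-1) ^ k * Complex.exp ((ν + 2 * k) * x)) := by
  have h : Complex.exp (s * (Complex.I * Real.pi)) = -1 := by
    rcases hs with rfl | rfl
    · rw [one_mul, mul_comm, Complex.exp_pi_mul_I]
    · rw [neg_one_mul, Complex.exp_neg, mul_comm, Complex.exp_pi_mul_I]; norm_num
  rw [← h, ← Complex.exp_nat_mul, ← Complex.exp_add, ← Complex.exp_add]
  congr 1
  ring

theorem besselI_rotate (ν ζ s : ℂ) (hs : s = 1 ∨ s = -1) :
    besselI ν (ζ + s * (Complex.I * Real.pi / 2)) =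
      Complex.exp (s * (Complex.I * Real.pi / 2) * ν) * besselJ ν ζ := by
  unfold besselI besselJ
  rw [← tsum_mul_left]
  refine tsum_congr fun k => ?_
  rw [show ζ + s * (Complex.I * Real.pi / 2) - Real.log 2 =
    (ζ - Real.log 2) + s * (Complex.I * Real.pi / 2) by ring, exp_two_k ν k s hs]
  ring

theorem besselJ_eq_besselKQuot (ν ζ : ℂ) (hν : Complex.sin (Real.pi * ν) ≠ 0) :
    Real.pi * Complex.I * besselJ ν ζ =
      Complex.exp (-1 * (Complex.I * Real.pi / 2) * ν) *
          besselKQuot ν (ζ + -1 * (Complex.I * Real.pi / 2)) -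
        Complex.exp (1 * (Complex.I * Real.pi / 2) * ν) *
          besselKQuot ν (ζ + 1 * (Complex.I * Real.pi / 2)) := by
  unfold besselKQuot
  rw [besselI_rotate _ _ _ (Or.inl rfl), besselI_rotate _ _ _ (Or.inl rfl),
    besselI_rotate _ _ _ (Or.inr rfl), besselI_rotate _ _ _ (Or.inr rfl)]
  set x : ℂ := Complex.exp (1 * (Complex.I * Real.pi / 2) * ν) with hx
  have hx0 : x ≠ 0 := Complex.exp_ne_zero _
  have e1 : Complex.exp (-1 * (Complex.I * Real.pi / 2) * ν) = x⁻¹ := by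
    rw [hx, ← Complex.exp_neg]; ring_nf
  have e2 : Complex.exp (1 * (Complex.I * Real.pi / 2) * -ν) = x⁻¹ := by
    rw [hx, ← Complex.exp_neg]; ring_nf
  have e3 : Complex.exp (-1 * (Complex.I * Real.pi / 2) * -ν) = x := by
    rw [hx]; ring_nf
  have e4 : Complex.sin (Real.pi * ν) = ((x ^ 2)⁻¹ - x ^ 2) * Complex.I / 2 := by
    rw [Complex.sin, hx, ← Complex.exp_nat_mul, ← Complex.exp_neg]
    push_cast
    ring_nf
  rw [e1, e2, e3]
  rw [div_eq_mul_inv _ (Complex.sin (Real.pi * ν)), div_eq_mul_inv _ (Complex.sin (Real.pi * ν))]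
  have e5 : Complex.sin (Real.pi * ν) * (Complex.sin (Real.pi * ν))⁻¹ = 1 := mul_inv_cancel₀ hν
  generalize (Complex.sin (Real.pi * ν))⁻¹ = t at e5 ⊢
  rw [e4] at e5
  have e6 : ((x⁻¹) ^ 2 - x ^ 2) * Complex.I * t = 2 := by
    rw [inv_pow]; linear_combination 2 * e5
  have e7 : x * x⁻¹ = 1 := mul_inv_cancel₀ hx0
  have e8 : Complex.I * Complex.I = -1 := Complex.I_mul_I
  generalize x⁻¹ = y at *
  have e9 : (x ^ 2 - y ^ 2) * t = 2 * Complex.I := by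
    linear_combination Complex.I * e6 - (y ^ 2 - x ^ 2) * t * e8
  linear_combination -(Real.pi / 2 : ℂ) * besselJ ν ζ * e9

/-- The connection formula `π i J_ν(z) = e^{-πiν/2} K_ν(z e^{-πi/2}) - e^{πiν/2} K_ν(z e^{πi/2})`. -/
theorem besselJ_eq_besselK (ν ζ : ℂ) :
    Real.pi * Complex.I * besselJ ν ζ =
      Complex.exp (-1 * (Complex.I * Real.pi / 2) * ν) *
          besselK ν (ζ + -1 * (Complex.I * Real.pi / 2)) -
        Complex.exp (1 * (Complex.I * Real.pi / 2) * ν) *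
          besselK ν (ζ + 1 * (Complex.I * Real.pi / 2)) := by
  have hsin : ∀ μ : ℂ, (¬ ∃ n : ℤ, μ = n) → Complex.sin (Real.pi * μ) ≠ 0 := by
    intro μ hμ h
    obtain ⟨n, hn⟩ := Complex.sin_eq_zero_iff.1 h
    refine hμ ⟨n, ?_⟩
    have hpi : (Real.pi : ℂ) ≠ 0 := by exact_mod_cast Real.pi_ne_zero
    exact mul_left_cancel₀ hpi (by rw [hn]; ring)
  by_cases hν : ∃ n : ℤ, ν = n
  · obtain ⟨n, rfl⟩ := hν
    have hJ : ∀ μ : ℂ, besselJ μ ζ = Complex.exp (-(1 * (Complex.I * Real.pi / 2) * μ)) *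
        besselI μ (ζ + 1 * (Complex.I * Real.pi / 2)) := by
      intro μ
      rw [besselI_rotate _ _ _ (Or.inl rfl), ← mul_assoc, ← Complex.exp_add]
      simp
    have hJc : Continuous fun μ : ℂ => Real.pi * Complex.I * besselJ μ ζ := by
      simp only [hJ]
      have := (besselI_differentiable (ζ + 1 * (Complex.I * Real.pi / 2))).continuous
      fun_prop
    have h1 : Tendsto (fun μ : ℂ => Real.pi * Complex.I * besselJ μ ζ) (𝓝[≠] (n : ℂ))
        (𝓝 (Real.pi * Complex.I * besselJ n ζ)) := (hJc.tendsto _).mono_left nhdsWithin_le_nhds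
    have hexp : ∀ s : ℂ, Tendsto (fun μ : ℂ => Complex.exp (s * (Complex.I * Real.pi / 2) * μ))
        (𝓝[≠] (n : ℂ)) (𝓝 (Complex.exp (s * (Complex.I * Real.pi / 2) * n))) := by
      intro s
      have : Continuous fun μ : ℂ => Complex.exp (s * (Complex.I * Real.pi / 2) * μ) := by
        fun_prop
      exact (this.tendsto _).mono_left nhdsWithin_le_nhds
    have h2 := ((hexp (-1)).mul
        (besselK_tendsto_int n (ζ + -1 * (Complex.I * Real.pi / 2)))).sub
      ((hexp 1).mul (besselK_tendsto_int n (ζ + 1 * (Complex.I * Real.pi / 2))))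
    refine tendsto_nhds_unique (h1.congr' ?_) h2
    have hev : ∀ᶠ μ : ℂ in 𝓝[≠] (n : ℂ), dist μ (n : ℂ) < 1 :=
      nhdsWithin_le_nhds (Metric.ball_mem_nhds _ one_pos)
    filter_upwards [hev, self_mem_nhdsWithin] with μ hμ hμn
    refine besselJ_eq_besselKQuot μ ζ (hsin μ ?_)
    rintro ⟨m, rfl⟩
    rw [dist_eq_norm, ← Int.cast_sub, Complex.norm_intCast] at hμ
    have h3 : |m - n| < 1 := by exact_mod_cast hμ
    have h4 : m = n := by
      have := Int.abs_lt_one_iff.1 h3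
      omega
    exact hμn (by simp [h4])
  · simp only [besselK, if_neg hν]
    exact besselJ_eq_besselKQuot ν ζ (hsin ν hν)

/-- The functions `remJ` are the remainders of the expansion of `J_ν(z)`: with
`ω = z - π ν / 2 - π / 4`, and for arbitrary `N` and `M`,
`J_ν(z) = (2 / (π z))^(1/2) (cos ω (∑_{n < N} (-1)^n a_{2n}(ν) / z^{2n} + R_{2N}^{(J)}(z, ν))
  - sin ω (∑_{m < M} (-1)^m a_{2m+1}(ν) / z^{2m+1} - R_{2M+1}^{(J)}(z, ν)))`. -/
theorem besselJ_eq (N M : ℕ) (ν ζ : ℂ) :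
    besselJ ν ζ = Real.sqrt (2 / Real.pi) * Complex.exp (-ζ / 2) *
      (Complex.cos (Complex.exp ζ - Real.pi / 2 * ν - Real.pi / 4) *
          (∑ n ∈ Finset.range N, (-1) ^ n * coeffA (2 * n) ν / Complex.exp ζ ^ (2 * n) +
            remJ (2 * N) ν ζ) -
        Complex.sin (Complex.exp ζ - Real.pi / 2 * ν - Real.pi / 4) *
          (∑ m ∈ Finset.range M, (-1) ^ m * coeffA (2 * m + 1) ν / Complex.exp ζ ^ (2 * m + 1) -
            remJ (2 * M + 1) ν ζ)) := by
  have hI2 : Complex.I ^ 2 = -1 := Complex.I_sq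
  have hI0 : Complex.I ≠ 0 := Complex.I_ne_zero
  have hz0 : Complex.exp ζ ≠ 0 := Complex.exp_ne_zero _
  have hq : Complex.exp (Complex.I * Real.pi / 2) = Complex.I := by
    rw [show Complex.I * Real.pi / 2 = Real.pi / 2 * Complex.I by ring, Complex.exp_pi_div_two_mul_I]
  have hp : Complex.exp (ζ + Complex.I * Real.pi / 2) = Complex.I * Complex.exp ζ := by
    rw [Complex.exp_add, hq, mul_comm]
  have hm : Complex.exp (ζ - Complex.I * Real.pi / 2) = -Complex.I * Complex.exp ζ := by
    rw [Complex.exp_sub, hq, div_eq_mul_inv, Complex.inv_I, mul_comm]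
  -- the two normalised values of `K`
  set kp : ℂ := besselK ν (ζ + Complex.I * Real.pi / 2) / (Real.sqrt (Real.pi / 2) *
    Complex.exp (-(ζ + Complex.I * Real.pi / 2) / 2) *
    Complex.exp (-Complex.exp (ζ + Complex.I * Real.pi / 2))) with hkp
  set km : ℂ := besselK ν (ζ - Complex.I * Real.pi / 2) / (Real.sqrt (Real.pi / 2) *
    Complex.exp (-(ζ - Complex.I * Real.pi / 2) / 2) *
    Complex.exp (-Complex.exp (ζ - Complex.I * Real.pi / 2))) with hkm
  have hIe : ∀ n : ℕ, Complex.I ^ (2 * n) = (-1) ^ n := fun n => by rw [pow_mul, hI2]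
  have hs : ∀ n : ℕ, ((-1 : ℂ) ^ n) * (-1) ^ n = 1 := fun n => by
    rw [← mul_pow]; norm_num
  have hse : ∀ n : ℕ, ((-1 : ℂ) ^ n)⁻¹ = (-1) ^ n := fun n => by
    rw [← inv_pow]; norm_num
  have pe : ∀ (n : ℕ) (a : ℂ), a / (Complex.I * Complex.exp ζ) ^ (2 * n) =
      (-1) ^ n * a / Complex.exp ζ ^ (2 * n) := fun n a => by
    rw [mul_pow, hIe, div_eq_mul_inv, mul_inv, hse]; ring
  have me : ∀ (n : ℕ) (a : ℂ), a / (-Complex.I * Complex.exp ζ) ^ (2 * n) =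
      (-1) ^ n * a / Complex.exp ζ ^ (2 * n) := fun n a => by
    rw [mul_pow, (even_two_mul n).neg_pow, hIe, div_eq_mul_inv, mul_inv, hse]; ring
  have po : ∀ (n : ℕ) (a : ℂ), a / (Complex.I * Complex.exp ζ) ^ (2 * n + 1) =
      -Complex.I * ((-1) ^ n * a / Complex.exp ζ ^ (2 * n + 1)) := fun n a => by
    rw [mul_pow, pow_succ Complex.I, hIe, div_eq_mul_inv, mul_inv, mul_inv, hse, Complex.inv_I]; ring
  have mo : ∀ (n : ℕ) (a : ℂ), a / (-Complex.I * Complex.exp ζ) ^ (2 * n + 1) =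
      Complex.I * ((-1) ^ n * a / Complex.exp ζ ^ (2 * n + 1)) := fun n a => by
    rw [mul_pow, (odd_two_mul_add_one n).neg_pow, pow_succ Complex.I, hIe, div_eq_mul_inv, mul_inv,
      inv_neg, mul_inv, hse, Complex.inv_I]; ring
  have sumP : ∀ n : ℕ,
      ∑ j ∈ Finset.range (2 * n), coeffA j ν / (Complex.I * Complex.exp ζ) ^ j =
        ∑ j ∈ Finset.range n, (-1) ^ j * coeffA (2 * j) ν / Complex.exp ζ ^ (2 * j) -
          Complex.I * ∑ j ∈ Finset.range n,
            (-1) ^ j * coeffA (2 * j + 1) ν / Complex.exp ζ ^ (2 * j + 1) := by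
    intro n
    induction n with
    | zero => simp
    | succ n ih =>
      rw [show 2 * (n + 1) = 2 * n + 1 + 1 by ring, Finset.sum_range_succ, Finset.sum_range_succ, ih,
        Finset.sum_range_succ, Finset.sum_range_succ, pe, po]
      ring
  have sumM : ∀ n : ℕ,
      ∑ j ∈ Finset.range (2 * n), coeffA j ν / (-Complex.I * Complex.exp ζ) ^ j =
        ∑ j ∈ Finset.range n, (-1) ^ j * coeffA (2 * j) ν / Complex.exp ζ ^ (2 * j) +
          Complex.I * ∑ j ∈ Finset.range n,
            (-1) ^ j * coeffA (2 * j + 1) ν / Complex.exp ζ ^ (2 * j + 1) := by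
    intro n
    induction n with
    | zero => simp
    | succ n ih =>
      rw [show 2 * (n + 1) = 2 * n + 1 + 1 by ring, Finset.sum_range_succ, Finset.sum_range_succ, ih,
        Finset.sum_range_succ, Finset.sum_range_succ, me, mo]
      ring
  have hE : ∑ n ∈ Finset.range N, (-1) ^ n * coeffA (2 * n) ν / Complex.exp ζ ^ (2 * n) +
      remJ (2 * N) ν ζ = (kp + km) / 2 := by
    simp only [remJ, if_pos (even_two_mul N), remK, ← hkp, ← hkm]
    rw [hp, hm, sumP, sumM]
    ring
  have hO : ∑ m ∈ Finset.range M, (-1) ^ m * coeffA (2 * m + 1) ν / Complex.exp ζ ^ (2 * m + 1) -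
      remJ (2 * M + 1) ν ζ = (kp - km) * Complex.I / 2 := by
    have hodd : ¬ Even (2 * M + 1) := Nat.not_even_iff_odd.2 (odd_two_mul_add_one M)
    simp only [remJ, if_neg hodd, remK, ← hkp, ← hkm]
    rw [hp, hm, Finset.sum_range_succ, Finset.sum_range_succ, sumP, sumM, pe, me]
    rw [div_eq_mul_inv _ (2 * Complex.I), mul_inv, Complex.inv_I]
    generalize (∑ m ∈ Finset.range M,
      (-1) ^ m * coeffA (2 * m + 1) ν / Complex.exp ζ ^ (2 * m + 1)) = S
    linear_combination S * hI2
  rw [hE, hO]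
  have hcon := besselJ_eq_besselK ν ζ
  rw [show ζ + -1 * (Complex.I * Real.pi / 2) = ζ - Complex.I * Real.pi / 2 by ring,
    show ζ + 1 * (Complex.I * Real.pi / 2) = ζ + Complex.I * Real.pi / 2 by ring] at hcon
  have hs0 : (Real.sqrt (Real.pi / 2) : ℂ) ≠ 0 := by
    exact_mod_cast (Real.sqrt_pos.2 (by positivity)).ne'
  have hss : (Real.pi : ℂ) * Real.sqrt (2 / Real.pi) = 2 * Real.sqrt (Real.pi / 2) := by
    have h1 : Real.sqrt (Real.pi / 2) * Real.sqrt (2 / Real.pi) = 1 := by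
      rw [← Real.sqrt_mul (by positivity), show Real.pi / 2 * (2 / Real.pi) = 1 by
        field_simp, Real.sqrt_one]
    have h2 : Real.sqrt (Real.pi / 2) * Real.sqrt (Real.pi / 2) = Real.pi / 2 :=
      Real.mul_self_sqrt (by positivity)
    have h3 : Real.pi * Real.sqrt (2 / Real.pi) = 2 * Real.sqrt (Real.pi / 2) := by
      linear_combination -2 * Real.sqrt (2 / Real.pi) * h2 + 2 * Real.sqrt (Real.pi / 2) * h1
    exact_mod_cast h3
  have hpi : (Real.pi : ℂ) ≠ 0 := by exact_mod_cast Real.pi_ne_zero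
  have hKp : besselK ν (ζ + Complex.I * Real.pi / 2) = kp * (Real.sqrt (Real.pi / 2) *
      Complex.exp (-(ζ + Complex.I * Real.pi / 2) / 2) *
      Complex.exp (-Complex.exp (ζ + Complex.I * Real.pi / 2))) :=
    (div_mul_cancel₀ _ (mul_ne_zero (mul_ne_zero hs0 (Complex.exp_ne_zero _))
      (Complex.exp_ne_zero _))).symm
  have hKm : besselK ν (ζ - Complex.I * Real.pi / 2) = km * (Real.sqrt (Real.pi / 2) *
      Complex.exp (-(ζ - Complex.I * Real.pi / 2) / 2) *
      Complex.exp (-Complex.exp (ζ - Complex.I * Real.pi / 2))) :=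
    (div_mul_cancel₀ _ (mul_ne_zero (mul_ne_zero hs0 (Complex.exp_ne_zero _))
      (Complex.exp_ne_zero _))).symm
  rw [hKp, hKm, hp, hm] at hcon
  set w : ℂ := Complex.exp ζ - Real.pi / 2 * ν - Real.pi / 4 with hw
  have hX : Complex.exp (-1 * (Complex.I * Real.pi / 2) * ν) *
      Complex.exp (-(ζ - Complex.I * Real.pi / 2) / 2) *
      Complex.exp (-(-Complex.I * Complex.exp ζ)) =
      Complex.I * Complex.exp (-ζ / 2) * Complex.exp (w * Complex.I) := by
    rw [← hq, ← Complex.exp_add, ← Complex.exp_add, ← Complex.exp_add, ← Complex.exp_add, hw]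
    congr 1
    rw [hq]
    ring
  have hY : Complex.exp (1 * (Complex.I * Real.pi / 2) * ν) *
      Complex.exp (-(ζ + Complex.I * Real.pi / 2) / 2) *
      Complex.exp (-(Complex.I * Complex.exp ζ)) =
      -Complex.I * Complex.exp (-ζ / 2) * Complex.exp (-w * Complex.I) := by
    have hq' : Complex.exp (-(Complex.I * Real.pi / 2)) = -Complex.I := by
      rw [Complex.exp_neg, hq, Complex.inv_I]
    rw [← hq', ← Complex.exp_add, ← Complex.exp_add, ← Complex.exp_add, ← Complex.exp_add, hw]
    congr 1
    ring
  have hmain : Real.pi * besselJ ν ζ = Real.sqrt (Real.pi / 2) * Complex.exp (-ζ / 2) *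
      (km * Complex.exp (w * Complex.I) + kp * Complex.exp (-w * Complex.I)) := by
    refine mul_left_cancel₀ hI0 ?_
    linear_combination hcon + km * Real.sqrt (Real.pi / 2) * hX - kp * Real.sqrt (Real.pi / 2) * hY
  refine mul_left_cancel₀ hpi ?_
  rw [hmain, Complex.cos, Complex.sin]
  generalize Complex.exp (w * Complex.I) = X
  generalize Complex.exp (-w * Complex.I) = Y
  generalize Complex.exp (-ζ / 2) = e
  linear_combination -(1 / 2) * e * (km * X + kp * Y) * hss +
    (Real.pi * Real.sqrt (2 / Real.pi) * e * (Y - X) * (kp - km) / 4 : ℂ) * hI2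

end

end HankelBessel

/-!
Why the bounds hold. Let `p = N + max (0, 1/2 - |ν|)`. The key is that `R_N^{(K)}` is an average of
terminants: there is a probability measure `ρ` on `[1, ∞)`, depending on `N` and `ν` only, with
`R_N^{(K)}(z, ν) = a_N(ν) z^{-N} ∫ Λ_p(2zr) dρ(r)` for `|arg z| < 3π/2` (`exists_measure_remK`).
Inserting `z e^{±πi/2}` turns this into the same formula for `R_N^{(J)}`, with `Π_p` in place of
`Λ_p` and up to a factor of modulus one (`norm_remJ_eq`). The bounds follow, since `Λ_p` is bounded
on closed subsectors of `|arg w| < 3π/2` (`exists_norm_terminantL_le`); for this, the path of the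
incomplete gamma function is rotated, which writes `Λ_p` as an absolutely convergent integral along
a ray.

For `z = x > 0`, the average arises in three steps. Let
`k(x) = (2x/π)^{1/2} e^x K_ν(x)` (`normK`).

* The remainder of the expansion of `k` is a Stieltjes transform,
  `a_N(ν) x^{-N} ∫ m(t) x/(x+t) dt / ∫ m(t) dt` with `m(t) = t^{N-1} e^{-2t} k(t)`
  (`normK_sub_hankelSum`). Both `k` and the truncated expansion plus this candidate tend to `1` at
  infinity. The first solves `x² (T'' - 2T') = (ν² - 1/4) T`; so does the second, since applying
  the operator under the integral sign and integrating by parts leaves a multiple of `∫ m`, which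
  cancels the only term left over by the truncated expansion (`stieltjesK_relation`,
  `hankelSum_ode`). Hence the Wronskian is constant, and it vanishes at infinity
  (`eq_normK_of_ode`).
* The function `t^{-max (0, 1/2 - |ν|)} e^{-2t} k(t)` is the Laplace transform, in `2t`, of a
  positive measure on `[1, ∞)` (`exists_measure_normK`). For `|ν| ≥ 1/2` this holds because
  `cosh (νσ) / cosh (σ/2)` is increasing, and its derivative multiplies complementary error
  functions in the integral for `K_ν`. For `|ν| < 1/2` it comes from a power of `τ` in the integral
  `∫ τ^{ν-1} e^{-τ-q/τ} dτ`, written as a Laplace integral itself, and the elementary case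
  `ν = 1/2`.
* Since `∫ t^{p-1} e^{-2rt} x/(x+t) dt = (2r)^{-p} Γ(p) Λ_p(2rx)`, an exchange of integrations
  gives the average (`exists_measure_remainder`).

Both sides are holomorphic in `log z` on the strip, `K_ν` being entire there also at integer orders
(`differentiable_besselK`), so that the formula extends from the positive half-line. That `K_ν`, as
defined from the series of `I_ν`, is given by its classical integrals is shown for `0 < ν < 1` by
comparing Wronskians (`macdonald_eq_besselSeries`), and for all orders by analytic continuation in
the order (`besselK_log_eq_mellin`, `besselK_log`).
-/

namespace HankelBessel

open Filter Topology MeasureTheory Set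

/-! ### The terminant `Λ_p` as an entire function of the logarithm -/

theorem integrableOn_cpow_mul_exp_neg (a : ℂ) {c : ℝ} (hc : 0 < c) :
    IntegrableOn (fun t : ℝ => (t : ℂ) ^ (a - 1) * Complex.exp (-t)) (Ioi c) := by
  have h1 : IntegrableOn (fun t : ℝ => Real.exp (-t) * t ^ (a.re - 1)) (Ioi c) := by
    refine integrable_of_isBigO_exp_neg (b := 1 / 2) (by norm_num) ?_ ?_
    · refine ContinuousOn.mul (by fun_prop) (ContinuousOn.rpow_const continuousOn_id ?_)
      intro x hx
      exact Or.inl (hc.trans_le hx).ne'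
    · exact (Real.Gamma_integrand_isLittleO (a.re - 1)).isBigO
  refine Integrable.mono' h1 ?_ ?_
  · refine ContinuousOn.aestronglyMeasurable ?_ measurableSet_Ioi
    refine ContinuousOn.mul (ContinuousOn.cpow_const (by fun_prop) ?_) (by fun_prop)
    intro x hx
    exact Complex.ofReal_mem_slitPlane.2 (hc.trans hx)
  · refine (ae_restrict_iff' measurableSet_Ioi).2 (ae_of_all _ fun t ht => ?_)
    have ht0 : 0 < t := hc.trans ht
    rw [norm_mul, Complex.norm_cpow_eq_rpow_re_of_pos ht0, ← Complex.ofReal_neg,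
      Complex.norm_exp_ofReal, mul_comm]
    simp

/-- The path in the definition of the incomplete gamma function may be deformed: both pieces of it
are integrals of the entire function `e^{az} e^{-e^z}` in the variable `z = log t`. -/
theorem hasDerivAt_incGamma (a ω : ℂ) :
    HasDerivAt (incGamma a) (-(Complex.exp (a * ω) * Complex.exp (-Complex.exp ω))) ω := by
  let g : ℂ → ℂ := fun z => Complex.exp (a * z) * Complex.exp (-Complex.exp z)
  have hg : Differentiable ℂ g := by fun_prop
  -- a primitive of the integrand in the variable `log t`
  obtain ⟨G, hG⟩ := hg.isExactOn_univ
  replace hG : ∀ z, HasDerivAt G (g z) z := fun z => hG z (mem_univ z)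
  have hreal : ∀ x : ℝ, (∫ t in Ioi (Real.exp 0), (t : ℂ) ^ (a - 1) * Complex.exp (-t)) -
      (∫ t in Ioi (Real.exp x), (t : ℂ) ^ (a - 1) * Complex.exp (-t)) = G x - G 0 := by
    intro x
    have key : ∀ y : ℝ, (Real.exp y) • ((Real.exp y : ℂ) ^ (a - 1) * Complex.exp (-Real.exp y)) =
        g y := by
      intro y
      have h1 : (Real.exp y : ℂ) ≠ 0 := by exact_mod_cast (Real.exp_pos y).ne'
      rw [Complex.real_smul, ← mul_assoc, Complex.cpow_sub _ _ h1, Complex.cpow_one,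
        mul_div_cancel₀ _ h1, Complex.cpow_def_of_ne_zero h1, Complex.ofReal_exp,
        ← Complex.ofReal_exp, ← Complex.ofReal_log (Real.exp_pos y).le, Real.log_exp]
      simp only [g, Complex.ofReal_exp]
      rw [mul_comm a]
    have hint : ∀ y : ℝ, IntegrableOn (fun s : ℝ => g s) (Ioi y) := by
      intro y
      have := (integrableOn_comp_exp_Ioi
        (fun t : ℝ => (t : ℂ) ^ (a - 1) * Complex.exp (-t)) y).2
        (integrableOn_cpow_mul_exp_neg a (Real.exp_pos y))
      simpa only [key] using this
    rw [← integral_comp_exp_Ioi, ← integral_comp_exp_Ioi]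
    simp only [key]
    rw [intervalIntegral.integral_Ioi_sub_Ioi' (hint 0) (hint x),
      intervalIntegral.integral_eq_sub_of_hasDerivAt (f := fun s : ℝ => G s)]
    · simp
    · intro s _
      exact (hG s).comp_ofReal
    · exact (hg.continuous.comp Complex.continuous_ofReal).intervalIntegrable _ _
  have himag : ∀ x y : ℝ, (∫ θ in (0 : ℝ)..y, Complex.exp (a * (x + Complex.I * θ)) *
      Complex.exp (-Complex.exp (x + Complex.I * θ)) * Complex.I) =
      G (x + Complex.I * y) - G x := by
    intro x y
    rw [intervalIntegral.integral_eq_sub_of_hasDerivAt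
      (f := fun s : ℝ => G (x + Complex.I * s))]
    · simp
    · intro s _
      have h1 : HasDerivAt (fun s : ℝ => (x : ℂ) + Complex.I * s) Complex.I s := by
        have := ((hasDerivAt_id (s : ℂ)).const_mul Complex.I).const_add (x : ℂ)
        simpa using this.comp_ofReal
      have := (hG (x + Complex.I * s)).comp_of_eq s h1 rfl
      exact this
    · exact Continuous.intervalIntegrable (by fun_prop) _ _
  have hfun : incGamma a = fun z =>
      ((∫ t in Ioi (Real.exp 0), (t : ℂ) ^ (a - 1) * Complex.exp (-t)) + G 0) - G z := by
    funext z
    unfold incGamma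
    have h2 : (z.re : ℂ) + Complex.I * z.im = z := by
      rw [mul_comm]; exact Complex.re_add_im z
    rw [himag, h2]
    linear_combination -hreal z.re
  rw [hfun]
  exact (hG ω).const_sub _

theorem differentiable_terminantL (p : ℂ) : Differentiable ℂ (terminantL p) := by
  have h : Differentiable ℂ (incGamma (1 - p)) := fun ω =>
    (hasDerivAt_incGamma _ ω).differentiableAt
  unfold terminantL
  fun_prop

/-! ### Integral representations of `Λ_p` on rotated rays -/

/-- `∫_0^∞ e^{-sv} (1 + cv)^{-p} dv`. For `c = e^{-iθ}` and `s = e^{ω - iθ}`, it is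
`Λ_p(e^ω) / s`, by rotation of the path of integration. -/
noncomputable def rayIntegral (p : ℝ) (c s : ℂ) : ℂ :=
  ∫ v in Ioi (0 : ℝ), Complex.exp (-s * v) * (1 + c * v) ^ ((-p : ℝ) : ℂ)

/-- For `c ≠ -1`, the ray of the points `1 + cv`, `v ≥ 0`, stays away from the origin. -/
theorem norm_one_add_mul_ge {c : ℂ} (hc : ‖c‖ = 1) (v : ℝ) :
    Real.sqrt ((1 + c.re) / 2) * (1 + v) ≤ ‖1 + c * v‖ := by
  have h1 : c.re ^ 2 + c.im ^ 2 = 1 := by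
    have := Complex.sq_norm c
    rw [hc, Complex.normSq_apply] at this
    linarith
  have h2 : c.re ≤ 1 := by nlinarith [sq_nonneg c.im]
  have h3 : -1 ≤ c.re := by nlinarith [sq_nonneg c.im]
  refine le_of_sq_le_sq ?_ (norm_nonneg _)
  rw [mul_pow, Real.sq_sqrt (by linarith), Complex.sq_norm, Complex.normSq_apply]
  simp only [Complex.add_re, Complex.one_re, Complex.mul_re, Complex.ofReal_re, Complex.ofReal_im,
    Complex.add_im, Complex.one_im, Complex.mul_im]
  nlinarith [mul_nonneg (sub_nonneg.2 h2) (sq_nonneg (1 - v))]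

theorem one_add_mul_mem_slitPlane {c : ℂ} (hc : ‖c‖ = 1) (hc1 : -1 < c.re) {v : ℝ} (hv : 0 ≤ v) :
    1 + c * v ∈ Complex.slitPlane := by
  by_cases h : c.im = 0
  · left
    have h1 : c.re ^ 2 = 1 := by
      have := Complex.sq_norm c
      rw [hc, Complex.normSq_apply, h] at this
      linarith
    have h2 : c.re = 1 := by nlinarith
    simp [h2]; linarith
  · rcases hv.eq_or_lt with rfl | hv
    · simp
    · right
      simp [h, hv.ne']

theorem norm_one_add_mul_cpow_le {p : ℝ} (hp : 0 ≤ p) {c : ℂ} (hc : ‖c‖ = 1) (hc1 : -1 < c.re)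
    {v : ℝ} (hv : 0 ≤ v) :
    ‖(1 + c * v) ^ ((-p : ℝ) : ℂ)‖ ≤ Real.sqrt ((1 + c.re) / 2) ^ (-p) := by
  have hd : 0 < Real.sqrt ((1 + c.re) / 2) := Real.sqrt_pos.2 (by linarith)
  rw [Complex.norm_cpow_real]
  refine Real.rpow_le_rpow_of_nonpos hd ?_ (by linarith)
  refine le_trans ?_ (norm_one_add_mul_ge hc v)
  nlinarith

theorem continuousOn_rayIntegrand (p : ℝ) {c : ℂ} (hc : ‖c‖ = 1) (hc1 : -1 < c.re) (s : ℂ) :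
    ContinuousOn (fun v : ℝ => Complex.exp (-s * v) * (1 + c * v) ^ ((-p : ℝ) : ℂ)) (Ici 0) := by
  refine ContinuousOn.mul (by fun_prop) (ContinuousOn.cpow_const (by fun_prop) ?_)
  intro v hv
  exact one_add_mul_mem_slitPlane hc hc1 hv

theorem norm_rayIntegrand_le {p : ℝ} (hp : 0 ≤ p) {c : ℂ} (hc : ‖c‖ = 1) (hc1 : -1 < c.re) (s : ℂ)
    {v : ℝ} (hv : 0 ≤ v) :
    ‖Complex.exp (-s * v) * (1 + c * v) ^ ((-p : ℝ) : ℂ)‖ ≤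
      Real.sqrt ((1 + c.re) / 2) ^ (-p) * Real.exp (-s.re * v) := by
  rw [norm_mul, Complex.norm_exp, mul_comm]
  refine mul_le_mul (norm_one_add_mul_cpow_le hp hc hc1 hv) ?_ (by positivity) (by positivity)
  simp

theorem integrableOn_mul_exp_neg {b : ℝ} (hb : 0 < b) :
    IntegrableOn (fun v : ℝ => v * Real.exp (-b * v)) (Ioi 0) := by
  have := integrableOn_rpow_mul_exp_neg_mul_rpow (p := 1) (s := 1) (by norm_num) one_pos hb
  simpa using this

/-- The first order differential equation in `s`, by integration by parts in `v`. -/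
theorem hasDerivAt_rayIntegral {p : ℝ} (hp : 0 ≤ p) {c s : ℂ} (hc : ‖c‖ = 1) (hc1 : -1 < c.re)
    (hs : 0 < s.re) :
    HasDerivAt (rayIntegral p c)
      (((s - c * (1 - p)) * rayIntegral p c s - 1) / (s * c)) s := by
  set B := Real.sqrt ((1 + c.re) / 2) ^ (-p) with hB
  have hB0 : 0 ≤ B := by positivity
  have hc0 : c ≠ 0 := by rintro rfl; simp at hc
  have hs0 : s ≠ 0 := by rintro rfl; simp at hs
  have hintF : ∀ z : ℂ, 0 < z.re → IntegrableOn
      (fun v : ℝ => Complex.exp (-z * v) * (1 + c * v) ^ ((-p : ℝ) : ℂ)) (Ioi 0) := by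
    intro z hz
    refine Integrable.mono' ((exp_neg_integrableOn_Ioi 0 hz).const_mul B)
      (((continuousOn_rayIntegrand p hc hc1 z).mono Ioi_subset_Ici_self).aestronglyMeasurable
        measurableSet_Ioi) ?_
    refine (ae_restrict_iff' measurableSet_Ioi).2 (ae_of_all _ fun v hv => ?_)
    exact norm_rayIntegrand_le hp hc hc1 z (le_of_lt hv)
  have hnhds : {z : ℂ | s.re / 2 < z.re} ∈ 𝓝 s :=
    (isOpen_lt continuous_const Complex.continuous_re).mem_nhds (by simp; linarith)
  have hder := hasDerivAt_integral_of_dominated_loc_of_deriv_le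
    (μ := volume.restrict (Ioi (0 : ℝ)))
    (F := fun (z : ℂ) (v : ℝ) => Complex.exp (-z * v) * (1 + c * v) ^ ((-p : ℝ) : ℂ))
    (F' := fun (z : ℂ) (v : ℝ) => -v * (Complex.exp (-z * v) * (1 + c * v) ^ ((-p : ℝ) : ℂ)))
    (bound := fun v => B * (v * Real.exp (-(s.re / 2) * v))) (x₀ := s) hnhds
    (Eventually.of_forall fun z =>
      ((continuousOn_rayIntegrand p hc hc1 z).mono Ioi_subset_Ici_self).aestronglyMeasurable
        measurableSet_Ioi) (hintF s hs)
    ((ContinuousOn.mul (by fun_prop)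
      ((continuousOn_rayIntegrand p hc hc1 s).mono Ioi_subset_Ici_self)).aestronglyMeasurable
        measurableSet_Ioi)
    ((ae_restrict_iff' measurableSet_Ioi).2 (ae_of_all _ fun v hv z hz => by
      have hv0 : (0 : ℝ) ≤ v := le_of_lt hv
      have h1 := norm_rayIntegrand_le hp hc hc1 z hv0
      have h2 : Real.exp (-z.re * v) ≤ Real.exp (-(s.re / 2) * v) := by
        refine Real.exp_le_exp.2 ?_
        have : s.re / 2 < z.re := hz
        nlinarith
      rw [norm_mul, norm_neg, Complex.norm_real, Real.norm_of_nonneg hv0]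
      calc _ ≤ v * (B * Real.exp (-(s.re / 2) * v)) := by gcongr; exact h1.trans (by gcongr)
        _ = _ := by ring))
    ((integrableOn_mul_exp_neg (half_pos hs)).const_mul B)
    (ae_of_all _ fun v z _ => by
      have h1 : HasDerivAt (fun z : ℂ => -z * (v : ℂ)) (-v) z := by
        simpa using ((hasDerivAt_id z).neg.mul_const (v : ℂ))
      have := h1.cexp.mul_const ((1 + c * v) ^ ((-p : ℝ) : ℂ))
      exact this.congr_deriv (by ring))
  obtain ⟨hint', hder⟩ := hder
  -- integration by parts
  have hP : ∀ v ∈ Ici (0 : ℝ), HasDerivAt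
      (fun v : ℝ => Complex.exp (-s * v) * (1 + c * v) ^ (((-p : ℝ) : ℂ) + 1))
      (s * c * (-v * (Complex.exp (-s * v) * (1 + c * v) ^ ((-p : ℝ) : ℂ))) +
        (c * (1 - p) - s) * (Complex.exp (-s * v) * (1 + c * v) ^ ((-p : ℝ) : ℂ))) v := by
    intro v hv
    have hsl := one_add_mul_mem_slitPlane hc hc1 hv
    have h1 : HasDerivAt (fun z : ℂ => -s * z) (-s) (v : ℂ) := by
      simpa using (hasDerivAt_id (v : ℂ)).const_mul (-s)
    have h2 : HasDerivAt (fun z : ℂ => 1 + c * z) c (v : ℂ) := by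
      simpa using ((hasDerivAt_id (v : ℂ)).const_mul c).const_add 1
    have h3 := (h1.cexp.mul (h2.cpow_const (c := ((-p : ℝ) : ℂ) + 1) hsl)).comp_ofReal
    refine h3.congr_deriv ?_
    rw [add_sub_cancel_right, Complex.cpow_add _ _ (Complex.slitPlane_ne_zero hsl),
      Complex.cpow_one]
    push_cast
    ring
  have hlim : Tendsto (fun v : ℝ => Complex.exp (-s * v) * (1 + c * v) ^ (((-p : ℝ) : ℂ) + 1))
      atTop (𝓝 0) := by
    have h0 : Tendsto (fun v : ℝ => B * (Real.exp (-s.re * v) + v * Real.exp (-s.re * v)))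
        atTop (𝓝 0) := by
      have e1 : Tendsto (fun v : ℝ => v ^ (0 : ℝ) * Real.exp (-s.re * v)) atTop (𝓝 0) :=
        tendsto_rpow_mul_exp_neg_mul_atTop_nhds_zero 0 s.re hs
      have e2 : Tendsto (fun v : ℝ => v ^ (1 : ℝ) * Real.exp (-s.re * v)) atTop (𝓝 0) :=
        tendsto_rpow_mul_exp_neg_mul_atTop_nhds_zero 1 s.re hs
      simpa using (e1.add e2).const_mul B
    refine squeeze_zero_norm' ?_ h0
    filter_upwards [eventually_ge_atTop 0] with v hv
    have hsl := one_add_mul_mem_slitPlane hc hc1 hv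
    rw [Complex.cpow_add _ _ (Complex.slitPlane_ne_zero hsl), Complex.cpow_one, ← mul_assoc,
      norm_mul]
    have h1 := norm_rayIntegrand_le hp hc hc1 s hv
    have h2 : ‖1 + c * v‖ ≤ 1 + v := by
      refine (norm_add_le _ _).trans ?_
      simp [hc, abs_of_nonneg hv]
    calc _ ≤ B * Real.exp (-s.re * v) * (1 + v) := by gcongr
      _ = _ := by ring
  have hparts := integral_Ioi_of_hasDerivAt_of_tendsto' hP
    ((hint'.const_mul (s * c)).add ((hintF s hs).const_mul (c * (1 - p) - s))) hlim
  rw [integral_add (hint'.const_mul (s * c)) ((hintF s hs).const_mul (c * (1 - p) - s)),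
    integral_const_mul, integral_const_mul] at hparts
  simp only [Complex.ofReal_zero, mul_zero, Complex.exp_zero, add_zero, Complex.one_cpow,
    mul_one] at hparts
  refine hder.congr_deriv ?_
  rw [eq_div_iff (mul_ne_zero hs0 hc0)]
  unfold rayIntegral
  linear_combination hparts

theorem norm_rayIntegral_le {p : ℝ} (hp : 0 ≤ p) {c s : ℂ} (hc : ‖c‖ = 1) (hc1 : -1 < c.re)
    (hs : 0 < s.re) :
    ‖rayIntegral p c s‖ ≤ Real.sqrt ((1 + c.re) / 2) ^ (-p) / s.re := by
  unfold rayIntegral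
  refine (norm_integral_le_of_norm_le ((exp_neg_integrableOn_Ioi 0 hs).const_mul _)
    ((ae_restrict_iff' measurableSet_Ioi).2 (ae_of_all _ fun v hv =>
      norm_rayIntegrand_le hp hc hc1 s (le_of_lt hv)))).trans (le_of_eq ?_)
  rw [integral_const_mul, integral_exp_mul_Ioi (by linarith)]
  simp [div_eq_mul_inv]

/-- Both `Λ_p` and its integral along the ray of argument `-θ` solve `y' = (p + w) y - w` in
`log w`, so that their difference is a constant multiple of `w^p e^w` for `|arg w - θ| < π / 2`. -/
theorem terminantL_sub_rayIntegral_const {p : ℝ} (hp : 0 ≤ p) {θ : ℝ} (hθ : |θ| < Real.pi) :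
    ∃ C : ℂ, ∀ ω : ℂ, |ω.im - θ| < Real.pi / 2 →
      Complex.exp (-(p * ω)) * Complex.exp (-Complex.exp ω) *
        (terminantL p ω - Complex.exp (ω - Complex.I * θ) *
          rayIntegral p (Complex.exp (-(Complex.I * θ)))
            (Complex.exp (ω - Complex.I * θ))) = C := by
  set c := Complex.exp (-(Complex.I * θ)) with hcdef
  have hc : ‖c‖ = 1 := by rw [hcdef, Complex.norm_exp]; simp
  have hc1 : -1 < c.re := by
    have h1 : c.re = Real.cos θ := by
      rw [hcdef, Complex.exp_re]; simp
    rw [h1, ← Real.cos_abs θ, ← Real.cos_pi]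
    exact Real.cos_lt_cos_of_nonneg_of_le_pi (abs_nonneg _) le_rfl hθ
  set U : Set ℂ := {ω : ℂ | |ω.im - θ| < Real.pi / 2} with hU
  have hUo : IsOpen U := by
    refine isOpen_lt ?_ continuous_const
    exact (Complex.continuous_im.sub continuous_const).abs
  have hUc : IsPreconnected U := by
    have : U = Complex.imCLM ⁻¹' (Metric.ball θ (Real.pi / 2)) := by
      ext ω; simp [hU, Real.dist_eq]
    rw [this]
    exact ((convex_ball θ _).linear_preimage Complex.imLm).isPreconnected
  have hre : ∀ ω ∈ U, 0 < (Complex.exp (ω - Complex.I * θ)).re := by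
    intro ω hω
    rw [Complex.exp_re]
    refine mul_pos (Real.exp_pos _) (Real.cos_pos_of_mem_Ioo ?_)
    have := abs_lt.1 (show |ω.im - θ| < Real.pi / 2 from hω)
    simpa using this
  have hder : ∀ ω ∈ U, HasDerivAt (fun ω : ℂ =>
      Complex.exp (-(p * ω)) * Complex.exp (-Complex.exp ω) *
        (terminantL p ω - Complex.exp (ω - Complex.I * θ) *
          rayIntegral p c (Complex.exp (ω - Complex.I * θ)))) 0 ω := by
    intro ω hω
    have h1 : HasDerivAt (fun ω : ℂ => Complex.exp (ω - Complex.I * θ))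
        (Complex.exp (ω - Complex.I * θ)) ω := by
      simpa using ((hasDerivAt_id ω).sub_const (Complex.I * (θ : ℂ))).cexp
    have h2 := (hasDerivAt_rayIntegral hp hc hc1 (hre ω hω)).comp ω h1
    have h3 := h1.mul h2
    have h4 : HasDerivAt (fun ω : ℂ => Complex.exp (p * ω)) (p * Complex.exp (p * ω)) ω := by
      have := ((hasDerivAt_id ω).const_mul (p : ℂ)).cexp
      simpa [mul_comm] using this
    have h5 : HasDerivAt (fun ω : ℂ => Complex.exp (Complex.exp ω))
        (Complex.exp ω * Complex.exp (Complex.exp ω)) ω := by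
      simpa [mul_comm] using (Complex.hasDerivAt_exp ω).cexp
    have h6 : HasDerivAt (fun ω : ℂ => Complex.exp (-(p * ω))) (-p * Complex.exp (-(p * ω))) ω := by
      have := ((hasDerivAt_id ω).const_mul (p : ℂ)).neg.cexp
      simpa [mul_comm] using this
    have h7 : HasDerivAt (fun ω : ℂ => Complex.exp (-Complex.exp ω))
        (-Complex.exp ω * Complex.exp (-Complex.exp ω)) ω := by
      simpa [mul_comm] using (Complex.hasDerivAt_exp ω).neg.cexp
    have h8 := (h4.mul h5).mul (hasDerivAt_incGamma (1 - p) ω)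
    have h9 := (h6.mul h7).mul (h8.sub h3)
    refine h9.congr_deriv ?_
    have hE0 : Complex.exp (ω - Complex.I * θ) ≠ 0 := Complex.exp_ne_zero _
    have hc0 : c ≠ 0 := Complex.exp_ne_zero _
    have hsc : Complex.exp (ω - Complex.I * θ) = Complex.exp ω * c := by
      rw [hcdef, ← Complex.exp_add]; ring_nf
    have e1 : Complex.exp ((1 - p) * ω) = Complex.exp ω * Complex.exp (-(p * ω)) := by
      rw [← Complex.exp_add]; ring_nf
    have e2 : Complex.exp (p * ω) * Complex.exp (-(p * ω)) = 1 := by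
      rw [← Complex.exp_add]; simp
    have e3 : Complex.exp (Complex.exp ω) * Complex.exp (-Complex.exp ω) = 1 := by
      rw [← Complex.exp_add]; simp
    simp only [Pi.mul_apply, Function.comp_apply, Pi.sub_apply]
    rw [hsc, e1]
    have hX : Complex.exp ω ≠ 0 := Complex.exp_ne_zero _
    generalize rayIntegral p c (Complex.exp ω * c) = L
    generalize incGamma (1 - p) ω = Γ
    generalize Complex.exp (Complex.exp ω) = X1 at *
    generalize Complex.exp (-Complex.exp ω) = X2 at *
    generalize Complex.exp (p * ω) = Y1 at *
    generalize Complex.exp (-(p * ω)) = Y2 at *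
    generalize Complex.exp ω = E at *
    have e4 : E * c * (((E * c - c * (1 - p)) * L - 1) / (E * c * c) * (E * c)) =
        E * (((E * c - c * (1 - p)) * L - 1)) := by
      field_simp
    rw [e4]
    linear_combination (-E * Y2 * X2 * X1 * X2) * e2 - E * Y2 * X2 * e3
  obtain ⟨C, hC⟩ := hUo.exists_is_const_of_fderiv_eq_zero (𝕜 := ℂ) hUc
    (fun ω hω => (hder ω hω).differentiableAt.differentiableWithinAt)
    (fun ω hω => by
      simpa using (hder ω hω).hasFDerivAt.fderiv)
  exact ⟨C, fun ω hω => hC ω hω⟩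

/-- The ray integral is scale invariant up to the factor in front, so that the bound depends on the
argument of `w` only. -/
theorem norm_exp_mul_rayIntegral_le {p : ℝ} (hp : 0 ≤ p) {θ : ℝ} (hθ : |θ| < Real.pi) {ω : ℂ}
    (hω : |ω.im - θ| < Real.pi / 2) :
    ‖Complex.exp (ω - Complex.I * θ) *
      rayIntegral p (Complex.exp (-(Complex.I * θ))) (Complex.exp (ω - Complex.I * θ))‖ ≤
      Real.sqrt ((1 + Real.cos θ) / 2) ^ (-p) / Real.cos (ω.im - θ) := by
  set c := Complex.exp (-(Complex.I * θ)) with hcdef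
  have hc : ‖c‖ = 1 := by rw [hcdef, Complex.norm_exp]; simp
  have hcre : c.re = Real.cos θ := by
    rw [hcdef, Complex.exp_re]; simp
  have hc1 : -1 < c.re := by
    rw [hcre, ← Real.cos_abs θ, ← Real.cos_pi]
    exact Real.cos_lt_cos_of_nonneg_of_le_pi (abs_nonneg _) le_rfl hθ
  have hcos : 0 < Real.cos (ω.im - θ) :=
    Real.cos_pos_of_mem_Ioo (by simpa using abs_lt.1 hω)
  have hre : (Complex.exp (ω - Complex.I * θ)).re = Real.exp ω.re * Real.cos (ω.im - θ) := by
    rw [Complex.exp_re]; simp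
  have hpos : 0 < (Complex.exp (ω - Complex.I * θ)).re := by
    rw [hre]; exact mul_pos (Real.exp_pos _) hcos
  rw [norm_mul]
  have h1 := norm_rayIntegral_le hp hc hc1 hpos
  have h2 : ‖Complex.exp (ω - Complex.I * θ)‖ = Real.exp ω.re := by
    rw [Complex.norm_exp]; simp
  rw [h2]
  refine (mul_le_mul_of_nonneg_left h1 (Real.exp_pos _).le).trans (le_of_eq ?_)
  rw [hre, hcre]
  have := (Real.exp_pos ω.re).ne'
  field_simp

theorem tendsto_exp_neg_mul_exp_exp {κ : ℝ} (hκ : 0 < κ) {p : ℝ} (hp : 0 ≤ p) :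
    Tendsto (fun x : ℝ => Real.exp (-(p * x)) * Real.exp (-(Real.exp x * κ))) atTop (𝓝 0) := by
  have h1 : Tendsto (fun x : ℝ => Real.exp (-(Real.exp x * κ))) atTop (𝓝 0) :=
    Real.tendsto_exp_neg_atTop_nhds_zero.comp (Real.tendsto_exp_atTop.atTop_mul_const hκ)
  refine squeeze_zero' (Eventually.of_forall fun x => by positivity) ?_ h1
  filter_upwards [eventually_ge_atTop 0] with x hx
  refine mul_le_of_le_one_left (Real.exp_pos _).le (Real.exp_le_one_iff.2 ?_)
  have := mul_nonneg hp hx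
  linarith

theorem norm_exp_mul_exp_neg_exp (p x φ : ℝ) :
    ‖Complex.exp (-(p * (x + Complex.I * φ))) *
      Complex.exp (-Complex.exp (x + Complex.I * φ))‖ =
      Real.exp (-(p * x)) * Real.exp (-(Real.exp x * Real.cos φ)) := by
  rw [norm_mul, Complex.norm_exp, Complex.norm_exp]
  simp [Complex.exp_re]

/-- On the right half-plane, `Λ_p` is an integral along the positive ray: `w^{-p} e^{-w}` tends
to `0` as `w → +∞`, and so does the incomplete gamma function. -/
theorem terminantL_eq_rayIntegral_zero {p : ℝ} (hp : 0 ≤ p) {ω : ℂ} (hω : |ω.im| < Real.pi / 2) :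
    terminantL p ω = Complex.exp ω * rayIntegral p 1 (Complex.exp ω) := by
  have hpi := Real.pi_pos
  obtain ⟨C, hC⟩ := terminantL_sub_rayIntegral_const hp (θ := 0) (by simpa using hpi)
  have hb : ∀ ω : ℂ, |ω.im - (0 : ℝ)| < Real.pi / 2 → _ := fun ω hω =>
    norm_exp_mul_rayIntegral_le hp (θ := 0) (by simpa using hpi) hω
  simp only [Complex.ofReal_zero, mul_zero, neg_zero, Complex.exp_zero, sub_zero] at hC hb
  have hC0 : C = 0 := by
    have h1 : ∀ x : ℝ, C = incGamma (1 - p) x - Complex.exp (-(p * (x + Complex.I * (0 : ℝ)))) *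
        Complex.exp (-Complex.exp (x + Complex.I * (0 : ℝ))) *
        (Complex.exp x * rayIntegral p 1 (Complex.exp x)) := by
      intro x
      rw [← hC x (by simpa using hpi), terminantL]
      have e2 : Complex.exp (p * x) * Complex.exp (-(p * x)) = 1 := by
        rw [← Complex.exp_add]; simp
      have e3 : Complex.exp (Complex.exp x) * Complex.exp (-Complex.exp x) = 1 := by
        rw [← Complex.exp_add]; simp
      simp only [Complex.ofReal_zero, mul_zero, add_zero]
      linear_combination (-(Complex.exp (Complex.exp x) * Complex.exp (-Complex.exp x)) * e2 -
        e3) * (-incGamma (1 - p) x)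
    have h2 : Tendsto (fun x : ℝ => incGamma (1 - p) x) atTop (𝓝 0) := by
      have := tendsto_integral_Ioi_zero (μ := volume)
        (f := fun t : ℝ => (t : ℂ) ^ ((1 - p : ℂ) - 1) * Complex.exp (-t)) Real.tendsto_exp_atTop
      refine this.congr fun x => ?_
      simp [incGamma]
    have h3 : Tendsto (fun x : ℝ => Complex.exp (-(p * (x + Complex.I * (0 : ℝ)))) *
        Complex.exp (-Complex.exp (x + Complex.I * (0 : ℝ))) *
        (Complex.exp x * rayIntegral p 1 (Complex.exp x))) atTop (𝓝 0) := by
      have h4 := (tendsto_exp_neg_mul_exp_exp one_pos hp).mul_const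
        (Real.sqrt ((1 + Real.cos 0) / 2) ^ (-p) / Real.cos 0)
      rw [zero_mul] at h4
      refine squeeze_zero_norm (fun x => ?_) h4
      rw [norm_mul, norm_exp_mul_exp_neg_exp, Real.cos_zero]
      refine mul_le_mul_of_nonneg_left ?_ (by positivity)
      simpa using hb x (by simpa using hpi)
    have h5 := h2.sub h3
    rw [sub_zero] at h5
    exact tendsto_nhds_unique (tendsto_const_nhds.congr h1) h5
  have h := hC ω (by simpa using hω)
  rw [hC0] at h
  exact sub_eq_zero.1 ((mul_eq_zero.1 h).resolve_left
    (mul_ne_zero (Complex.exp_ne_zero _) (Complex.exp_ne_zero _)))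

/-- `Λ_p` as an integral along the ray of argument `-θ`, for `|arg w - θ| < π / 2` and any
`|θ| < π`. -/
theorem terminantL_eq_rayIntegral {p : ℝ} (hp : 0 ≤ p) {θ : ℝ} (hθ : |θ| < Real.pi) {ω : ℂ}
    (hω : |ω.im - θ| < Real.pi / 2) :
    terminantL p ω = Complex.exp (ω - Complex.I * θ) *
      rayIntegral p (Complex.exp (-(Complex.I * θ))) (Complex.exp (ω - Complex.I * θ)) := by
  obtain ⟨C, hC⟩ := terminantL_sub_rayIntegral_const hp hθ
  have hpi := Real.pi_pos
  -- along the direction `arg w = θ / 2` both representations are available and bounded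
  have hhalf : |θ / 2| < Real.pi / 2 := by rw [abs_div, abs_two]; linarith
  have hhalf' : |θ / 2 - θ| < Real.pi / 2 := by
    rw [show θ / 2 - θ = -(θ / 2) by ring, abs_neg]; exact hhalf
  have hκ : 0 < Real.cos (θ / 2) := Real.cos_pos_of_mem_Ioo (by simpa using abs_lt.1 hhalf)
  have hC0 : C = 0 := by
    have h4 := (tendsto_exp_neg_mul_exp_exp hκ hp).mul_const
        (Real.sqrt ((1 + Real.cos 0) / 2) ^ (-p) / Real.cos (θ / 2) +
          Real.sqrt ((1 + Real.cos θ) / 2) ^ (-p) / Real.cos (θ / 2 - θ))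
    rw [zero_mul] at h4
    have h5 : ‖C‖ ≤ 0 := by
      refine ge_of_tendsto' h4 fun x => ?_
      have him : ((x : ℂ) + Complex.I * ((θ / 2 : ℝ) : ℂ)).im = θ / 2 := by simp
      rw [← hC (x + Complex.I * ((θ / 2 : ℝ) : ℂ)) (by rw [him]; exact hhalf'), norm_mul,
        norm_exp_mul_exp_neg_exp]
      refine mul_le_mul_of_nonneg_left ((norm_sub_le _ _).trans (add_le_add ?_ ?_)) (by positivity)
      · rw [terminantL_eq_rayIntegral_zero hp (by rw [him]; exact hhalf)]
        have := norm_exp_mul_rayIntegral_le hp (θ := 0)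
          (ω := x + Complex.I * ((θ / 2 : ℝ) : ℂ)) (by simpa using hpi)
          (by rw [him]; simpa using hhalf)
        rw [him] at this
        simpa only [Complex.ofReal_zero, mul_zero, neg_zero, Complex.exp_zero, sub_zero] using this
      · have := norm_exp_mul_rayIntegral_le hp hθ
          (ω := x + Complex.I * ((θ / 2 : ℝ) : ℂ)) (by rw [him]; exact hhalf')
        rw [him] at this
        exact this
    exact norm_le_zero_iff.1 h5
  have h := hC ω hω
  rw [hC0] at h
  exact sub_eq_zero.1 ((mul_eq_zero.1 h).resolve_left
    (mul_ne_zero (Complex.exp_ne_zero _) (Complex.exp_ne_zero _)))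

theorem norm_terminantL_le_of_abs_im_sub_le {p : ℝ} (hp : 0 ≤ p) {θ δ : ℝ} (hθ : |θ| < Real.pi)
    (hδ : 0 < δ) {ω : ℂ} (hω : |ω.im - θ| ≤ Real.pi / 2 - δ) :
    ‖terminantL p ω‖ ≤ Real.sqrt ((1 + Real.cos θ) / 2) ^ (-p) / Real.sin δ := by
  have hpi := Real.pi_pos
  rw [terminantL_eq_rayIntegral hp hθ (hω.trans_lt (by linarith))]
  refine (norm_exp_mul_rayIntegral_le hp hθ (hω.trans_lt (by linarith))).trans ?_
  have h0 : 0 ≤ |ω.im - θ| := abs_nonneg _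
  refine div_le_div_of_nonneg_left (by positivity)
    (Real.sin_pos_of_pos_of_lt_pi hδ (by linarith)) ?_
  rw [← Real.cos_pi_div_two_sub, ← Real.cos_abs (ω.im - θ)]
  exact Real.cos_le_cos_of_nonneg_of_le_pi h0 (by linarith) hω

/-- `Λ_p` is bounded on every closed subsector of `|arg w| < 3π / 2`. -/
theorem exists_norm_terminantL_le {p : ℝ} (hp : 0 ≤ p) {δ : ℝ} (hδ : 0 < δ) :
    ∃ C : ℝ, ∀ ω : ℂ, |ω.im| ≤ 3 * Real.pi / 2 - δ → ‖terminantL p ω‖ ≤ C := by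
  have hpi := Real.pi_pos
  set ε := min δ 1 with hε
  have hε0 : 0 < ε := lt_min hδ one_pos
  have hε1 : ε ≤ 1 := min_le_right _ _
  have hεδ : ε ≤ δ := min_le_left _ _
  have hpi3 := Real.pi_gt_three
  -- the rays of argument `0`, `-θ` and `θ` serve `|arg w| ≤ π/2 - ε/4` and the parts beyond it
  set θ := Real.pi - 3 / 4 * ε with hθ
  have hθ' : |θ| < Real.pi := by rw [abs_lt]; constructor <;> linarith
  have hθ'' : |-θ| < Real.pi := by rwa [abs_neg]
  refine ⟨max (Real.sqrt ((1 + Real.cos 0) / 2) ^ (-p) / Real.sin (ε / 4))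
    (Real.sqrt ((1 + Real.cos θ) / 2) ^ (-p) / Real.sin (ε / 4)), fun ω hω => ?_⟩
  have hω' := abs_le.1 hω
  by_cases h1 : |ω.im| ≤ Real.pi / 2 - ε / 4
  · refine le_max_of_le_left (norm_terminantL_le_of_abs_im_sub_le hp (by simpa using hpi)
      (by positivity) ?_)
    simpa using h1
  · refine le_max_of_le_right ?_
    rw [not_le] at h1
    rcases le_total 0 ω.im with h | h
    · rw [abs_of_nonneg h] at h1
      refine norm_terminantL_le_of_abs_im_sub_le hp hθ' (by positivity) ?_
      rw [abs_le]; constructor <;> linarith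
    · rw [abs_of_nonpos h] at h1
      rw [← Real.cos_neg θ]
      refine norm_terminantL_le_of_abs_im_sub_le hp hθ'' (by positivity) ?_
      rw [abs_le]; constructor <;> linarith

/-! ### `Λ_p` on the positive half-line -/

/-- `Λ_p(x)` for real `x > 0`, in the form `x ∫_0^∞ e^{-xv} (1 + v)^{-p} dv`. -/
noncomputable def terminantReal (p x : ℝ) : ℝ :=
  x * ∫ v in Ioi (0 : ℝ), Real.exp (-x * v) * (1 + v) ^ (-p)

theorem terminantL_log {p : ℝ} (hp : 0 ≤ p) {x : ℝ} (hx : 0 < x) :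
    terminantL p (Real.log x) = terminantReal p x := by
  rw [terminantL_eq_rayIntegral_zero hp (by simpa using Real.pi_pos), ← Complex.ofReal_exp,
    Real.exp_log hx, rayIntegral, terminantReal, Complex.ofReal_mul, ← integral_complex_ofReal]
  congr 1
  refine setIntegral_congr_fun measurableSet_Ioi fun v hv => ?_
  have hv0 : (0 : ℝ) < v := hv
  simp only [one_mul]
  rw [Complex.ofReal_mul, Complex.ofReal_cpow (by linarith)]
  push_cast
  rfl

theorem terminantReal_nonneg (p : ℝ) {x : ℝ} (hx : 0 ≤ x) : 0 ≤ terminantReal p x := by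
  refine mul_nonneg hx (setIntegral_nonneg measurableSet_Ioi fun v hv => ?_)
  have : (0 : ℝ) < v := hv
  positivity

theorem lintegral_exp_neg_mul {b : ℝ} (hb : 0 < b) :
    ∫⁻ t in Ioi (0 : ℝ), ENNReal.ofReal (Real.exp (-(b * t))) = ENNReal.ofReal (1 / b) := by
  have h : IntegrableOn (fun t : ℝ => Real.exp (-(b * t))) (Ioi 0) := by
    simpa using exp_neg_integrableOn_Ioi 0 hb
  rw [← ofReal_integral_eq_lintegral_ofReal h (ae_of_all _ fun t => (Real.exp_pos _).le)]
  have := integral_exp_mul_Ioi (a := -b) (by linarith) 0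
  simp only [neg_mul] at this
  rw [this]
  simp [neg_div_neg_eq]

theorem lintegral_rpow_mul_exp_neg_mul {a r : ℝ} (ha : 0 < a) (hr : 0 < r) :
    ∫⁻ t in Ioi (0 : ℝ), ENNReal.ofReal (t ^ (a - 1) * Real.exp (-(r * t))) =
      ENNReal.ofReal (r ^ (-a) * Real.Gamma a) := by
  have h : IntegrableOn (fun t : ℝ => t ^ (a - 1) * Real.exp (-(r * t))) (Ioi 0) := by
    simpa using integrableOn_rpow_mul_exp_neg_mul_rpow (p := 1) (s := a - 1) (b := r)
      (by linarith) one_pos hr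
  rw [← ofReal_integral_eq_lintegral_ofReal h, Real.integral_rpow_mul_exp_neg_mul_Ioi ha hr,
    one_div, Real.inv_rpow hr.le, Real.rpow_neg hr.le]
  refine (ae_restrict_iff' measurableSet_Ioi).2 (ae_of_all _ fun t ht => ?_)
  have : (0 : ℝ) < t := ht
  positivity

/-! ### The integral `∫_0^∞ τ^{s-1} e^{-τ-q/τ} dτ` -/

/-- `∫_0^∞ τ^{s-1} e^{-τ-q/τ} dτ`, which is `2 (x/2)^s K_s(x)` for `q = x² / 4`. -/
noncomputable def macdonald (s q : ℝ) : ℝ :=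
  ∫ τ in Ioi (0 : ℝ), τ ^ (s - 1) * Real.exp (-τ - q / τ)

/-- The factor `e^{-q/τ}` vanishes to all orders at `τ = 0`, so that the integral exists for
all `s`. -/
theorem exp_neg_div_le (n : ℕ) {q τ : ℝ} (hq : 0 < q) (hτ : 0 < τ) :
    Real.exp (-(q / τ)) ≤ n.factorial * (τ / q) ^ n := by
  have h1 := Real.pow_div_factorial_le_exp (x := q / τ) (by positivity) n
  have h2 : 0 < (q / τ) ^ n / n.factorial := by positivity
  rw [Real.exp_neg]
  refine (inv_anti₀ h2 h1).trans (le_of_eq ?_)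
  rw [inv_div, div_eq_mul_inv, ← inv_pow, inv_div]

theorem measurable_macdonald_integrand (s q : ℝ) :
    Measurable fun τ : ℝ => τ ^ (s - 1) * Real.exp (-τ - q / τ) := by
  fun_prop

theorem macdonald_integrand_le (s : ℝ) (n : ℕ) {q τ : ℝ} (hq : 0 < q) (hτ : 0 < τ) :
    τ ^ (s - 1) * Real.exp (-τ - q / τ) ≤
      n.factorial / q ^ n * (Real.exp (-τ) * τ ^ (s + n - 1)) := by
  have h1 := exp_neg_div_le n hq hτ
  rw [sub_eq_add_neg (-τ), Real.exp_add]
  calc τ ^ (s - 1) * (Real.exp (-τ) * Real.exp (-(q / τ)))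
      ≤ τ ^ (s - 1) * (Real.exp (-τ) * (n.factorial * (τ / q) ^ n)) := by gcongr
    _ = n.factorial / q ^ n * (Real.exp (-τ) * (τ ^ (s - 1) * τ ^ n)) := by
        rw [div_pow]; ring
    _ = _ := by
        rw [← Real.rpow_natCast τ n, ← Real.rpow_add hτ]
        ring_nf

theorem integrableOn_macdonald (s : ℝ) {q : ℝ} (hq : 0 < q) :
    IntegrableOn (fun τ : ℝ => τ ^ (s - 1) * Real.exp (-τ - q / τ)) (Ioi 0) := by
  obtain ⟨n, hn⟩ := exists_nat_gt (-s)
  have h := (Real.GammaIntegral_convergent (s := s + n) (by linarith)).const_mul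
    ((n.factorial : ℝ) / q ^ n)
  refine Integrable.mono' h (measurable_macdonald_integrand s q).aestronglyMeasurable ?_
  refine (ae_restrict_iff' measurableSet_Ioi).2 (ae_of_all _ fun τ hτ => ?_)
  have hτ0 : (0 : ℝ) < τ := hτ
  rw [Real.norm_of_nonneg (by positivity)]
  exact macdonald_integrand_le s n hq hτ0

theorem hasDerivAt_macdonald (s : ℝ) {q : ℝ} (hq : 0 < q) :
    HasDerivAt (macdonald s) (-macdonald (s - 1) q) q := by
  have h := hasDerivAt_integral_of_dominated_loc_of_deriv_le
    (μ := volume.restrict (Ioi (0 : ℝ)))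
    (F := fun (q τ : ℝ) => τ ^ (s - 1) * Real.exp (-τ - q / τ))
    (F' := fun (q τ : ℝ) => -(τ ^ (s - 1 - 1) * Real.exp (-τ - q / τ)))
    (bound := fun τ => τ ^ (s - 1 - 1) * Real.exp (-τ - (q / 2) / τ))
    (x₀ := q) (Ioi_mem_nhds (half_lt_self hq))
    (Eventually.of_forall fun q => (measurable_macdonald_integrand s q).aestronglyMeasurable)
    (integrableOn_macdonald s hq)
    (measurable_macdonald_integrand (s - 1) q).neg.aestronglyMeasurable
    ((ae_restrict_iff' measurableSet_Ioi).2 (ae_of_all _ fun τ hτ z hz => by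
      have hτ0 : (0 : ℝ) < τ := hτ
      have hz0 : q / 2 < z := hz
      rw [norm_neg, Real.norm_of_nonneg (by positivity)]
      gcongr))
    (integrableOn_macdonald (s - 1) (half_pos hq))
    ((ae_restrict_iff' measurableSet_Ioi).2 (ae_of_all _ fun τ hτ z _ => by
      have hτ0 : (0 : ℝ) < τ := hτ
      have h1 : HasDerivAt (fun z : ℝ => -τ - z / τ) (-(1 / τ)) z :=
        ((hasDerivAt_id z).div_const τ).const_sub (-τ)
      refine (h1.exp.const_mul (τ ^ (s - 1))).congr_deriv ?_
      rw [Real.rpow_sub_one hτ0.ne' (s - 1)]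
      ring))
  have h2 := h.2
  rw [integral_neg] at h2
  exact h2

/-- The substitution `τ ↦ q / τ`. -/
theorem macdonald_neg (s : ℝ) {q : ℝ} (hq : 0 < q) :
    macdonald (-s) q = q ^ (-s) * macdonald s q := by
  unfold macdonald
  rw [← integral_comp_rpow_Ioi (fun τ : ℝ => τ ^ (-s - 1) * Real.exp (-τ - q / τ))
    (p := -1) (by norm_num), ← integral_const_mul]
  have h := integral_comp_mul_left_Ioi' (fun τ : ℝ =>
    (|(-1 : ℝ)| * τ ^ ((-1 : ℝ) - 1)) • ((τ ^ (-1 : ℝ)) ^ (-s - 1) *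
      Real.exp (-τ ^ (-1 : ℝ) - q / τ ^ (-1 : ℝ)))) 0 (inv_pos.2 hq)
  rw [mul_zero] at h
  rw [← h, smul_eq_mul, ← integral_const_mul]
  refine setIntegral_congr_fun measurableSet_Ioi fun τ hτ => ?_
  have hτ0 : (0 : ℝ) < τ := hτ
  have hiq : (0 : ℝ) < q⁻¹ * τ := by positivity
  have e1 : (q⁻¹ * τ) ^ ((-1 : ℝ) - 1) * ((q⁻¹ * τ) ^ (-1 : ℝ)) ^ (-s - 1) =
      (q⁻¹ * τ) ^ (s - 1) := by
    rw [← Real.rpow_mul hiq.le, ← Real.rpow_add hiq]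
    ring_nf
  have e2 : -(q⁻¹ * τ) ^ (-1 : ℝ) - q / (q⁻¹ * τ) ^ (-1 : ℝ) = -τ - q / τ := by
    rw [Real.rpow_neg_one]
    field_simp
    ring
  have e3 : q⁻¹ * (q⁻¹ * τ) ^ (s - 1) = q ^ (-s) * τ ^ (s - 1) := by
    rw [Real.mul_rpow (inv_pos.2 hq).le hτ0.le, Real.inv_rpow hq.le, ← Real.rpow_neg hq.le,
      ← Real.rpow_neg_one q, ← mul_assoc, ← Real.rpow_add hq]
    congr 2
    ring
  simp only [smul_eq_mul, abs_neg, abs_one, one_mul]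
  rw [e2]
  linear_combination (q⁻¹ * Real.exp (-τ - q / τ)) * e1 + Real.exp (-τ - q / τ) * e3

theorem tendsto_macdonald_zero {s : ℝ} (hs : 0 < s) :
    Tendsto (macdonald s) (𝓝[>] 0) (𝓝 (Real.Gamma s)) := by
  rw [Real.Gamma_eq_integral hs]
  refine tendsto_integral_filter_of_dominated_convergence
    (fun τ : ℝ => Real.exp (-τ) * τ ^ (s - 1))
    (Eventually.of_forall fun q => (measurable_macdonald_integrand s q).aestronglyMeasurable) ?_
    (Real.GammaIntegral_convergent hs) ?_
  · filter_upwards [self_mem_nhdsWithin] with q hq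
    have hq0 : (0 : ℝ) < q := hq
    refine (ae_restrict_iff' measurableSet_Ioi).2 (ae_of_all _ fun τ hτ => ?_)
    have hτ0 : (0 : ℝ) < τ := hτ
    rw [Real.norm_of_nonneg (by positivity), mul_comm]
    gcongr
    have : 0 ≤ q / τ := by positivity
    linarith
  · refine ae_of_all _ fun τ => ?_
    have h : Continuous fun q : ℝ => τ ^ (s - 1) * Real.exp (-τ - q / τ) := by fun_prop
    have := (h.tendsto 0).mono_left (nhdsWithin_le_nhds (s := Ioi 0))
    simpa [mul_comm] using this

/-! ### The series of the modified Bessel function of the first kind -/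

/-- The series `∑ q^k / (k! Γ(σ+k+1))`, so that `I_σ(x) = (x/2)^σ besselSeries σ (x²/4)`. -/
noncomputable def besselSeries (σ q : ℝ) : ℝ :=
  ∑' k : ℕ, q ^ k / (k.factorial * Real.Gamma (σ + k + 1))

theorem exists_abs_inv_Gamma_le (σ : ℝ) :
    ∃ C : ℝ, 0 ≤ C ∧ ∀ k : ℕ, |(Real.Gamma (σ + k + 1))⁻¹| ≤ C := by
  obtain ⟨C, hC⟩ := bounded_one_div_Gamma |σ|
  have h : ∀ k : ℕ, |(Real.Gamma (σ + k + 1))⁻¹| ≤ C := by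
    intro k
    have := hC k σ (by simp)
    rw [show ((σ : ℂ) + k + 1) = ((σ + k + 1 : ℝ) : ℂ) by push_cast; rfl, Complex.Gamma_ofReal,
      ← Complex.ofReal_inv, Complex.norm_real] at this
    exact this
  exact ⟨C, (abs_nonneg _).trans (h 0), h⟩

theorem summable_besselSeries (σ q : ℝ) :
    Summable fun k : ℕ => q ^ k / (k.factorial * Real.Gamma (σ + k + 1)) := by
  obtain ⟨C, hC0, hC⟩ := exists_abs_inv_Gamma_le σ
  refine Summable.of_norm_bounded ((Real.summable_pow_div_factorial |q|).mul_left C) fun k => ?_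
  have h := hC k
  rw [Real.norm_eq_abs, ← div_div, div_eq_mul_inv _ (Real.Gamma _), abs_mul, abs_div, abs_pow,
    Nat.abs_cast, mul_comm]
  gcongr

theorem hasDerivAt_besselSeries (σ q : ℝ) :
    HasDerivAt (besselSeries σ) (besselSeries (σ + 1) q) q := by
  obtain ⟨C, hC0, hC⟩ := exists_abs_inv_Gamma_le σ
  set R := |q| + 1 with hR
  have hR0 : 0 ≤ R := by positivity
  have hterm : ∀ (k : ℕ) (y : ℝ), HasDerivAt
      (fun y : ℝ => y ^ k / (k.factorial * Real.Gamma (σ + k + 1)))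
      (k * y ^ (k - 1) / (k.factorial * Real.Gamma (σ + k + 1))) y := fun k y =>
    (hasDerivAt_pow k y).div_const _
  have hu : Summable fun k : ℕ => C * (k * R ^ (k - 1) / k.factorial) := by
    refine Summable.mul_left C ((summable_nat_add_iff 1).1 ?_)
    refine (Real.summable_pow_div_factorial R).congr fun k => ?_
    rw [Nat.factorial_succ, Nat.add_sub_cancel]
    push_cast
    field_simp
  have h := hasDerivAt_tsum_of_isPreconnected (t := Metric.ball (0 : ℝ) R) hu Metric.isOpen_ball
    (convex_ball _ _).isPreconnected (fun k y _ => hterm k y) (fun k y hy => by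
      have h1 := hC k
      have h2 : |y| ≤ R := by simpa using (Metric.mem_ball.1 hy).le
      rw [Real.norm_eq_abs, ← div_div, div_eq_mul_inv _ (Real.Gamma _), abs_mul, abs_div, abs_mul,
        abs_pow, Nat.abs_cast, Nat.abs_cast, mul_comm C]
      gcongr) (y₀ := 0) (y := q) (by simp; positivity) (summable_besselSeries σ 0)
    (by simp [hR])
  refine h.congr_deriv ?_
  have hs : Summable fun k : ℕ => (k * q ^ (k - 1) / (k.factorial * Real.Gamma (σ + k + 1))) := by
    refine Summable.of_norm_bounded hu fun k => ?_
    have h1 := hC k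
    have h2 : |q| ≤ R := by rw [hR]; linarith
    rw [Real.norm_eq_abs, ← div_div, div_eq_mul_inv _ (Real.Gamma _), abs_mul, abs_div, abs_mul,
      abs_pow, Nat.abs_cast, Nat.abs_cast, mul_comm C]
    gcongr
  rw [hs.tsum_eq_zero_add, besselSeries]
  simp only [Nat.cast_zero, zero_mul, zero_div, zero_add, Nat.add_sub_cancel]
  refine tsum_congr fun k => ?_
  rw [Nat.factorial_succ]
  push_cast
  rw [show σ + (k + 1 : ℝ) + 1 = σ + 1 + k + 1 by ring, mul_assoc, mul_div_mul_left]
  positivity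

/-- The recurrence that makes `q^σ besselSeries σ q` differentiate to the series of
order `σ - 1`. -/
theorem besselSeries_rec {σ : ℝ} (hσ : 0 < σ) (q : ℝ) :
    besselSeries (σ - 1) q = σ * besselSeries σ q + q * besselSeries (σ + 1) q := by
  have h1 : HasSum (fun k : ℕ => σ * (q ^ k / (k.factorial * Real.Gamma (σ + k + 1))))
      (σ * besselSeries σ q) := (summable_besselSeries σ q).hasSum.mul_left σ
  have h2 : HasSum (fun k : ℕ => k * (q ^ k / (k.factorial * Real.Gamma (σ + k + 1))))
      (q * besselSeries (σ + 1) q) := by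
    rw [← hasSum_nat_add_iff' 1]
    simp only [Finset.range_one, Finset.sum_singleton, Nat.cast_zero, zero_mul, sub_zero]
    refine ((summable_besselSeries (σ + 1) q).hasSum.mul_left q).congr_fun fun k => ?_
    rw [Nat.factorial_succ]
    push_cast
    rw [show σ + (k + 1 : ℝ) + 1 = σ + 1 + k + 1 by ring]
    have : (k : ℝ) + 1 ≠ 0 := by positivity
    field_simp
    ring
  have h3 := h1.add h2
  refine HasSum.tsum_eq (h3.congr_fun fun k => ?_)
  have hk : σ + k ≠ 0 := by positivity
  rw [show σ - 1 + k + 1 = σ + k by ring, Real.Gamma_add_one hk]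
  field_simp

theorem besselSeries_zero (σ : ℝ) : besselSeries σ 0 = (Real.Gamma (σ + 1))⁻¹ := by
  unfold besselSeries
  rw [tsum_eq_single 0]
  · simp
  · intro k hk
    simp [hk]

theorem tendsto_besselSeries_zero (σ : ℝ) :
    Tendsto (besselSeries σ) (𝓝[>] 0) (𝓝 (Real.Gamma (σ + 1))⁻¹) := by
  rw [← besselSeries_zero]
  exact ((hasDerivAt_besselSeries σ 0).continuousAt.tendsto).mono_left nhdsWithin_le_nhds

theorem hasDerivAt_rpow_mul_besselSeries {σ : ℝ} (hσ : 0 < σ) {q : ℝ} (hq : 0 < q) :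
    HasDerivAt (fun q => q ^ σ * besselSeries σ q) (q ^ (σ - 1) * besselSeries (σ - 1) q) q := by
  refine ((Real.hasDerivAt_rpow_const (Or.inl hq.ne')).mul
    (hasDerivAt_besselSeries σ q)).congr_deriv ?_
  rw [besselSeries_rec hσ, Real.rpow_sub_one hq.ne']
  field_simp

/-! ### `K_ν(x)` as an integral -/

theorem eq_of_hasDerivAt_zero_of_tendsto {f : ℝ → ℝ} {L : ℝ}
    (hf : ∀ q : ℝ, 0 < q → HasDerivAt f 0 q) (hL : Tendsto f (𝓝[>] 0) (𝓝 L)) {q : ℝ}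
    (hq : 0 < q) : f q = L := by
  have hconst : ∀ x ∈ Ioi (0 : ℝ), f x = f q := fun x hx =>
    isOpen_Ioi.is_const_of_fderiv_eq_zero (𝕜 := ℝ) isPreconnected_Ioi
      (fun y hy => (hf y hy).differentiableAt.differentiableWithinAt)
      (fun y hy => by simpa using (hf y hy).hasFDerivAt.fderiv) hx hq
  refine tendsto_nhds_unique (tendsto_const_nhds.congr' ?_) hL
  filter_upwards [self_mem_nhdsWithin] with x hx
  exact (hconst x hx).symm

/-- For `0 < s < 1`, the integral is the combination of the series that defines `K_s`: both sides
solve the same first order system, and the constant Wronskians are found at `q = 0`. -/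
theorem macdonald_eq_besselSeries {s : ℝ} (hs0 : 0 < s) (hs1 : s < 1) {q : ℝ} (hq : 0 < q) :
    Real.sin (Real.pi * s) * macdonald s q =
      Real.pi * (besselSeries (-s) q - q ^ s * besselSeries s q) := by
  have hdM : ∀ q : ℝ, 0 < q →
      HasDerivAt (macdonald s) (-(q ^ (s - 1) * macdonald (1 - s) q)) q := by
    intro q hq
    refine (hasDerivAt_macdonald s hq).congr_deriv ?_
    have := macdonald_neg (1 - s) hq
    rw [neg_sub] at this
    rw [this]
  have hdM' : ∀ q : ℝ, 0 < q →
      HasDerivAt (macdonald (1 - s)) (-(q ^ (-s) * macdonald s q)) q := by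
    intro q hq
    refine (hasDerivAt_macdonald (1 - s) hq).congr_deriv ?_
    rw [show (1 - s - 1) = -s by ring, macdonald_neg s hq]
  have hd1 : ∀ q : ℝ, HasDerivAt (besselSeries (-s)) (besselSeries (1 - s) q) q := by
    intro q
    have := hasDerivAt_besselSeries (-s) q
    rwa [neg_add_eq_sub] at this
  have hd2 : ∀ q : ℝ, HasDerivAt (besselSeries (s - 1)) (besselSeries s q) q := by
    intro q
    have := hasDerivAt_besselSeries (s - 1) q
    rwa [sub_add_cancel] at this
  have hd3 : ∀ q : ℝ, 0 < q → HasDerivAt (fun q => q ^ (1 - s) * besselSeries (1 - s) q)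
      (q ^ (-s) * besselSeries (-s) q) q := by
    intro q hq
    have := hasDerivAt_rpow_mul_besselSeries (σ := 1 - s) (by linarith) hq
    rwa [show (1 - s - 1) = -s by ring] at this
  have hd4 : ∀ q : ℝ, 0 < q → HasDerivAt (fun q => q ^ s * besselSeries s q)
      (q ^ (s - 1) * besselSeries (s - 1) q) q := fun q hq =>
    hasDerivAt_rpow_mul_besselSeries hs0 hq
  have hpow : ∀ q : ℝ, 0 < q → q ^ (s - 1) * q ^ (1 - s) = 1 := fun q hq => by
    rw [← Real.rpow_add hq]; simp
  have hpow' : ∀ q : ℝ, 0 < q → q ^ (-s) * q ^ s = 1 := fun q hq => by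
    rw [← Real.rpow_add hq]; simp
  have hl : ∀ a : ℝ, 0 < a → Tendsto (fun q : ℝ => q ^ a) (𝓝[>] 0) (𝓝 0) := by
    intro a ha
    have := (Real.continuousAt_rpow_const 0 a (Or.inr ha.le)).tendsto
    rw [Real.zero_rpow ha.ne'] at this
    exact this.mono_left nhdsWithin_le_nhds
  have hG : Real.Gamma s ≠ 0 := (Real.Gamma_pos_of_pos hs0).ne'
  have hG' : Real.Gamma (1 - s) ≠ 0 := (Real.Gamma_pos_of_pos (by linarith)).ne'
  have l1 := tendsto_besselSeries_zero (-s)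
  have l2 := tendsto_besselSeries_zero (s - 1)
  have l3 := tendsto_besselSeries_zero (1 - s)
  have l4 := tendsto_besselSeries_zero s
  rw [neg_add_eq_sub] at l1
  rw [sub_add_cancel] at l2
  have lM := tendsto_macdonald_zero hs0
  have lM' := tendsto_macdonald_zero (s := 1 - s) (by linarith)
  -- The pairs of series `(-s, 1 - s)` and `(s, s - 1)` solve the system of the integrals with
  -- parameters `s` and `1 - s`; the Wronskians of the three solutions are constant.
  have w1 := eq_of_hasDerivAt_zero_of_tendsto (q := q)
    (f := fun q => macdonald s q * (q ^ (1 - s) * besselSeries (1 - s) q) +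
      macdonald (1 - s) q * besselSeries (-s) q) (L := 1)
    (fun q hq => (((hdM q hq).mul (hd3 q hq)).add ((hdM' q hq).mul (hd1 q))).congr_deriv (by
      linear_combination -macdonald (1 - s) q * besselSeries (1 - s) q * hpow q hq))
    (by
      have := (lM.mul ((hl (1 - s) (by linarith)).mul l3)).add (lM'.mul l1)
      simpa [hG'] using this) hq
  have w2 := eq_of_hasDerivAt_zero_of_tendsto (q := q)
    (f := fun q => macdonald s q * besselSeries (s - 1) q +
      macdonald (1 - s) q * (q ^ s * besselSeries s q)) (L := 1)
    (fun q hq => (((hdM q hq).mul (hd2 q)).add ((hdM' q hq).mul (hd4 q hq))).congr_deriv (by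
      linear_combination -macdonald s q * besselSeries s q * hpow' q hq))
    (by
      have := (lM.mul l2).add (lM'.mul ((hl s hs0).mul l4))
      simpa [hG] using this) hq
  have w3 := eq_of_hasDerivAt_zero_of_tendsto (q := q)
    (f := fun q => besselSeries (-s) q * besselSeries (s - 1) q -
      (q ^ s * besselSeries s q) * (q ^ (1 - s) * besselSeries (1 - s) q))
    (L := (Real.Gamma (1 - s))⁻¹ * (Real.Gamma s)⁻¹)
    (fun q hq => (((hd1 q).mul (hd2 q)).sub ((hd4 q hq).mul (hd3 q hq))).congr_deriv (by
      linear_combination -besselSeries (s - 1) q * besselSeries (1 - s) q * hpow q hq -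
        besselSeries s q * besselSeries (-s) q * hpow' q hq))
    (by
      have := (l1.mul l2).sub (((hl s hs0).mul l4).mul ((hl (1 - s) (by linarith)).mul l3))
      simpa using this) hq
  have hrefl := Real.Gamma_mul_Gamma_one_sub s
  have hsin : Real.sin (Real.pi * s) ≠ 0 := by
    refine (Real.sin_pos_of_pos_of_lt_pi (by have := Real.pi_pos; positivity) ?_).ne'
    have := Real.pi_pos
    nlinarith
  rw [eq_div_iff hsin] at hrefl
  have h5 : macdonald s q * ((Real.Gamma (1 - s))⁻¹ * (Real.Gamma s)⁻¹) =
      besselSeries (-s) q - q ^ s * besselSeries s q := by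
    rw [← w3]
    linear_combination besselSeries (-s) q * w2 - (q ^ s * besselSeries s q) * w1
  rw [← h5]
  field_simp
  linear_combination macdonald s q * hrefl

/-! ### Continuation of the integral formula for `K_ν(x)` in the order -/

theorem mellin_eq_macdonald (s q : ℝ) :
    mellin (fun τ : ℝ => ((Real.exp (-τ - q / τ) : ℝ) : ℂ)) s = macdonald s q := by
  rw [mellin, macdonald, ← integral_complex_ofReal]
  refine setIntegral_congr_fun measurableSet_Ioi fun τ hτ => ?_
  have hτ0 : (0 : ℝ) < τ := hτ
  simp only [smul_eq_mul]
  rw [Complex.ofReal_mul, Complex.ofReal_cpow hτ0.le]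
  push_cast
  rfl

/-- As a Mellin transform, the integral is entire in `s`. -/
theorem differentiable_mellin_macdonald {q : ℝ} (hq : 0 < q) :
    Differentiable ℂ (mellin fun τ : ℝ => ((Real.exp (-τ - q / τ) : ℝ) : ℂ)) := by
  intro s
  obtain ⟨n, hn⟩ := exists_nat_gt (-s.re)
  refine mellin_differentiableAt_of_isBigO_rpow_exp (a := 1) (b := -n) one_pos ?_ ?_ ?_
    (by linarith)
  · refine ContinuousOn.locallyIntegrableOn ?_ measurableSet_Ioi
    refine Complex.continuous_ofReal.comp_continuousOn (ContinuousOn.rexp ?_)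
    refine ContinuousOn.sub (by fun_prop) (continuousOn_const.div continuousOn_id ?_)
    intro x hx
    exact (ne_of_gt hx)
  · refine Asymptotics.IsBigO.of_bound 1 ?_
    filter_upwards [eventually_gt_atTop 0] with τ hτ
    rw [Complex.norm_real, Real.norm_of_nonneg (Real.exp_pos _).le,
      Real.norm_of_nonneg (Real.exp_pos _).le, one_mul]
    refine Real.exp_le_exp.2 ?_
    have : 0 ≤ q / τ := by positivity
    linarith
  · refine Asymptotics.IsBigO.of_bound (n.factorial / q ^ n) ?_
    filter_upwards [self_mem_nhdsWithin] with τ hτ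
    have hτ0 : (0 : ℝ) < τ := hτ
    rw [Complex.norm_real, Real.norm_of_nonneg (Real.exp_pos _).le,
      Real.norm_of_nonneg (by positivity), neg_neg, Real.rpow_natCast]
    have h1 := exp_neg_div_le n hq hτ0
    rw [div_pow] at h1
    have h2 : Real.exp (-τ - q / τ) ≤ Real.exp (-(q / τ)) := Real.exp_le_exp.2 (by linarith)
    refine (h2.trans h1).trans (le_of_eq (by ring))

theorem besselI_log (σ : ℝ) {x : ℝ} (hx : 0 < x) :
    besselI σ (Real.log x) = ((x / 2) ^ σ * besselSeries σ (x ^ 2 / 4) : ℝ) := by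
  have hx2 : 0 < x / 2 := by positivity
  rw [besselI, besselSeries, ← tsum_mul_left, Complex.ofReal_tsum]
  refine tsum_congr fun k => ?_
  have h1 : Complex.exp (((σ : ℂ) + 2 * k) * ((Real.log x : ℂ) - Real.log 2)) =
      ((x / 2) ^ σ * (x ^ 2 / 4) ^ k : ℝ) := by
    rw [← Complex.ofReal_sub, ← Real.log_div hx.ne' two_ne_zero]
    have : ((σ : ℂ) + 2 * k) * (Real.log (x / 2) : ℂ) =
      ((Real.log (x / 2) * σ + (2 * k : ℕ) * Real.log (x / 2) : ℝ) : ℂ) := by push_cast; ring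
    rw [this, ← Complex.ofReal_exp, Real.exp_add, Real.exp_nat_mul, Real.exp_log hx2,
      ← Real.rpow_def_of_pos hx2, pow_mul]
    norm_num [div_pow]
  rw [h1, show ((σ : ℂ) + k + 1) = ((σ + k + 1 : ℝ) : ℂ) by push_cast; rfl, Complex.Gamma_ofReal]
  push_cast
  ring

/-- The definition of `K_s` without division by `sin (π s)`, as an identity of entire functions
of the order. -/
theorem sin_mul_mellin_macdonald {x : ℝ} (hx : 0 < x) (s : ℂ) :
    Complex.sin (Real.pi * s) *
        mellin (fun τ : ℝ => ((Real.exp (-τ - (x ^ 2 / 4) / τ) : ℝ) : ℂ)) s =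
      Real.pi * Complex.exp (s * Real.log (x / 2)) *
        (besselI (-s) (Real.log x) - besselI s (Real.log x)) := by
  have hq : 0 < x ^ 2 / 4 := by positivity
  have hx2 : 0 < x / 2 := by positivity
  have hI := besselI_differentiable (Real.log x)
  have hI' : Differentiable ℂ fun s => besselI (-s) (Real.log x) := hI.comp differentiable_neg
  have hM := differentiable_mellin_macdonald hq
  have hf : Differentiable ℂ fun s : ℂ => Complex.sin (Real.pi * s) *
      mellin (fun τ : ℝ => ((Real.exp (-τ - (x ^ 2 / 4) / τ) : ℝ) : ℂ)) s := by fun_prop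
  have hg : Differentiable ℂ fun s : ℂ => Real.pi * Complex.exp (s * Real.log (x / 2)) *
        (besselI (-s) (Real.log x) - besselI s (Real.log x)) := by fun_prop
  have hreal : ∀ s : ℝ, 0 < s → s < 1 → Complex.sin (Real.pi * s) *
        mellin (fun τ : ℝ => ((Real.exp (-τ - (x ^ 2 / 4) / τ) : ℝ) : ℂ)) s =
      Real.pi * Complex.exp (s * Real.log (x / 2)) *
        (besselI (-s) (Real.log x) - besselI s (Real.log x)) := by
    intro s hs0 hs1
    have h1 : Complex.exp (s * Real.log (x / 2)) = ((x / 2) ^ s : ℝ) := by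
      rw [Real.rpow_def_of_pos hx2, Complex.ofReal_exp]
      push_cast
      ring_nf
    have h2 := besselI_log (-s) hx
    rw [Complex.ofReal_neg] at h2
    rw [mellin_eq_macdonald, besselI_log s hx, h1, h2, ← Complex.ofReal_mul, ← Complex.ofReal_sin,
      ← Complex.ofReal_sub, ← Complex.ofReal_mul, ← Complex.ofReal_mul, ← Complex.ofReal_mul,
      macdonald_eq_besselSeries hs0 hs1 hq]
    congr 1
    have e1 : (x / 2) ^ s * (x / 2) ^ (-s) = 1 := by rw [← Real.rpow_add hx2]; simp
    have e2 : (x ^ 2 / 4) ^ s = (x / 2) ^ s * (x / 2) ^ s := by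
      rw [← Real.mul_rpow hx2.le hx2.le]
      ring_nf
    rw [e2]
    linear_combination (-Real.pi * besselSeries (-s) (x ^ 2 / 4)) * e1
  refine congrFun (AnalyticOnNhd.eq_of_frequently_eq (z₀ := ((1 / 2 : ℝ) : ℂ))
    (fun z _ => hf.analyticAt z) (fun z _ => hg.analyticAt z) ?_) s
  have ht : Tendsto (fun t : ℝ => (t : ℂ)) (𝓝[≠] (1 / 2)) (𝓝[≠] ((1 / 2 : ℝ) : ℂ)) := by
    refine tendsto_nhdsWithin_iff.2 ⟨(Complex.continuous_ofReal.tendsto _).mono_left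
      nhdsWithin_le_nhds, ?_⟩
    filter_upwards [self_mem_nhdsWithin] with t ht
    exact fun h => ht (Complex.ofReal_injective h)
  refine ht.frequently (Eventually.frequently ?_)
  have : Ioo (0 : ℝ) 1 ∈ 𝓝 (1 / 2 : ℝ) := Ioo_mem_nhds (by norm_num) (by norm_num)
  filter_upwards [mem_nhdsWithin_of_mem_nhds this] with t ht
  exact hreal t ht.1 ht.2

theorem besselKQuot_log {x : ℝ} (hx : 0 < x) {s : ℂ} (hs : Complex.sin (Real.pi * s) ≠ 0) :
    besselKQuot s (Real.log x) = 1 / 2 * Complex.exp (-(s * Real.log (x / 2))) *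
      mellin (fun τ : ℝ => ((Real.exp (-τ - (x ^ 2 / 4) / τ) : ℝ) : ℂ)) s := by
  have h := sin_mul_mellin_macdonald hx s
  have e : Complex.exp (-(s * Real.log (x / 2))) * Complex.exp (s * Real.log (x / 2)) = 1 := by
    rw [← Complex.exp_add]; simp
  rw [besselKQuot, div_eq_iff hs]
  linear_combination (-(1 : ℂ) / 2 * Complex.exp (-(s * Real.log (x / 2)))) * h -
    (Real.pi / 2 * (besselI (-s) (Real.log x) - besselI s (Real.log x))) * e

theorem sin_pi_mul_ne_zero {s : ℂ} (hs : ¬ ∃ n : ℤ, s = n) : Complex.sin (Real.pi * s) ≠ 0 := by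
  intro h
  obtain ⟨k, hk⟩ := Complex.sin_eq_zero_iff.1 h
  refine hs ⟨k, ?_⟩
  have hpi : (Real.pi : ℂ) ≠ 0 := by exact_mod_cast Real.pi_ne_zero
  refine mul_left_cancel₀ hpi ?_
  rw [hk, mul_comm]

/-- `K_s(x)` as a Mellin transform, for every order `s`; at integers, by continuity in the order. -/
theorem besselK_log_eq_mellin {x : ℝ} (hx : 0 < x) (s : ℂ) :
    besselK s (Real.log x) = 1 / 2 * Complex.exp (-(s * Real.log (x / 2))) *
      mellin (fun τ : ℝ => ((Real.exp (-τ - (x ^ 2 / 4) / τ) : ℝ) : ℂ)) s := by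
  by_cases hs : ∃ n : ℤ, s = n
  · obtain ⟨n, rfl⟩ := hs
    refine tendsto_nhds_unique (besselK_tendsto_int n (Real.log x)) ?_
    have hM := differentiable_mellin_macdonald (q := x ^ 2 / 4) (by positivity)
    have hc : Continuous fun s : ℂ => 1 / 2 * Complex.exp (-(s * Real.log (x / 2))) *
      mellin (fun τ : ℝ => ((Real.exp (-τ - (x ^ 2 / 4) / τ) : ℝ) : ℂ)) s := by
      have := hM.continuous
      fun_prop
    refine ((hc.tendsto (n : ℂ)).mono_left nhdsWithin_le_nhds).congr' ?_
    have hd : HasDerivAt (fun s : ℂ => Complex.sin (Real.pi * s))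
        (Complex.cos (Real.pi * n) * Real.pi) n := by
      have h1 : HasDerivAt (fun μ : ℂ => Real.pi * μ) (Real.pi : ℂ) n := by
        simpa using (hasDerivAt_id (n : ℂ)).const_mul (Real.pi : ℂ)
      exact h1.csin
    have hd0 : Complex.cos (Real.pi * n) * Real.pi ≠ 0 := by
      refine mul_ne_zero ?_ (by exact_mod_cast Real.pi_ne_zero)
      intro h
      have := Complex.sin_sq_add_cos_sq (Real.pi * n)
      rw [h, sin_pi_int] at this
      norm_num at this
    filter_upwards [hd.eventually_ne (c := 0) hd0] with s hs
    exact (besselKQuot_log hx hs).symm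
  · rw [besselK, if_neg hs, besselKQuot_log hx (sin_pi_mul_ne_zero hs)]

/-! ### `K_ν(x)` as an integral of hyperbolic cosines -/

/-- `∫_0^∞ e^{-x cosh t} (cosh t)^j cosh(νt) dt`, which is `(-1)^j` times the `j`-th derivative of
`K_ν(x)`. -/
noncomputable def coshK (j : ℕ) (ν x : ℝ) : ℝ :=
  ∫ t in Ioi (0 : ℝ), Real.exp (-(x * Real.cosh t)) * Real.cosh t ^ j * Real.cosh (ν * t)

theorem exists_rpow_mul_exp_neg_le {a : ℝ} (ha : 0 ≤ a) :
    ∃ C : ℝ, 0 ≤ C ∧ ∀ y : ℝ, 0 < y → y ^ a * Real.exp (-y) ≤ C := by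
  obtain ⟨n, hn⟩ := exists_nat_ge a
  refine ⟨1 + n.factorial, by positivity, fun y hy => ?_⟩
  have h1 : y ^ a ≤ 1 + y ^ n := by
    rcases le_total y 1 with h | h
    · have := Real.rpow_le_one hy.le h ha
      have : 0 ≤ y ^ n := by positivity
      linarith
    · have := Real.rpow_le_rpow_of_exponent_le h hn
      rw [Real.rpow_natCast] at this
      linarith
  have h2 : y ^ n ≤ n.factorial * Real.exp y := by
    have := Real.pow_div_factorial_le_exp y hy.le n
    rwa [div_le_iff₀ (by positivity), mul_comm] at this
  have h3 : 1 ≤ Real.exp y := Real.one_le_exp hy.le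
  rw [Real.exp_neg, ← div_eq_mul_inv, div_le_iff₀ (Real.exp_pos _)]
  nlinarith

theorem cosh_mul_le_exp (ν : ℝ) {t : ℝ} (ht : 0 ≤ t) : Real.cosh (ν * t) ≤ Real.exp (|ν| * t) := by
  rw [← Real.cosh_abs, abs_mul, abs_of_nonneg ht, Real.cosh_eq]
  have : Real.exp (-(|ν| * t)) ≤ Real.exp (|ν| * t) :=
    Real.exp_le_exp.2 (by have : 0 ≤ |ν| * t := by positivity
                          linarith)
  linarith

/-- A bound for the integrand, with the dependence on `x` that gives `K_ν(x) = O(x^{-μ})` for each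
`μ > |ν|`. -/
theorem exists_coshK_integrand_le (j : ℕ) {ν μ : ℝ} (hμ : |ν| < μ) :
    ∃ C : ℝ, 0 ≤ C ∧ ∀ x t : ℝ, 0 < x → 0 ≤ t →
      Real.exp (-(x * Real.cosh t)) * Real.cosh t ^ j * Real.cosh (ν * t) ≤
        C * x ^ (-(μ + j)) * Real.exp (-(μ - |ν|) * t) := by
  have hμ0 : 0 < μ := (abs_nonneg _).trans_lt hμ
  obtain ⟨C, hC0, hC⟩ := exists_rpow_mul_exp_neg_le (a := μ + j) (by positivity)
  refine ⟨C * 2 ^ μ, by positivity, fun x t hx ht => ?_⟩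
  have hc : 0 < Real.cosh t := Real.cosh_pos t
  have h1 := hC (x * Real.cosh t) (by positivity)
  rw [Real.mul_rpow hx.le hc.le, Real.rpow_add hc, Real.rpow_natCast] at h1
  have hxp : 0 < x ^ (μ + j) := by positivity
  have h2 : Real.exp (-(x * Real.cosh t)) * Real.cosh t ^ j ≤
      C * x ^ (-(μ + j)) * (Real.cosh t) ^ (-μ) := by
    rw [Real.rpow_neg hx.le, Real.rpow_neg hc.le, ← div_eq_mul_inv, ← div_eq_mul_inv, div_div,
      le_div_iff₀ (by positivity)]
    linarith
  have h3 : (Real.cosh t) ^ (-μ) ≤ 2 ^ μ * Real.exp (-μ * t) := by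
    have e1 : Real.exp t / 2 ≤ Real.cosh t := by
      rw [Real.cosh_eq]; have := Real.exp_pos (-t); linarith
    refine (Real.rpow_le_rpow_of_nonpos (by positivity) e1 (by linarith)).trans (le_of_eq ?_)
    rw [Real.div_rpow (Real.exp_pos _).le (by norm_num), ← Real.exp_mul, Real.rpow_neg two_pos.le,
      div_inv_eq_mul, mul_comm]
    ring_nf
  calc _ ≤ C * x ^ (-(μ + j)) * (2 ^ μ * Real.exp (-μ * t)) * Real.exp (|ν| * t) := by
        have := cosh_mul_le_exp ν ht
        have := Real.cosh_pos (ν * t)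
        exact mul_le_mul (h2.trans (by gcongr)) (by assumption) this.le (by positivity)
    _ = C * 2 ^ μ * x ^ (-(μ + j)) * (Real.exp (-μ * t) * Real.exp (|ν| * t)) := by ring
    _ = _ := by rw [← Real.exp_add]; ring_nf

theorem continuous_coshK_integrand (j : ℕ) (ν x : ℝ) : Continuous fun t : ℝ =>
    Real.exp (-(x * Real.cosh t)) * Real.cosh t ^ j * Real.cosh (ν * t) := by
  have := Real.continuous_cosh
  fun_prop

theorem coshK_integrand_nonneg (j : ℕ) (ν x t : ℝ) :
    0 ≤ Real.exp (-(x * Real.cosh t)) * Real.cosh t ^ j * Real.cosh (ν * t) := by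
  have := Real.cosh_pos t
  have := Real.cosh_pos (ν * t)
  positivity

theorem integrableOn_coshK (j : ℕ) (ν : ℝ) {x : ℝ} (hx : 0 < x) :
    IntegrableOn (fun t : ℝ =>
      Real.exp (-(x * Real.cosh t)) * Real.cosh t ^ j * Real.cosh (ν * t)) (Ioi 0) := by
  obtain ⟨C, -, hC⟩ := exists_coshK_integrand_le j (lt_add_one |ν|)
  refine Integrable.mono' ((exp_neg_integrableOn_Ioi 0 (b := |ν| + 1 - |ν|)
    (by linarith)).const_mul (C * x ^ (-(|ν| + 1 + j))))
    (continuous_coshK_integrand j ν x).aestronglyMeasurable ?_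
  refine (ae_restrict_iff' measurableSet_Ioi).2 (ae_of_all _ fun t ht => ?_)
  rw [Real.norm_of_nonneg (coshK_integrand_nonneg _ _ _ _)]
  exact hC x t hx (le_of_lt ht)

theorem coshK_nonneg (j : ℕ) (ν x : ℝ) : 0 ≤ coshK j ν x :=
  integral_nonneg fun t => coshK_integrand_nonneg j ν x t

theorem coshK_pos (j : ℕ) (ν : ℝ) {x : ℝ} (hx : 0 < x) : 0 < coshK j ν x := by
  unfold coshK
  rw [integral_pos_iff_support_of_nonneg (fun t => coshK_integrand_nonneg j ν x t)
    (integrableOn_coshK j ν hx)]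
  have : (Function.support fun t : ℝ =>
      Real.exp (-(x * Real.cosh t)) * Real.cosh t ^ j * Real.cosh (ν * t)) = univ := by
    refine Function.support_eq_univ fun t => ?_
    have := Real.cosh_pos t
    have := Real.cosh_pos (ν * t)
    positivity
  rw [this]
  simp

theorem exists_coshK_le (j : ℕ) {ν μ : ℝ} (hμ : |ν| < μ) :
    ∃ C : ℝ, ∀ x : ℝ, 0 < x → coshK j ν x ≤ C * x ^ (-(μ + j)) := by
  obtain ⟨C, hC0, hC⟩ := exists_coshK_integrand_le j hμ
  have hint : IntegrableOn (fun t : ℝ => Real.exp (-(μ - |ν|) * t)) (Ioi 0) :=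
    exp_neg_integrableOn_Ioi 0 (by linarith)
  refine ⟨C * ∫ t in Ioi (0 : ℝ), Real.exp (-(μ - |ν|) * t), fun x hx => ?_⟩
  refine (setIntegral_mono_on (integrableOn_coshK j ν hx)
    (hint.const_mul (C * x ^ (-(μ + j)))) measurableSet_Ioi fun t ht =>
      hC x t hx (le_of_lt ht)).trans (le_of_eq ?_)
  rw [integral_const_mul]
  ring

theorem hasDerivAt_coshK (j : ℕ) (ν : ℝ) {x : ℝ} (hx : 0 < x) :
    HasDerivAt (coshK j ν) (-coshK (j + 1) ν x) x := by
  have h := (hasDerivAt_integral_of_dominated_loc_of_deriv_le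
    (μ := volume.restrict (Ioi (0 : ℝ)))
    (F := fun (x t : ℝ) => Real.exp (-(x * Real.cosh t)) * Real.cosh t ^ j * Real.cosh (ν * t))
    (F' := fun (x t : ℝ) =>
      -(Real.exp (-(x * Real.cosh t)) * Real.cosh t ^ (j + 1) * Real.cosh (ν * t)))
    (bound := fun t =>
      Real.exp (-(x / 2 * Real.cosh t)) * Real.cosh t ^ (j + 1) * Real.cosh (ν * t))
    (x₀ := x) (Ioi_mem_nhds (half_lt_self hx))
    (Eventually.of_forall fun x => (continuous_coshK_integrand j ν x).aestronglyMeasurable)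
    (integrableOn_coshK j ν hx)
    (continuous_coshK_integrand (j + 1) ν x).neg.aestronglyMeasurable
    (ae_of_all _ fun t z hz => by
      have hz0 : x / 2 < z := hz
      have := Real.cosh_pos t
      have := Real.cosh_pos (ν * t)
      rw [norm_neg, Real.norm_of_nonneg (coshK_integrand_nonneg _ _ _ _)]
      gcongr)
    (integrableOn_coshK (j + 1) ν (half_pos hx))
    (ae_of_all _ fun t z _ => by
      have h1 : HasDerivAt (fun z : ℝ => -(z * Real.cosh t)) (-Real.cosh t) z := by
        have := ((hasDerivAt_id z).mul_const (Real.cosh t)).neg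
        rw [one_mul] at this
        exact this
      refine ((h1.exp.mul_const (Real.cosh t ^ j)).mul_const (Real.cosh (ν * t))).congr_deriv ?_
      ring)).2
  rw [integral_neg] at h
  exact h

/-- The modified Bessel equation. -/
theorem coshK_ode (ν : ℝ) {x : ℝ} (hx : 0 < x) :
    x ^ 2 * coshK 2 ν x - x * coshK 1 ν x = (x ^ 2 + ν ^ 2) * coshK 0 ν x := by
  have hd : ∀ t ∈ Ici (0 : ℝ), HasDerivAt
      (fun t : ℝ => -(x * Real.sinh t * Real.exp (-(x * Real.cosh t)) * Real.cosh (ν * t)) -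
        ν * (Real.exp (-(x * Real.cosh t)) * Real.sinh (ν * t)))
      (x ^ 2 * (Real.exp (-(x * Real.cosh t)) * Real.cosh t ^ 2 * Real.cosh (ν * t)) -
        x * (Real.exp (-(x * Real.cosh t)) * Real.cosh t ^ 1 * Real.cosh (ν * t)) -
        (x ^ 2 + ν ^ 2) * (Real.exp (-(x * Real.cosh t)) * Real.cosh t ^ 0 * Real.cosh (ν * t)))
      t := by
    intro t _
    have h1 : HasDerivAt (fun t => Real.exp (-(x * Real.cosh t)))
        (Real.exp (-(x * Real.cosh t)) * -(x * Real.sinh t)) t :=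
      ((Real.hasDerivAt_cosh t).const_mul x).neg.exp
    have h0 : HasDerivAt (fun t : ℝ => ν * t) ν t := by
      simpa using (hasDerivAt_id t).const_mul ν
    have h2 := h0.cosh
    have h3 := h0.sinh
    refine (((((Real.hasDerivAt_sinh t).const_mul x).mul h1).mul h2).neg.sub
      ((h1.mul h3).const_mul ν)).congr_deriv ?_
    simp only [Pi.mul_apply]
    have := Real.cosh_sq t
    rw [this]
    ring
  have hI := fun j => integrableOn_coshK j ν hx
  have hlim : Tendsto
      (fun t : ℝ => -(x * Real.sinh t * Real.exp (-(x * Real.cosh t)) * Real.cosh (ν * t)) -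
        ν * (Real.exp (-(x * Real.cosh t)) * Real.sinh (ν * t))) atTop (𝓝 0) := by
    obtain ⟨C, hC0, hC⟩ := exists_coshK_integrand_le 1 (lt_add_one |ν|)
    have h0 : Tendsto (fun t : ℝ => (x + |ν|) * (C * x ^ (-(|ν| + 1 + (1 : ℕ))) *
        Real.exp (-(|ν| + 1 - |ν|) * t))) atTop (𝓝 0) := by
      have := Real.tendsto_exp_neg_atTop_nhds_zero.const_mul
        ((x + |ν|) * (C * x ^ (-(|ν| + 1 + (1 : ℕ)))))
      rw [mul_zero] at this
      refine this.congr fun t => ?_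
      ring_nf
    refine squeeze_zero_norm' ?_ h0
    filter_upwards [eventually_ge_atTop 0] with t ht
    have hb := hC x t hx ht
    have hch := Real.one_le_cosh t
    have hch' := Real.cosh_pos (ν * t)
    have hs1 : |Real.sinh t| ≤ Real.cosh t := by
      rw [abs_le]; have := Real.sinh_lt_cosh t; have := Real.sinh_lt_cosh (-t)
      rw [Real.sinh_neg, Real.cosh_neg] at this
      constructor <;> linarith
    have hs2 : |Real.sinh (ν * t)| ≤ Real.cosh (ν * t) := by
      rw [abs_le]; have := Real.sinh_lt_cosh (ν * t); have := Real.sinh_lt_cosh (-(ν * t))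
      rw [Real.sinh_neg, Real.cosh_neg] at this
      constructor <;> linarith
    have hE := Real.exp_pos (-(x * Real.cosh t))
    rw [pow_one] at hb
    calc _ ≤ x * |Real.sinh t| * Real.exp (-(x * Real.cosh t)) * Real.cosh (ν * t) +
          |ν| * (Real.exp (-(x * Real.cosh t)) * |Real.sinh (ν * t)|) := by
          refine (norm_sub_le _ _).trans (le_of_eq ?_)
          simp only [Real.norm_eq_abs, abs_neg, abs_mul, abs_of_pos hx, abs_of_pos hE,
            abs_of_pos hch']
      _ ≤ x * Real.cosh t * Real.exp (-(x * Real.cosh t)) * Real.cosh (ν * t) +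
          |ν| * (Real.exp (-(x * Real.cosh t)) * (Real.cosh t * Real.cosh (ν * t))) := by
          gcongr
          exact hs2.trans (le_mul_of_one_le_left hch'.le hch)
      _ = (x + |ν|) * (Real.exp (-(x * Real.cosh t)) * Real.cosh t * Real.cosh (ν * t)) := by ring
      _ ≤ _ := by gcongr
  have i2 := (hI 2).const_mul (x ^ 2)
  have i1 := (hI 1).const_mul x
  have i0 := (hI 0).const_mul (x ^ 2 + ν ^ 2)
  have i21 : IntegrableOn (fun t : ℝ =>
      x ^ 2 * (Real.exp (-(x * Real.cosh t)) * Real.cosh t ^ 2 * Real.cosh (ν * t)) -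
        x * (Real.exp (-(x * Real.cosh t)) * Real.cosh t ^ 1 * Real.cosh (ν * t))) (Ioi 0) :=
    i2.sub i1
  have h := integral_Ioi_of_hasDerivAt_of_tendsto' hd (i21.sub i0) hlim
  rw [integral_sub i21 i0, integral_sub i2 i1, integral_const_mul, integral_const_mul,
    integral_const_mul] at h
  simp only [Real.sinh_zero, mul_zero, zero_mul, neg_zero, sub_zero] at h
  unfold coshK
  linarith

/-- The substitution `τ = (x/2) e^t`. -/
theorem macdonald_eq_coshK (ν : ℝ) {x : ℝ} (hx : 0 < x) :
    macdonald ν (x ^ 2 / 4) = 2 * (x / 2) ^ ν * coshK 0 ν x := by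
  have hx2 : 0 < x / 2 := by positivity
  have himg : (fun t : ℝ => x / 2 * Real.exp t) '' univ = Ioi 0 := by
    ext y
    simp only [image_univ, mem_range, mem_Ioi]
    constructor
    · rintro ⟨t, rfl⟩; positivity
    · intro hy
      refine ⟨Real.log (y / (x / 2)), ?_⟩
      rw [Real.exp_log (by positivity)]
      field_simp
  have hder : ∀ t ∈ (univ : Set ℝ), HasDerivWithinAt (fun t : ℝ => x / 2 * Real.exp t)
      (x / 2 * Real.exp t) univ t := fun t _ =>
    ((Real.hasDerivAt_exp t).const_mul (x / 2)).hasDerivWithinAt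
  have hinj : InjOn (fun t : ℝ => x / 2 * Real.exp t) univ := by
    intro a _ b _ hab
    exact Real.exp_injective (mul_left_cancel₀ hx2.ne' hab)
  have key : ∀ t : ℝ, |x / 2 * Real.exp t| • ((x / 2 * Real.exp t) ^ (ν - 1) *
      Real.exp (-(x / 2 * Real.exp t) - x ^ 2 / 4 / (x / 2 * Real.exp t))) =
      (x / 2) ^ ν * (Real.exp (ν * t) * Real.exp (-(x * Real.cosh t))) := by
    intro t
    have hp : 0 < x / 2 * Real.exp t := by positivity
    rw [abs_of_pos hp, smul_eq_mul, ← mul_assoc, Real.rpow_sub_one hp.ne',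
      mul_div_cancel₀ _ hp.ne', Real.mul_rpow hx2.le (Real.exp_pos _).le, ← Real.exp_mul,
      mul_assoc, mul_comm t ν]
    congr 3
    rw [Real.cosh_eq, Real.exp_neg]
    have := Real.exp_pos t
    field_simp
    ring
  have hint : Integrable fun t : ℝ => Real.exp (ν * t) * Real.exp (-(x * Real.cosh t)) := by
    have h := integrableOn_macdonald ν (q := x ^ 2 / 4) (by positivity)
    rw [← himg,
      integrableOn_image_iff_integrableOn_abs_deriv_smul MeasurableSet.univ hder hinj] at h
    simp only [key] at h
    rw [integrableOn_univ] at h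
    have h2 := h.const_mul ((x / 2) ^ ν)⁻¹
    refine h2.congr (ae_of_all _ fun t => ?_)
    simp only
    rw [← mul_assoc, inv_mul_cancel₀ (by positivity), one_mul]
  have hint' : Integrable fun t : ℝ => Real.exp (-(ν * t)) * Real.exp (-(x * Real.cosh t)) := by
    refine hint.comp_neg.congr (ae_of_all _ fun t => ?_)
    simp
  have hsymm : ∫ t : ℝ, Real.exp (-(ν * t)) * Real.exp (-(x * Real.cosh t)) =
      ∫ t : ℝ, Real.exp (ν * t) * Real.exp (-(x * Real.cosh t)) := by
    rw [← integral_neg_eq_self]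
    simp
  have h1 : macdonald ν (x ^ 2 / 4) =
      (x / 2) ^ ν * ∫ t : ℝ, Real.exp (ν * t) * Real.exp (-(x * Real.cosh t)) := by
    rw [macdonald, ← himg, integral_image_eq_integral_abs_deriv_smul MeasurableSet.univ hder hinj]
    simp only [key]
    rw [setIntegral_univ, integral_const_mul]
  have h2 : ∫ t : ℝ, Real.exp (ν * t) * Real.exp (-(x * Real.cosh t)) =
      ∫ t : ℝ, Real.exp (-(x * Real.cosh |t|)) * Real.cosh |t| ^ 0 * Real.cosh (ν * |t|) := by
    have h3 : ∫ t : ℝ, Real.exp (ν * t) * Real.exp (-(x * Real.cosh t)) =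
        ((∫ t : ℝ, Real.exp (ν * t) * Real.exp (-(x * Real.cosh t))) +
          ∫ t : ℝ, Real.exp (-(ν * t)) * Real.exp (-(x * Real.cosh t))) / 2 := by
      rw [hsymm]; ring
    rw [h3, ← integral_add hint hint', ← integral_div]
    congr 1
    ext t
    have : Real.cosh (ν * |t|) = Real.cosh (ν * t) := by
      rw [← Real.cosh_abs (ν * |t|), ← Real.cosh_abs (ν * t), abs_mul, abs_abs, abs_mul]
    rw [this, Real.cosh_abs, Real.cosh_eq (ν * t)]
    ring
  rw [h1, h2, integral_comp_abs (f := fun t => Real.exp (-(x * Real.cosh t)) * Real.cosh t ^ 0 *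
    Real.cosh (ν * t))]
  unfold coshK
  ring

/-- On the positive half-line and for real order, `K_ν(x) = ∫_0^∞ e^{-x cosh t} cosh(νt) dt`. -/
theorem besselK_log (ν : ℝ) {x : ℝ} (hx : 0 < x) :
    besselK ν (Real.log x) = coshK 0 ν x := by
  have hx2 : 0 < x / 2 := by positivity
  have h1 : Complex.exp (-(ν * Real.log (x / 2))) = (((x / 2) ^ ν)⁻¹ : ℝ) := by
    rw [Real.rpow_def_of_pos hx2, ← Real.exp_neg, Complex.ofReal_exp]
    push_cast
    ring_nf
  rw [besselK_log_eq_mellin hx, mellin_eq_macdonald, macdonald_eq_coshK ν hx, h1]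
  have : (x / 2) ^ ν ≠ 0 := by positivity
  push_cast
  have h2 : ((((x / 2) ^ ν : ℝ)) : ℂ) ≠ 0 := by exact_mod_cast this
  field_simp

/-! ### The normalized function `(2x/π)^{1/2} e^x K_ν(x)` -/

/-- The normalized function `(2x/π)^{1/2} e^x K_ν(x)`, which tends to `1` at infinity. -/
noncomputable def normK (ν x : ℝ) : ℝ :=
  Real.sqrt (2 * x / Real.pi) * Real.exp x * coshK 0 ν x

theorem sq_div_two_le_cosh_sub_one (u : ℝ) : u ^ 2 / 2 ≤ Real.cosh u - 1 := by
  have h1 : Real.cosh u - 1 = 2 * Real.sinh (u / 2) ^ 2 := by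
    have := Real.cosh_two_mul (u / 2)
    have h2 := Real.cosh_sq (u / 2)
    rw [show 2 * (u / 2) = u by ring] at this
    linarith
  have h3 : |u / 2| ≤ |Real.sinh (u / 2)| := by
    rw [Real.abs_sinh]
    exact Real.self_le_sinh_iff.2 (abs_nonneg _)
  have h4 := sq_le_sq.2 h3
  rw [h1]
  linarith

theorem normK_eq (ν : ℝ) {x : ℝ} (hx : 0 < x) :
    normK ν x = Real.sqrt (2 / Real.pi) * ∫ τ in Ioi (0 : ℝ),
      Real.exp (-(x * (Real.cosh ((Real.sqrt x)⁻¹ * τ) - 1))) *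
        Real.cosh (ν * ((Real.sqrt x)⁻¹ * τ)) := by
  have hs : 0 < Real.sqrt x := Real.sqrt_pos.2 hx
  have h := integral_comp_mul_left_Ioi (fun t : ℝ => Real.exp (-(x * (Real.cosh t - 1))) *
    Real.cosh (ν * t)) 0 (inv_pos.2 hs)
  rw [h, inv_inv, mul_zero, normK, coshK, smul_eq_mul, mul_assoc, ← integral_const_mul, ← mul_assoc]
  congr 1
  · rw [← Real.sqrt_mul' _ hx.le]
    congr 1
    ring
  · refine setIntegral_congr_fun measurableSet_Ioi fun t _ => ?_
    simp only [pow_zero, mul_one]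
    rw [← mul_assoc, ← Real.exp_add]
    ring_nf

/-- Laplace's method, in the scale `t = x^{-1/2} τ`. -/
theorem tendsto_normK (ν : ℝ) : Tendsto (normK ν) atTop (𝓝 1) := by
  have hgauss : ∫ τ in Ioi (0 : ℝ), Real.exp (-(1 / 2) * τ ^ 2) = Real.sqrt (Real.pi / 2) := by
    rw [integral_gaussian_Ioi, show Real.pi / (1 / 2) = Real.pi / 2 * 2 ^ 2 by ring,
      Real.sqrt_mul' _ (by positivity), Real.sqrt_sq two_pos.le]
    ring
  have hone : Real.sqrt (2 / Real.pi) * Real.sqrt (Real.pi / 2) = 1 := by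
    have := Real.pi_pos
    rw [← Real.sqrt_mul (by positivity), show 2 / Real.pi * (Real.pi / 2) = 1 by field_simp,
      Real.sqrt_one]
  rw [← hone, ← hgauss]
  have hlim : Tendsto (fun x : ℝ => ∫ τ in Ioi (0 : ℝ),
      Real.exp (-(x * (Real.cosh ((Real.sqrt x)⁻¹ * τ) - 1))) *
        Real.cosh (ν * ((Real.sqrt x)⁻¹ * τ))) atTop
      (𝓝 (∫ τ in Ioi (0 : ℝ), Real.exp (-(1 / 2) * τ ^ 2))) := by
    refine tendsto_integral_filter_of_dominated_convergence
      (fun τ => Real.exp ((|ν| + 1) ^ 2 / 2) * Real.exp (-1 * τ)) ?_ ?_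
      ((exp_neg_integrableOn_Ioi 0 one_pos).const_mul _) ?_
    · refine Eventually.of_forall fun x => Continuous.aestronglyMeasurable ?_
      have := Real.continuous_cosh
      fun_prop
    · filter_upwards [eventually_ge_atTop 1] with x hx
      refine (ae_restrict_iff' measurableSet_Ioi).2 (ae_of_all _ fun τ hτ => ?_)
      have hτ0 : (0 : ℝ) < τ := hτ
      have hs1 : 1 ≤ Real.sqrt x := Real.one_le_sqrt.2 hx
      have hs0 : 0 < Real.sqrt x := by linarith
      have hss : Real.sqrt x ^ 2 = x := Real.sq_sqrt (by linarith)
      have hu : (Real.sqrt x)⁻¹ * τ ≤ τ := mul_le_of_le_one_left hτ0.le (inv_le_one_of_one_le₀ hs1)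
      rw [Real.norm_of_nonneg (mul_nonneg (Real.exp_pos _).le (Real.cosh_pos _).le),
        ← Real.exp_add]
      have h1 : τ ^ 2 / 2 ≤ x * (Real.cosh ((Real.sqrt x)⁻¹ * τ) - 1) := by
        have h2 := mul_le_mul_of_nonneg_left
          (sq_div_two_le_cosh_sub_one ((Real.sqrt x)⁻¹ * τ)) (by linarith : 0 ≤ x)
        refine le_trans (le_of_eq ?_) h2
        rw [mul_pow, inv_pow, hss]
        field_simp
      have h3 : Real.cosh (ν * ((Real.sqrt x)⁻¹ * τ)) ≤ Real.exp (|ν| * τ) :=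
        (cosh_mul_le_exp ν (by positivity)).trans
          (Real.exp_le_exp.2 (mul_le_mul_of_nonneg_left hu (abs_nonneg _)))
      calc _ ≤ Real.exp (-(τ ^ 2 / 2)) * Real.exp (|ν| * τ) :=
            mul_le_mul (Real.exp_le_exp.2 (by linarith)) h3 (Real.cosh_pos _).le (Real.exp_pos _).le
        _ ≤ _ := by
            rw [← Real.exp_add]
            refine Real.exp_le_exp.2 ?_
            nlinarith [sq_nonneg (τ - (|ν| + 1))]
    · refine (ae_restrict_iff' measurableSet_Ioi).2 (ae_of_all _ fun τ _ => ?_)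
      have hinv : Tendsto (fun x : ℝ => (Real.sqrt x)⁻¹) atTop (𝓝 0) :=
        tendsto_inv_atTop_zero.comp Real.tendsto_sqrt_atTop
      have hsl : Tendsto (fun x : ℝ => Real.sqrt x * Real.sinh ((Real.sqrt x)⁻¹ * (τ / 2))) atTop
          (𝓝 (τ / 2)) := by
        have hd : HasDerivAt (fun u : ℝ => Real.sinh (u * (τ / 2))) (τ / 2) 0 := by
          have := ((hasDerivAt_id (0 : ℝ)).mul_const (τ / 2)).sinh
          simpa using this
        have h1 := hd.tendsto_slope_zero.comp
          (f := fun x : ℝ => (Real.sqrt x)⁻¹) (x := atTop) (by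
            refine tendsto_nhdsWithin_iff.2 ⟨hinv, ?_⟩
            filter_upwards [eventually_gt_atTop 0] with x hx
            simpa using (Real.sqrt_pos.2 hx).ne')
        simpa [Function.comp_def] using h1
      have hc : Tendsto (fun x : ℝ => Real.cosh (ν * ((Real.sqrt x)⁻¹ * τ))) atTop (𝓝 1) := by
        have := (Real.continuous_cosh.tendsto (ν * (0 * τ))).comp
          ((hinv.mul_const τ).const_mul ν)
        simpa [Function.comp_def] using this
      have he : Tendsto (fun x : ℝ => Real.exp (-(x * (Real.cosh ((Real.sqrt x)⁻¹ * τ) - 1))))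
          atTop (𝓝 (Real.exp (-(1 / 2) * τ ^ 2))) := by
        refine (Real.continuous_exp.tendsto _).comp ?_
        have h2 := (hsl.pow 2).const_mul (-2)
        rw [show -2 * (τ / 2) ^ 2 = -(1 / 2) * τ ^ 2 by ring] at h2
        refine h2.congr' ?_
        filter_upwards [eventually_gt_atTop 0] with x hx
        have h3 := Real.cosh_two_mul ((Real.sqrt x)⁻¹ * (τ / 2))
        have h4 := Real.cosh_sq ((Real.sqrt x)⁻¹ * (τ / 2))
        rw [show 2 * ((Real.sqrt x)⁻¹ * (τ / 2)) = (Real.sqrt x)⁻¹ * τ by ring] at h3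
        rw [mul_pow, Real.sq_sqrt hx.le, h3, h4]
        ring
      simpa using he.mul hc
  refine (hlim.const_mul (Real.sqrt (2 / Real.pi))).congr' ?_
  filter_upwards [eventually_gt_atTop 0] with x hx
  exact (normK_eq ν hx).symm

/-! ### Laplace representations of `K_ν` with positive measures -/

/-- For `τ ≥ 0`, the complementary error function of `(2t)^{1/2} sinh (τ/2)` is a Laplace
transform in `t`, up to a constant factor. -/
theorem lintegral_erfc {t τ : ℝ} (ht : 0 < t) (hτ : 0 ≤ τ) :
    ∫⁻ w in Ioi (0 : ℝ), ENNReal.ofReal (w ^ (-(1 / 2) : ℝ) / (1 + w) *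
        Real.exp (-(2 * t * Real.sinh (τ / 2) ^ 2 * (1 + w)))) =
      ENNReal.ofReal (Real.sqrt (2 * Real.pi * t)) * ∫⁻ σ in Ioi τ,
        ENNReal.ofReal (Real.exp (-(2 * t * Real.sinh (σ / 2) ^ 2)) * Real.cosh (σ / 2)) := by
  have hcs := Real.continuous_sinh
  have hcc := Real.continuous_cosh
  have hA : ∀ σ : ℝ, HasDerivAt (fun σ : ℝ => 2 * t * Real.sinh (σ / 2) ^ 2)
      (2 * t * Real.sinh (σ / 2) * Real.cosh (σ / 2)) σ := by
    intro σ
    have h1 : HasDerivAt (fun σ : ℝ => σ / 2) (1 / 2) σ := (hasDerivAt_id σ).div_const 2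
    refine ((h1.sinh.pow 2).const_mul (2 * t)).congr_deriv ?_
    norm_num
    ring
  have hAtop : Tendsto (fun σ : ℝ => 2 * t * Real.sinh (σ / 2) ^ 2) atTop atTop := by
    refine tendsto_atTop_mono' _ (f₁ := fun σ : ℝ => 2 * t * (σ / 2) ^ 2) ?_ ?_
    · filter_upwards [eventually_ge_atTop 0] with σ hσ
      have : σ / 2 ≤ Real.sinh (σ / 2) := Real.self_le_sinh_iff.2 (by positivity)
      gcongr
    · refine Tendsto.const_mul_atTop (by positivity) ?_
      exact (tendsto_pow_atTop two_ne_zero).comp (tendsto_id.atTop_div_const two_pos)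
  have h1 : ∀ w ∈ Ioi (0 : ℝ), ENNReal.ofReal (w ^ (-(1 / 2) : ℝ) / (1 + w) *
        Real.exp (-(2 * t * Real.sinh (τ / 2) ^ 2 * (1 + w)))) =
      ∫⁻ σ in Ioi τ, ENNReal.ofReal (w ^ (-(1 / 2) : ℝ)) *
        ENNReal.ofReal (Real.exp (-(2 * t * Real.sinh (σ / 2) ^ 2 * (1 + w))) *
          (2 * t * Real.sinh (σ / 2) * Real.cosh (σ / 2))) := by
    intro w hw
    have hw0 : (0 : ℝ) < w := hw
    have hd : ∀ σ ∈ Ici τ, HasDerivAt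
        (fun σ : ℝ => -(Real.exp (-(2 * t * Real.sinh (σ / 2) ^ 2 * (1 + w))) / (1 + w)))
        (Real.exp (-(2 * t * Real.sinh (σ / 2) ^ 2 * (1 + w))) *
          (2 * t * Real.sinh (σ / 2) * Real.cosh (σ / 2))) σ := by
      intro σ _
      refine ((((hA σ).mul_const (1 + w)).neg.exp).div_const (1 + w)).neg.congr_deriv ?_
      have : 1 + w ≠ 0 := by positivity
      simp only [Pi.neg_apply]
      field_simp
    have hnn : ∀ σ ∈ Ioi τ, 0 ≤ Real.exp (-(2 * t * Real.sinh (σ / 2) ^ 2 * (1 + w))) *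
          (2 * t * Real.sinh (σ / 2) * Real.cosh (σ / 2)) := by
      intro σ hσ
      have hσ0 : 0 ≤ σ / 2 := by have : τ < σ := hσ; linarith
      have := Real.sinh_nonneg_iff.2 hσ0
      have := Real.cosh_pos (σ / 2)
      positivity
    have hl : Tendsto
        (fun σ : ℝ => -(Real.exp (-(2 * t * Real.sinh (σ / 2) ^ 2 * (1 + w))) / (1 + w)))
        atTop (𝓝 0) := by
      have h2 := Real.tendsto_exp_neg_atTop_nhds_zero.comp
        (hAtop.atTop_mul_const (by linarith : 0 < 1 + w))
      simpa [Function.comp_def] using (h2.div_const (1 + w)).neg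
    rw [lintegral_const_mul _ (by fun_prop), ← ofReal_integral_eq_lintegral_ofReal
      (integrableOn_Ioi_deriv_of_nonneg' hd hnn hl)
      ((ae_restrict_iff' measurableSet_Ioi).2 (ae_of_all _ hnn)),
      integral_Ioi_of_hasDerivAt_of_nonneg' hd hnn hl, ← ENNReal.ofReal_mul (by positivity)]
    congr 1
    ring
  rw [setLIntegral_congr_fun measurableSet_Ioi h1, lintegral_lintegral_swap,
    ← lintegral_const_mul _ (by fun_prop)]
  swap
  · refine Measurable.aemeasurable ?_
    fun_prop
  refine setLIntegral_congr_fun measurableSet_Ioi fun σ hσ => ?_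
  have hσ0 : 0 < σ / 2 := by have : τ < σ := hσ; linarith
  have hsh : 0 < Real.sinh (σ / 2) := Real.sinh_pos_iff.2 hσ0
  have hch := Real.cosh_pos (σ / 2)
  have h3 : ∀ w ∈ Ioi (0 : ℝ), ENNReal.ofReal (w ^ (-(1 / 2) : ℝ)) *
        ENNReal.ofReal (Real.exp (-(2 * t * Real.sinh (σ / 2) ^ 2 * (1 + w))) *
          (2 * t * Real.sinh (σ / 2) * Real.cosh (σ / 2))) =
      ENNReal.ofReal (Real.exp (-(2 * t * Real.sinh (σ / 2) ^ 2)) *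
          (2 * t * Real.sinh (σ / 2) * Real.cosh (σ / 2))) *
        ENNReal.ofReal (w ^ ((1 / 2 : ℝ) - 1) *
          Real.exp (-((2 * t * Real.sinh (σ / 2) ^ 2) * w))) := by
    intro w hw
    have hw0 : (0 : ℝ) < w := hw
    rw [← ENNReal.ofReal_mul (by positivity), ← ENNReal.ofReal_mul (by positivity)]
    congr 1
    have : Real.exp (-(2 * t * Real.sinh (σ / 2) ^ 2 * (1 + w))) =
        Real.exp (-(2 * t * Real.sinh (σ / 2) ^ 2)) *
          Real.exp (-((2 * t * Real.sinh (σ / 2) ^ 2) * w)) := by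
      rw [← Real.exp_add]; ring_nf
    rw [this, show (1 / 2 : ℝ) - 1 = -(1 / 2) by norm_num]
    ring
  rw [setLIntegral_congr_fun measurableSet_Ioi h3, lintegral_const_mul _ (by fun_prop),
    lintegral_rpow_mul_exp_neg_mul (by norm_num) (by positivity),
    ← ENNReal.ofReal_mul (by positivity), ← ENNReal.ofReal_mul (by positivity),
    Real.Gamma_one_half_eq]
  congr 1
  rw [Real.rpow_neg (by positivity), ← Real.sqrt_eq_rpow, Real.sqrt_mul (by positivity),
    Real.sqrt_sq hsh.le, show 2 * Real.pi * t = 2 * t * Real.pi by ring,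
    Real.sqrt_mul (by positivity) Real.pi]
  have h4 : Real.sqrt (2 * t) * Real.sqrt (2 * t) = 2 * t := Real.mul_self_sqrt (by positivity)
  have h5 : 0 < Real.sqrt (2 * t) := Real.sqrt_pos.2 (by positivity)
  field_simp
  linear_combination (-1 : ℝ) * h4

/-- `e^t K_ν(t)`, with the integrand of `K_{1/2}` split off. -/
theorem coshK_zero_eq_lintegral (ν : ℝ) {t : ℝ} (ht : 0 < t) :
    ENNReal.ofReal (Real.exp t * coshK 0 ν t) = ∫⁻ σ in Ioi (0 : ℝ),
      ENNReal.ofReal (Real.exp (-(2 * t * Real.sinh (σ / 2) ^ 2)) * Real.cosh (σ / 2)) *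
        ENNReal.ofReal (Real.cosh (ν * σ) / Real.cosh (σ / 2)) := by
  rw [coshK, ← integral_const_mul, ofReal_integral_eq_lintegral_ofReal
    ((integrableOn_coshK 0 ν ht).const_mul _)
    (ae_of_all _ fun σ => mul_nonneg (Real.exp_pos _).le (coshK_integrand_nonneg 0 ν t σ))]
  refine lintegral_congr fun σ => ?_
  have hch := Real.cosh_pos (σ / 2)
  have hch' := Real.cosh_pos (ν * σ)
  rw [← ENNReal.ofReal_mul (by positivity)]
  congr 1
  have h1 : Real.cosh σ = 1 + 2 * Real.sinh (σ / 2) ^ 2 := by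
    have := Real.cosh_two_mul (σ / 2)
    have h2 := Real.cosh_sq (σ / 2)
    rw [show 2 * (σ / 2) = σ by ring] at this
    linarith
  rw [pow_zero, mul_one, ← mul_assoc, ← Real.exp_add, h1]
  field_simp
  ring_nf

theorem sqrt_mul_exp_mul_coshK (ν : ℝ) {t : ℝ} (ht : 0 < t) :
    Real.sqrt (2 * Real.pi * t) * (Real.exp t * coshK 0 ν t) = Real.pi * normK ν t := by
  have : Real.sqrt (2 * Real.pi * t) = Real.pi * Real.sqrt (2 * t / Real.pi) := by
    have hp := Real.pi_pos
    rw [show 2 * Real.pi * t = Real.pi ^ 2 * (2 * t / Real.pi) by field_simp,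
      Real.sqrt_mul (by positivity), Real.sqrt_sq hp.le]
  rw [this, normK]
  ring

/-- The integral on the left is `π`; here it is only used that it does not depend on `t`. -/
theorem lintegral_rpow_div_one_add_eq (t : ℝ) (ht : 0 < t) :
    ∫⁻ w in Ioi (0 : ℝ), ENNReal.ofReal (w ^ (-(1 / 2) : ℝ) / (1 + w)) =
      ENNReal.ofReal (Real.pi * normK (1 / 2) t) := by
  have h := lintegral_erfc ht le_rfl
  have h2 := coshK_zero_eq_lintegral (1 / 2) ht
  have h3 : ∀ σ : ℝ, ENNReal.ofReal (Real.cosh (1 / 2 * σ) / Real.cosh (σ / 2)) = 1 := by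
    intro σ
    rw [show 1 / 2 * σ = σ / 2 by ring, div_self (Real.cosh_pos _).ne', ENNReal.ofReal_one]
  simp only [h3, mul_one] at h2
  rw [← h2, ← ENNReal.ofReal_mul (by positivity), sqrt_mul_exp_mul_coshK _ ht] at h
  rw [← h]
  simp

/-- `K_{1/2}(x) = (π / (2x))^{1/2} e^{-x}`. -/
theorem normK_one_half {t : ℝ} (ht : 0 < t) : normK (1 / 2) t = 1 := by
  have hnn : ∀ t : ℝ, 0 ≤ normK (1 / 2) t := fun t =>
    mul_nonneg (by positivity) (coshK_nonneg _ _ _)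
  have hconst : ∀ s : ℝ, 0 < s → normK (1 / 2) s = normK (1 / 2) t := by
    intro s hs
    have h := (lintegral_rpow_div_one_add_eq s hs).symm.trans (lintegral_rpow_div_one_add_eq t ht)
    have hp := Real.pi_pos
    rw [ENNReal.ofReal_eq_ofReal_iff (mul_nonneg hp.le (hnn _)) (mul_nonneg hp.le (hnn _))] at h
    exact mul_left_cancel₀ hp.ne' h
  refine tendsto_nhds_unique (tendsto_const_nhds.congr' ?_) (tendsto_normK (1 / 2))
  filter_upwards [eventually_gt_atTop 0] with s hs
  exact (hconst s hs).symm

theorem coshK_abs (j : ℕ) (ν x : ℝ) : coshK j |ν| x = coshK j ν x := by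
  unfold coshK
  refine setIntegral_congr_fun measurableSet_Ioi fun t ht => ?_
  have : Real.cosh (|ν| * t) = Real.cosh (ν * t) := by
    rw [← Real.cosh_abs (|ν| * t), ← Real.cosh_abs (ν * t), abs_mul, abs_abs, abs_mul]
  simp only [this]

theorem normK_abs (ν x : ℝ) : normK |ν| x = normK ν x := by
  unfold normK
  rw [coshK_abs]

/-- The derivative of `cosh (aσ) / cosh (σ/2)`. -/
noncomputable def coshQuotDeriv (a σ : ℝ) : ℝ :=
  (a * Real.sinh (a * σ) * Real.cosh (σ / 2) - 1 / 2 * Real.cosh (a * σ) * Real.sinh (σ / 2)) /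
    Real.cosh (σ / 2) ^ 2

theorem hasDerivAt_coshQuot (a σ : ℝ) :
    HasDerivAt (fun σ => Real.cosh (a * σ) / Real.cosh (σ / 2)) (coshQuotDeriv a σ) σ := by
  have h1 : HasDerivAt (fun σ : ℝ => σ / 2) (1 / 2) σ := (hasDerivAt_id σ).div_const 2
  have h2 : HasDerivAt (fun σ : ℝ => a * σ) a σ := by
    simpa using (hasDerivAt_id σ).const_mul a
  refine (h2.cosh.div h1.cosh (Real.cosh_pos _).ne').congr_deriv ?_
  rw [coshQuotDeriv]
  congr 1
  ring

theorem continuous_coshQuotDeriv (a : ℝ) : Continuous (coshQuotDeriv a) := by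
  have hcs := Real.continuous_sinh
  have hcc := Real.continuous_cosh
  unfold coshQuotDeriv
  refine Continuous.div (by fun_prop) (by fun_prop) fun σ => ?_
  have := Real.cosh_pos (σ / 2)
  positivity

/-- `cosh (aσ) / cosh (σ/2)` is increasing for `a ≥ 1/2`. -/
theorem coshQuotDeriv_nonneg {a : ℝ} (ha : 1 / 2 ≤ a) {σ : ℝ} (hσ : 0 ≤ σ) :
    0 ≤ coshQuotDeriv a σ := by
  refine div_nonneg ?_ (by positivity)
  have h1 : 0 ≤ Real.sinh (a * σ - σ / 2) := Real.sinh_nonneg_iff.2 (by nlinarith)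
  rw [Real.sinh_sub] at h1
  have h2 : 0 ≤ Real.sinh (a * σ) := Real.sinh_nonneg_iff.2 (by positivity)
  have h3 := Real.cosh_pos (σ / 2)
  nlinarith [mul_nonneg h2 h3.le]

theorem lintegral_coshQuotDeriv {a : ℝ} (ha : 1 / 2 ≤ a) {σ : ℝ} (hσ : 0 ≤ σ) :
    ENNReal.ofReal (Real.cosh (a * σ) / Real.cosh (σ / 2)) =
      1 + ∫⁻ τ in Ioc 0 σ, ENNReal.ofReal (coshQuotDeriv a τ) := by
  have h1 := intervalIntegral.integral_eq_sub_of_hasDerivAt (a := 0) (b := σ)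
    (fun τ _ => hasDerivAt_coshQuot a τ) ((continuous_coshQuotDeriv a).intervalIntegrable _ _)
  have hnn : ∀ τ ∈ Ioc 0 σ, 0 ≤ coshQuotDeriv a τ := fun τ hτ => coshQuotDeriv_nonneg ha hτ.1.le
  rw [intervalIntegral.integral_of_le hσ] at h1
  rw [← ofReal_integral_eq_lintegral_ofReal
    ((continuous_coshQuotDeriv a).integrableOn_Ioc)
    ((ae_restrict_iff' measurableSet_Ioc).2 (ae_of_all _ hnn)), h1, ← ENNReal.ofReal_one,
    ← ENNReal.ofReal_add zero_le_one]
  · congr 1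
    simp
  · rw [← h1]
    exact setIntegral_nonneg measurableSet_Ioc hnn

/-- For `|ν| ≥ 1/2`, `e^{-2t} (2t/π)^{1/2} e^t K_ν(t)` is the Laplace transform, in `2t`, of a
positive measure on `[1, ∞)`. -/
theorem exists_measure_normK_of_half_le {ν : ℝ} (hν : 1 / 2 ≤ |ν|) :
    ∃ μ : Measure ℝ, SFinite μ ∧ μ (Iio 1) = 0 ∧ ∀ t : ℝ, 0 < t →
      ENNReal.ofReal (Real.exp (-(2 * t)) * normK ν t) =
        ∫⁻ r, ENNReal.ofReal (Real.exp (-(2 * t * r))) ∂μ := by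
  have hcs := Real.continuous_sinh
  have hcc := Real.continuous_cosh
  have hcd := (continuous_coshQuotDeriv |ν|).measurable
  have hp := Real.pi_pos
  -- the absolute value makes `R ≥ 1` hold everywhere; the measure lives on positive coordinates
  let R : ℝ × ℝ → ℝ := fun z => 1 + Real.sinh (z.1 / 2) ^ 2 * (1 + |z.2|)
  have hR : Measurable R := by fun_prop
  let d : ℝ × ℝ → ENNReal := fun z => ENNReal.ofReal (coshQuotDeriv |ν| z.1) *
    ENNReal.ofReal (z.2 ^ (-(1 / 2) : ℝ) / (1 + z.2))
  have hd : Measurable d := by fun_prop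
  let ρ : Measure (ℝ × ℝ) :=
    ((volume.restrict (Ioi 0)).prod (volume.restrict (Ioi 0))).withDensity d
  -- the point mass comes from the value at `0` of `cosh (νσ) / cosh (σ/2)`
  refine ⟨Measure.dirac 1 + ENNReal.ofReal Real.pi⁻¹ • ρ.map R, inferInstance, ?_, ?_⟩
  · rw [Measure.add_apply, Measure.smul_apply, Measure.map_apply hR measurableSet_Iio,
      Measure.dirac_apply' _ measurableSet_Iio]
    have : R ⁻¹' Iio 1 = ∅ := by
      ext z
      simp only [mem_preimage, mem_Iio, mem_empty_iff_false, iff_false, not_lt, R]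
      have : 0 ≤ Real.sinh (z.1 / 2) ^ 2 * (1 + |z.2|) := by positivity
      linarith
    rw [this]
    simp
  intro t ht
  set g : ℝ → ENNReal := fun σ =>
    ENNReal.ofReal (Real.exp (-(2 * t * Real.sinh (σ / 2) ^ 2)) * Real.cosh (σ / 2)) with hg
  have hgm : Measurable g := by fun_prop
  have hmap : ∫⁻ r, ENNReal.ofReal (Real.exp (-(2 * t * r))) ∂(ρ.map R) =
      ENNReal.ofReal (Real.exp (-(2 * t))) * ∫⁻ τ in Ioi (0 : ℝ),
        ENNReal.ofReal (coshQuotDeriv |ν| τ) *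
          (ENNReal.ofReal (Real.sqrt (2 * Real.pi * t)) * ∫⁻ σ in Ioi τ, g σ) := by
    rw [lintegral_map (by fun_prop) hR, lintegral_withDensity_eq_lintegral_mul _ hd (by fun_prop),
      lintegral_prod _ (by fun_prop), ← lintegral_const_mul']
    swap
    · exact ENNReal.ofReal_ne_top
    refine setLIntegral_congr_fun measurableSet_Ioi fun τ hτ => ?_
    have hτ0 : (0 : ℝ) < τ := hτ
    simp only [hg]
    rw [← lintegral_erfc ht hτ0.le, mul_left_comm, ← lintegral_const_mul _ (by fun_prop),
      ← lintegral_const_mul _ (by fun_prop)]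
    refine setLIntegral_congr_fun measurableSet_Ioi fun w hw => ?_
    have hw0 : (0 : ℝ) < w := hw
    simp only [Pi.mul_apply, d, R]
    rw [mul_assoc, abs_of_pos hw0, ENNReal.ofReal_mul' (Real.exp_pos _).le, mul_left_comm
      (ENNReal.ofReal (Real.exp (-(2 * t)))), ← ENNReal.ofReal_mul (Real.exp_pos _).le,
      ← Real.exp_add]
    congr 4
    ring_nf
  have hswap : ∫⁻ τ in Ioi (0 : ℝ), ENNReal.ofReal (coshQuotDeriv |ν| τ) * ∫⁻ σ in Ioi τ, g σ =
      ∫⁻ σ in Ioi (0 : ℝ), g σ * ∫⁻ τ in Ioc 0 σ, ENNReal.ofReal (coshQuotDeriv |ν| τ) := by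
    have e1 : ∀ τ ∈ Ioi (0 : ℝ), ENNReal.ofReal (coshQuotDeriv |ν| τ) * ∫⁻ σ in Ioi τ, g σ =
        ∫⁻ σ in Ioi (0 : ℝ), {z : ℝ × ℝ | z.1 < z.2}.indicator
          (fun z => ENNReal.ofReal (coshQuotDeriv |ν| z.1) * g z.2) (τ, σ) := by
      intro τ hτ
      have hτ0 : (0 : ℝ) < τ := hτ
      rw [← lintegral_const_mul _ hgm, ← lintegral_indicator measurableSet_Ioi,
        ← lintegral_indicator measurableSet_Ioi]
      refine lintegral_congr fun σ => ?_
      by_cases h : τ < σ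
      · rw [indicator_of_mem (show σ ∈ Ioi τ from h), indicator_of_mem
          (show σ ∈ Ioi (0 : ℝ) from hτ0.trans h), indicator_of_mem
          (show (τ, σ) ∈ {z : ℝ × ℝ | z.1 < z.2} from h)]
      · rw [indicator_of_notMem (show σ ∉ Ioi τ from h)]
        by_cases h' : σ ∈ Ioi (0 : ℝ)
        · rw [indicator_of_mem h', indicator_of_notMem
            (show (τ, σ) ∉ {z : ℝ × ℝ | z.1 < z.2} from h)]
        · rw [indicator_of_notMem h']
    have hms : MeasurableSet {z : ℝ × ℝ | z.1 < z.2} :=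
      measurableSet_lt measurable_fst measurable_snd
    rw [setLIntegral_congr_fun measurableSet_Ioi e1, lintegral_lintegral_swap]
    swap
    · exact (Measurable.indicator (by fun_prop) hms).aemeasurable
    refine setLIntegral_congr_fun measurableSet_Ioi fun σ hσ => ?_
    have hσ0 : (0 : ℝ) < σ := hσ
    rw [← lintegral_const_mul _ (by fun_prop), ← lintegral_indicator measurableSet_Ioi,
      restrict_Ioo_eq_restrict_Ioc.symm, ← lintegral_indicator measurableSet_Ioo]
    refine lintegral_congr fun τ => ?_
    by_cases h : τ ∈ Ioo 0 σ
    · rw [indicator_of_mem h, indicator_of_mem (show τ ∈ Ioi (0 : ℝ) from h.1), indicator_of_mem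
        (show (τ, σ) ∈ {z : ℝ × ℝ | z.1 < z.2} from h.2), mul_comm]
    · rw [indicator_of_notMem h]
      by_cases h' : τ ∈ Ioi (0 : ℝ)
      · rw [indicator_of_mem h', indicator_of_notMem]
        exact fun h'' => h ⟨h', h''⟩
      · rw [indicator_of_notMem h']
  have hhalf : ENNReal.ofReal (Real.sqrt (2 * Real.pi * t)) * ∫⁻ σ in Ioi (0 : ℝ), g σ =
      ENNReal.ofReal Real.pi := by
    have h := lintegral_erfc ht le_rfl
    have e := lintegral_rpow_div_one_add_eq t ht
    rw [normK_one_half ht, mul_one] at e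
    rw [← h, ← e]
    simp
  have hmain : ENNReal.ofReal (Real.pi * normK ν t) = ENNReal.ofReal Real.pi +
      ENNReal.ofReal (Real.sqrt (2 * Real.pi * t)) * ∫⁻ τ in Ioi (0 : ℝ),
        ENNReal.ofReal (coshQuotDeriv |ν| τ) * ∫⁻ σ in Ioi τ, g σ := by
    rw [hswap, ← hhalf, ← mul_add, ← lintegral_add_left hgm, ← normK_abs,
      ← sqrt_mul_exp_mul_coshK _ ht, ENNReal.ofReal_mul (by positivity),
      coshK_zero_eq_lintegral _ ht]
    congr 1
    refine setLIntegral_congr_fun measurableSet_Ioi fun σ hσ => ?_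
    have hσ0 : (0 : ℝ) < σ := hσ
    rw [lintegral_coshQuotDeriv hν hσ0.le, mul_add, mul_one]
  rw [lintegral_add_measure, lintegral_smul_measure, hmap, lintegral_dirac' _ (by fun_prop)]
  have e2 : Real.exp (-(2 * t)) * normK ν t =
      Real.exp (-(2 * t)) * (Real.pi⁻¹ * (Real.pi * normK ν t)) := by
    rw [inv_mul_cancel_left₀ hp.ne']
  rw [e2, ENNReal.ofReal_mul (Real.exp_pos _).le, ENNReal.ofReal_mul (inv_pos.2 hp).le, hmain,
    mul_add, ← ENNReal.ofReal_mul (inv_pos.2 hp).le, inv_mul_cancel₀ hp.ne', ENNReal.ofReal_one,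
    mul_add, mul_one, mul_one, smul_eq_mul]
  congr 1
  rw [mul_left_comm]
  congr 2
  rw [← lintegral_const_mul']
  · refine lintegral_congr fun τ => ?_
    rw [mul_left_comm]
  · exact ENNReal.ofReal_ne_top

/-- The elementary case of order `1/2`. -/
theorem macdonald_one_half {x : ℝ} (hx : 0 < x) :
    macdonald (1 / 2) (x ^ 2 / 4) = Real.sqrt Real.pi * Real.exp (-x) := by
  have h := normK_one_half hx
  have hp := Real.pi_pos
  rw [normK] at h
  have h1 : (x / 2) ^ (1 / 2 : ℝ) * 2 = Real.sqrt Real.pi * Real.sqrt (2 * x / Real.pi) := by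
    rw [← Real.sqrt_mul hp.le, show Real.pi * (2 * x / Real.pi) = (x / 2) * 2 ^ 2 by
      field_simp, Real.sqrt_mul (by positivity), Real.sqrt_sq two_pos.le, Real.sqrt_eq_rpow]
  have h2 : Real.exp x * Real.exp (-x) = 1 := by rw [← Real.exp_add]; simp
  rw [macdonald_eq_coshK _ hx]
  linear_combination coshK 0 (1 / 2) x * h1 + (Real.sqrt Real.pi * Real.exp (-x)) * h -
    (Real.sqrt Real.pi * Real.sqrt (2 * x / Real.pi) * coshK 0 (1 / 2) x) * h2

theorem lintegral_macdonald_one_half {b x : ℝ} (hb : 0 < b) (hx : 0 < x) :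
    ∫⁻ τ in Ioi (0 : ℝ), ENNReal.ofReal (τ ^ (-(1 / 2) : ℝ) *
        Real.exp (-(b ^ 2 * τ) - x ^ 2 / 4 / τ)) =
      ENNReal.ofReal (b⁻¹ * (Real.sqrt Real.pi * Real.exp (-(x * b)))) := by
  have hbx : 0 < x * b := by positivity
  have h := integral_comp_mul_left_Ioi (fun τ : ℝ => τ ^ ((1 / 2 : ℝ) - 1) *
    Real.exp (-τ - (x * b) ^ 2 / 4 / τ)) 0 (show 0 < b ^ 2 by positivity)
  have hi := (integrableOn_Ioi_comp_mul_left_iff (fun τ : ℝ => τ ^ ((1 / 2 : ℝ) - 1) *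
    Real.exp (-τ - (x * b) ^ 2 / 4 / τ)) 0 (show 0 < b ^ 2 by positivity)).2
    (by rw [mul_zero]; exact integrableOn_macdonald (1 / 2) (by positivity))
  rw [mul_zero] at h
  have h1 := macdonald_one_half hbx
  rw [macdonald] at h1
  rw [h1, smul_eq_mul] at h
  have e : ∀ τ ∈ Ioi (0 : ℝ), ENNReal.ofReal (τ ^ (-(1 / 2) : ℝ) *
        Real.exp (-(b ^ 2 * τ) - x ^ 2 / 4 / τ)) = ENNReal.ofReal b *
      ENNReal.ofReal ((b ^ 2 * τ) ^ ((1 / 2 : ℝ) - 1) *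
        Real.exp (-(b ^ 2 * τ) - (x * b) ^ 2 / 4 / (b ^ 2 * τ))) := by
    intro τ hτ
    have hτ0 : (0 : ℝ) < τ := hτ
    rw [← ENNReal.ofReal_mul hb.le]
    congr 1
    have hb2 : (b ^ 2) ^ (-(1 / 2) : ℝ) = b⁻¹ := by
      rw [Real.rpow_neg (by positivity), ← Real.sqrt_eq_rpow, Real.sqrt_sq hb.le]
    rw [Real.mul_rpow (by positivity) hτ0.le, show (1 / 2 : ℝ) - 1 = -(1 / 2) by norm_num, hb2]
    have : (x * b) ^ 2 / 4 / (b ^ 2 * τ) = x ^ 2 / 4 / τ := by field_simp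
    rw [this]
    field_simp
  rw [setLIntegral_congr_fun measurableSet_Ioi e, lintegral_const_mul _ (by fun_prop),
    ← ofReal_integral_eq_lintegral_ofReal hi, h, ← ENNReal.ofReal_mul hb.le]
  · congr 1
    field_simp
  · refine (ae_restrict_iff' measurableSet_Ioi).2 (ae_of_all _ fun τ hτ => ?_)
    have hτ0 : (0 : ℝ) < τ := hτ
    positivity

/-- For `a < 1/2`, a Laplace representation of `x^a K_a(x)`: in the integral over `τ`, write
`τ^{a-1/2}` as a multiple of `∫_0^∞ v^{-a-1/2} e^{-τv} dv`, and use the formula for order `1/2`. -/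
theorem lintegral_macdonald_laplace {a : ℝ} (ha1 : a < 1 / 2) {x : ℝ} (hx : 0 < x) :
    ENNReal.ofReal (Real.Gamma (1 / 2 - a) * macdonald a (x ^ 2 / 4)) =
      ∫⁻ v in Ioi (0 : ℝ), ENNReal.ofReal (v ^ (-a - 1 / 2)) * ENNReal.ofReal
        ((Real.sqrt (1 + v))⁻¹ * (Real.sqrt Real.pi * Real.exp (-(x * Real.sqrt (1 + v))))) := by
  have hq : 0 < x ^ 2 / 4 := by positivity
  have hG : 0 < Real.Gamma (1 / 2 - a) := Real.Gamma_pos_of_pos (by linarith)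
  have e1 : ∀ v ∈ Ioi (0 : ℝ), ENNReal.ofReal (v ^ (-a - 1 / 2)) * ENNReal.ofReal
        ((Real.sqrt (1 + v))⁻¹ * (Real.sqrt Real.pi * Real.exp (-(x * Real.sqrt (1 + v))))) =
      ∫⁻ τ in Ioi (0 : ℝ), ENNReal.ofReal (v ^ (-a - 1 / 2)) *
        ENNReal.ofReal (τ ^ (-(1 / 2) : ℝ) * Real.exp (-((1 + v) * τ) - x ^ 2 / 4 / τ)) := by
    intro v hv
    have hv0 : (0 : ℝ) < v := hv
    have h1v : 0 < 1 + v := by linarith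
    rw [lintegral_const_mul _ (by fun_prop), ← lintegral_macdonald_one_half
      (Real.sqrt_pos.2 h1v) hx, Real.sq_sqrt h1v.le]
  rw [setLIntegral_congr_fun measurableSet_Ioi e1, lintegral_lintegral_swap]
  swap
  · refine Measurable.aemeasurable ?_
    fun_prop
  rw [macdonald, ← integral_const_mul, ofReal_integral_eq_lintegral_ofReal
    ((integrableOn_macdonald a hq).const_mul _)]
  swap
  · refine (ae_restrict_iff' measurableSet_Ioi).2 (ae_of_all _ fun τ hτ => ?_)
    have hτ0 : (0 : ℝ) < τ := hτ
    positivity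
  refine setLIntegral_congr_fun measurableSet_Ioi fun τ hτ => ?_
  have hτ0 : (0 : ℝ) < τ := hτ
  have e2 : ∀ v ∈ Ioi (0 : ℝ), ENNReal.ofReal (v ^ (-a - 1 / 2)) *
        ENNReal.ofReal (τ ^ (-(1 / 2) : ℝ) * Real.exp (-((1 + v) * τ) - x ^ 2 / 4 / τ)) =
      ENNReal.ofReal (τ ^ (-(1 / 2) : ℝ) * Real.exp (-τ - x ^ 2 / 4 / τ)) *
        ENNReal.ofReal (v ^ ((1 / 2 - a) - 1) * Real.exp (-(τ * v))) := by
    intro v hv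
    have hv0 : (0 : ℝ) < v := hv
    rw [← ENNReal.ofReal_mul (by positivity), ← ENNReal.ofReal_mul (by positivity)]
    congr 1
    have : Real.exp (-((1 + v) * τ) - x ^ 2 / 4 / τ) =
        Real.exp (-τ - x ^ 2 / 4 / τ) * Real.exp (-(τ * v)) := by
      rw [← Real.exp_add]; ring_nf
    rw [this, show (1 / 2 - a) - 1 = -a - 1 / 2 by ring]
    ring
  rw [setLIntegral_congr_fun measurableSet_Ioi e2, lintegral_const_mul _ (by fun_prop),
    lintegral_rpow_mul_exp_neg_mul (by linarith) hτ0, ← ENNReal.ofReal_mul (by positivity)]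
  congr 1
  have : τ ^ (-(1 / 2) : ℝ) * τ ^ (-(1 / 2 - a)) = τ ^ (a - 1) := by
    rw [← Real.rpow_add hτ0]; ring_nf
  rw [← this]
  ring

/-- For `|ν| < 1/2`, `t^{|ν|-1/2} e^{-2t} (2t/π)^{1/2} e^t K_ν(t)` is the Laplace transform, in
`2t`, of a positive measure on `[1, ∞)`. -/
theorem exists_measure_normK_of_lt_half {ν : ℝ} (hν : |ν| < 1 / 2) :
    ∃ μ : Measure ℝ, SFinite μ ∧ μ (Iio 1) = 0 ∧ ∀ t : ℝ, 0 < t →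
      ENNReal.ofReal (t ^ (|ν| - 1 / 2) * (Real.exp (-(2 * t)) * normK ν t)) =
        ∫⁻ r, ENNReal.ofReal (Real.exp (-(2 * t * r))) ∂μ := by
  set a := |ν| with ha
  have hp := Real.pi_pos
  have hG : 0 < Real.Gamma (1 / 2 - a) := Real.Gamma_pos_of_pos (by linarith)
  let R : ℝ → ℝ := fun v => (1 + Real.sqrt (1 + |v|)) / 2
  have hR : Measurable R := by fun_prop
  let d : ℝ → ENNReal := fun v => ENNReal.ofReal (v ^ (-a - 1 / 2)) *
    ENNReal.ofReal ((Real.sqrt (1 + v))⁻¹ * Real.sqrt Real.pi)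
  have hd : Measurable d := by fun_prop
  let ρ : Measure ℝ := (volume.restrict (Ioi 0)).withDensity d
  set c : ℝ := Real.sqrt (2 / Real.pi) * 2 ^ a / 2 / Real.Gamma (1 / 2 - a) with hc
  have hc0 : 0 ≤ c := by positivity
  refine ⟨ENNReal.ofReal c • ρ.map R, inferInstance, ?_, ?_⟩
  · rw [Measure.smul_apply, Measure.map_apply hR measurableSet_Iio]
    have : R ⁻¹' Iio 1 = ∅ := by
      ext v
      simp only [mem_preimage, mem_Iio, mem_empty_iff_false, iff_false, not_lt, R]
      have : 1 ≤ Real.sqrt (1 + |v|) := Real.one_le_sqrt.2 (by simp)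
      linarith
    rw [this]
    simp
  intro t ht
  have h1 : t ^ (a - 1 / 2) * (Real.exp (-(2 * t)) * normK ν t) =
      c * (Real.exp (-t) * (Real.Gamma (1 / 2 - a) * macdonald a (t ^ 2 / 4))) := by
    rw [← normK_abs ν, ← ha, normK, macdonald_eq_coshK a ht, hc,
      show 2 * t / Real.pi = t * (2 / Real.pi) by ring, Real.sqrt_mul ht.le,
      Real.div_rpow ht.le two_pos.le, Real.rpow_sub ht, ← Real.sqrt_eq_rpow]
    have e : Real.exp (-(2 * t)) * Real.exp t = Real.exp (-t) := by
      rw [← Real.exp_add]; ring_nf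
    have hs : 0 < Real.sqrt t := Real.sqrt_pos.2 ht
    have h2a : (0 : ℝ) < 2 ^ a := by positivity
    rw [← e]
    generalize Real.Gamma (1 / 2 - a) = G at hG ⊢
    field_simp
  rw [h1, ENNReal.ofReal_mul hc0, ENNReal.ofReal_mul (Real.exp_pos _).le,
    lintegral_macdonald_laplace hν ht, lintegral_smul_measure, smul_eq_mul,
    lintegral_map (by fun_prop) hR, lintegral_withDensity_eq_lintegral_mul _ hd (by fun_prop),
    ← lintegral_const_mul _ (by fun_prop)]
  congr 1
  refine setLIntegral_congr_fun measurableSet_Ioi fun v hv => ?_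
  have hv0 : (0 : ℝ) < v := hv
  simp only [Pi.mul_apply, d, R]
  have e : Real.exp (-(2 * t * ((1 + Real.sqrt (1 + v)) / 2))) =
      Real.exp (-t) * Real.exp (-(t * Real.sqrt (1 + v))) := by
    rw [← Real.exp_add]; ring_nf
  rw [abs_of_pos hv0, e, ← ENNReal.ofReal_mul (by positivity), ← ENNReal.ofReal_mul (by positivity),
    ← ENNReal.ofReal_mul (by positivity), ← ENNReal.ofReal_mul (by positivity)]
  congr 1
  ring

/-! ### The Stieltjes transform of `t^a e^{-t} K_ν(t)` -/

/-- The weight `t^a e^{-t} K_ν(t)` on `(0, ∞)`. -/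
noncomputable def besselWeight (a ν t : ℝ) : ℝ := t ^ a * Real.exp (-t) * coshK 0 ν t

/-- The integrals `∫_0^∞ t^a e^{-t} K_ν(t) / (x + t)^(j+1) dt`. -/
noncomputable def stieltjesK (a ν : ℝ) (j : ℕ) (x : ℝ) : ℝ :=
  ∫ t in Ioi (0 : ℝ), besselWeight a ν t / (x + t) ^ (j + 1)

theorem besselWeight_pos (a ν : ℝ) {t : ℝ} (ht : 0 < t) : 0 < besselWeight a ν t := by
  have := coshK_pos 0 ν ht
  unfold besselWeight
  positivity

theorem continuousOn_besselWeight (a ν : ℝ) : ContinuousOn (besselWeight a ν) (Ioi 0) := by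
  intro t ht
  have ht0 : (0 : ℝ) < t := ht
  have h1 : ContinuousAt (coshK 0 ν) t := (hasDerivAt_coshK 0 ν ht0).continuousAt
  have h2 : ContinuousAt (fun t : ℝ => t ^ a) t :=
    Real.continuousAt_rpow_const _ _ (Or.inl ht0.ne')
  have h3 : ContinuousAt (fun t : ℝ => Real.exp (-t)) t := by fun_prop
  exact ((h2.mul h3).mul h1).continuousWithinAt

theorem aestronglyMeasurable_besselWeight (a ν : ℝ) :
    AEStronglyMeasurable (besselWeight a ν) (volume.restrict (Ioi 0)) :=
  (continuousOn_besselWeight a ν).aestronglyMeasurable measurableSet_Ioi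

theorem integrableOn_besselWeight {a ν : ℝ} (h : |ν| < a + 1) :
    IntegrableOn (besselWeight a ν) (Ioi 0) := by
  obtain ⟨μ, hμ1, hμ2⟩ := exists_between h
  obtain ⟨C, hC⟩ := exists_coshK_le 0 hμ1
  have hg : IntegrableOn (fun t : ℝ => Real.exp (-t) * t ^ ((a - μ + 1) - 1)) (Ioi 0) :=
    Real.GammaIntegral_convergent (by linarith)
  refine Integrable.mono' (hg.const_mul C) (aestronglyMeasurable_besselWeight a ν) ?_
  refine (ae_restrict_iff' measurableSet_Ioi).2 (ae_of_all _ fun t ht => ?_)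
  have ht0 : (0 : ℝ) < t := ht
  rw [Real.norm_of_nonneg (besselWeight_pos a ν ht0).le, besselWeight]
  have h1 := hC t ht0
  have h2 : t ^ ((a - μ + 1) - 1) = t ^ a * t ^ (-(μ + (0 : ℕ))) := by
    rw [← Real.rpow_add ht0]; congr 1; push_cast; ring
  rw [h2]
  calc t ^ a * Real.exp (-t) * coshK 0 ν t
      ≤ t ^ a * Real.exp (-t) * (C * t ^ (-(μ + (0 : ℕ)))) := by gcongr
    _ = _ := by ring

theorem integrableOn_besselWeight_div {a ν : ℝ} (h : |ν| < a + 1) (n : ℕ) {x : ℝ} (hx : 0 < x) :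
    IntegrableOn (fun t => besselWeight a ν t / (x + t) ^ n) (Ioi 0) := by
  refine Integrable.mono' ((integrableOn_besselWeight h).div_const (x ^ n)) ?_ ?_
  · refine ContinuousOn.aestronglyMeasurable ?_ measurableSet_Ioi
    refine (continuousOn_besselWeight a ν).div (by fun_prop) fun t ht => ?_
    have ht0 : (0 : ℝ) < t := ht
    positivity
  · refine (ae_restrict_iff' measurableSet_Ioi).2 (ae_of_all _ fun t ht => ?_)
    have ht0 : (0 : ℝ) < t := ht
    have := besselWeight_pos a ν ht0
    rw [Real.norm_of_nonneg (by positivity)]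
    gcongr
    linarith

theorem stieltjesK_nonneg (a ν : ℝ) (j : ℕ) {x : ℝ} (hx : 0 < x) : 0 ≤ stieltjesK a ν j x := by
  refine setIntegral_nonneg measurableSet_Ioi fun t ht => ?_
  have ht0 : (0 : ℝ) < t := ht
  have := besselWeight_pos a ν ht0
  positivity

theorem stieltjesK_le {a ν : ℝ} (h : |ν| < a + 1) (j : ℕ) {x : ℝ} (hx : 0 < x) :
    stieltjesK a ν j x ≤ (∫ t in Ioi (0 : ℝ), besselWeight a ν t) / x ^ (j + 1) := by
  rw [← integral_div]
  refine setIntegral_mono_on (integrableOn_besselWeight_div h _ hx)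
    ((integrableOn_besselWeight h).div_const _) measurableSet_Ioi fun t ht => ?_
  have ht0 : (0 : ℝ) < t := ht
  have := besselWeight_pos a ν ht0
  gcongr
  linarith

theorem hasDerivAt_stieltjesK {a ν : ℝ} (h : |ν| < a + 1) (j : ℕ) {x : ℝ} (hx : 0 < x) :
    HasDerivAt (stieltjesK a ν j) (-((j + 1) * stieltjesK a ν (j + 1) x)) x := by
  have hm : ∀ n : ℕ, ∀ x : ℝ, 0 < x → AEStronglyMeasurable
      (fun t => besselWeight a ν t / (x + t) ^ n) (volume.restrict (Ioi 0)) := fun n x hx =>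
    (integrableOn_besselWeight_div h n hx).aestronglyMeasurable
  have hd := (hasDerivAt_integral_of_dominated_loc_of_deriv_le
    (μ := volume.restrict (Ioi (0 : ℝ)))
    (F := fun (x t : ℝ) => besselWeight a ν t / (x + t) ^ (j + 1))
    (F' := fun (x t : ℝ) => -((j + 1) * (besselWeight a ν t / (x + t) ^ (j + 1 + 1))))
    (bound := fun t => (j + 1) * (besselWeight a ν t / (x / 2 + t) ^ (j + 1 + 1)))
    (x₀ := x) (Ioi_mem_nhds (half_lt_self hx))
    (by
      filter_upwards [lt_mem_nhds hx] with y hy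
      exact hm _ y hy)
    (integrableOn_besselWeight_div h _ hx)
    ((hm _ x hx).const_mul _).neg
    ((ae_restrict_iff' measurableSet_Ioi).2 (ae_of_all _ fun t ht z hz => by
      have ht0 : (0 : ℝ) < t := ht
      have hz0 : x / 2 < z := hz
      have hz1 : 0 < z := by linarith
      have := besselWeight_pos a ν ht0
      rw [norm_neg, Real.norm_of_nonneg (by positivity)]
      gcongr))
    ((integrableOn_besselWeight_div h _ (half_pos hx)).const_mul _)
    ((ae_restrict_iff' measurableSet_Ioi).2 (ae_of_all _ fun t ht z hz => by
      have ht0 : (0 : ℝ) < t := ht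
      have hz0 : x / 2 < z := hz
      have hz1 : 0 < z + t := by linarith
      have h1 : HasDerivAt (fun z : ℝ => (z + t) ^ (j + 1)) ((j + 1 : ℕ) * (z + t) ^ j * 1) z := by
        simpa using ((hasDerivAt_id z).add_const t).fun_pow (j + 1)
      refine ((hasDerivAt_const z (besselWeight a ν t)).div h1 (by positivity)).congr_deriv ?_
      push_cast
      field_simp
      ring))).2
  rw [integral_neg, integral_const_mul] at hd
  exact hd

/-- The bilinear concomitant of `t^{1/2} K_ν(t)` and `t^{a+3/2} e^{-t} / (x + t)`. -/
noncomputable def concomitant (a ν x t : ℝ) : ℝ :=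
  t ^ a * t * Real.exp (-t) * (coshK 0 ν t * ((a + 1) / (x + t) - t / (x + t) ^ 2 - t / (x + t)) +
    t * coshK 1 ν t / (x + t))

/-- The derivative of the concomitant involves no derivatives of `K_ν`: those cancel by Bessel's
equation. What remains is a combination of the integrands of the Stieltjes transforms. -/
theorem hasDerivAt_concomitant (a ν : ℝ) {x t : ℝ} (hx : 0 < x) (ht : 0 < t) :
    HasDerivAt (concomitant a ν x)
      ((a ^ 2 - ν ^ 2 + (2 * a - 1) * x) * (besselWeight a ν t / (x + t) ^ (0 + 1)) +
        ((2 * a - 1) * x + 2 * x ^ 2) * (besselWeight a ν t / (x + t) ^ (1 + 1)) +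
        2 * x ^ 2 * (besselWeight a ν t / (x + t) ^ (2 + 1)) -
        (2 * a + 1) * besselWeight a ν t) t := by
  have hxt : x + t ≠ 0 := by positivity
  have ht' := ht.ne'
  have h0 := hasDerivAt_coshK 0 ν ht
  have h1 := hasDerivAt_coshK 1 ν ht
  have hode := coshK_ode ν ht
  have hid := hasDerivAt_id' t
  have hs : HasDerivAt (fun t : ℝ => x + t) 1 t := hid.const_add x
  have ha : HasDerivAt (fun t : ℝ => t ^ a) (a * (t ^ a / t)) t := by
    have := Real.hasDerivAt_rpow_const (p := a) (Or.inl ht')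
    rwa [Real.rpow_sub_one ht'] at this
  have he : HasDerivAt (fun t : ℝ => Real.exp (-t)) (-Real.exp (-t)) t := by
    simpa using hid.neg.exp
  have hb : HasDerivAt (fun t : ℝ => (a + 1) / (x + t) - t / (x + t) ^ 2 - t / (x + t)) _ t :=
    ((((hasDerivAt_const t (a + 1)).div hs hxt).sub
      (hid.div (hs.fun_pow 2) (pow_ne_zero 2 hxt))).sub (hid.div hs hxt))
  have hall := ((ha.mul hid).mul he).mul ((h0.mul hb).add ((hid.mul h1).div hs hxt))
  refine hall.congr_deriv ?_
  have hK : coshK 2 ν t = coshK 1 ν t / t + (1 + ν ^ 2 / t ^ 2) * coshK 0 ν t := by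
    field_simp
    linear_combination hode
  simp only [besselWeight, zero_add, Pi.mul_apply, Pi.add_apply, Pi.div_apply, one_add_one_eq_two,
    hK]
  generalize t ^ a = A
  generalize Real.exp (-t) = E
  generalize coshK 0 ν t = k0
  generalize coshK 1 ν t = k1
  field_simp
  ring

/-- The concomitant vanishes at both ends of `(0, ∞)`, by this bound with `μ < a + 1`. -/
theorem exists_abs_concomitant_le {a ν μ : ℝ} (hμ : |ν| < μ) {x : ℝ} (hx : 0 < x) :
    ∃ C : ℝ, ∀ t : ℝ, 0 < t → |concomitant a ν x t| ≤ C * (t ^ (a + 1 - μ) * Real.exp (-t)) := by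
  obtain ⟨C0, hC0⟩ := exists_coshK_le 0 hμ
  obtain ⟨C1, hC1⟩ := exists_coshK_le 1 hμ
  refine ⟨C0 * (|a + 1| / x + 1 / x + 1) + C1 / x, fun t ht => ?_⟩
  have h0 := hC0 t ht
  have h1 := hC1 t ht
  have hk0 := coshK_pos 0 ν ht
  have hk1 := coshK_pos 1 ν ht
  have hp : t ^ (a + 1 - μ) = t ^ a * t * t ^ (-μ) := by
    rw [sub_eq_add_neg, Real.rpow_add ht, Real.rpow_add ht, Real.rpow_one]
  have hp0 : t ^ (-(μ + (0 : ℕ))) = t ^ (-μ) := by simp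
  have hp1 : t * t ^ (-(μ + (1 : ℕ))) = t ^ (-μ) := by
    rw [show -(μ + (1 : ℕ)) = -μ - 1 by push_cast; ring, Real.rpow_sub_one ht.ne']
    field_simp
  have hA : 0 < t ^ a * t * Real.exp (-t) := by positivity
  have hb : |(a + 1) / (x + t) - t / (x + t) ^ 2 - t / (x + t)| ≤ |a + 1| / x + 1 / x + 1 := by
    have e1 : |(a + 1) / (x + t)| ≤ |a + 1| / x := by
      rw [abs_div, abs_of_pos (show 0 < x + t by positivity)]
      gcongr
      linarith
    have e3 : t / (x + t) ≤ 1 := (div_le_one (by positivity)).2 (by linarith)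
    have e3' : 0 ≤ t / (x + t) := by positivity
    have e2 : t / (x + t) ^ 2 ≤ 1 / x := by
      rw [div_le_div_iff₀ (by positivity) hx]
      nlinarith
    have e2' : 0 ≤ t / (x + t) ^ 2 := by positivity
    have := abs_le.1 e1
    rw [abs_le]
    constructor <;> linarith [abs_nonneg (a + 1)]
  have hb1 : 0 ≤ |a + 1| / x + 1 / x + 1 := by positivity
  have hq : t * coshK 1 ν t / (x + t) ≤ C1 / x * t ^ (-μ) := by
    calc t * coshK 1 ν t / (x + t) ≤ t * (C1 * t ^ (-(μ + (1 : ℕ)))) / x := by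
          have : 0 ≤ C1 * t ^ (-(μ + (1 : ℕ))) := hk1.le.trans h1
          gcongr
          linarith
      _ = _ := by rw [← hp1]; ring
  rw [concomitant, abs_mul, abs_of_pos hA, hp]
  have key : |coshK 0 ν t * ((a + 1) / (x + t) - t / (x + t) ^ 2 - t / (x + t)) +
      t * coshK 1 ν t / (x + t)| ≤
      (C0 * (|a + 1| / x + 1 / x + 1) + C1 / x) * t ^ (-μ) := by
    refine (abs_add_le _ _).trans ?_
    rw [abs_mul, abs_of_pos hk0, abs_of_pos (show 0 < t * coshK 1 ν t / (x + t) by positivity)]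
    rw [hp0] at h0
    have : coshK 0 ν t * |(a + 1) / (x + t) - t / (x + t) ^ 2 - t / (x + t)| ≤
        C0 * t ^ (-μ) * (|a + 1| / x + 1 / x + 1) :=
      mul_le_mul h0 hb (abs_nonneg _) (hk0.le.trans h0)
    linarith
  calc _ ≤ t ^ a * t * Real.exp (-t) * ((C0 * (|a + 1| / x + 1 / x + 1) + C1 / x) * t ^ (-μ)) := by
        gcongr
    _ = _ := by ring

/-- The integrated form of the concomitant identity: a linear relation that makes the Stieltjes
transform solve an inhomogeneous Bessel equation. -/
theorem stieltjesK_relation {a ν : ℝ} (h : |ν| < a + 1) {x : ℝ} (hx : 0 < x) :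
    (a ^ 2 - ν ^ 2 + (2 * a - 1) * x) * stieltjesK a ν 0 x +
        ((2 * a - 1) * x + 2 * x ^ 2) * stieltjesK a ν 1 x + 2 * x ^ 2 * stieltjesK a ν 2 x =
      (2 * a + 1) * ∫ t in Ioi (0 : ℝ), besselWeight a ν t := by
  obtain ⟨μ, hμ1, hμ2⟩ := exists_between h
  have hs : 0 < a + 1 - μ := by linarith
  obtain ⟨C, hC⟩ := exists_abs_concomitant_le (a := a) hμ1 hx
  have hi : ∀ n, IntegrableOn (fun t => besselWeight a ν t / (x + t) ^ n) (Ioi 0) := fun n =>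
    integrableOn_besselWeight_div h n hx
  have hi0 := integrableOn_besselWeight h
  have htop : Tendsto (concomitant a ν x) atTop (𝓝 0) := by
    have h1 : Tendsto (fun t : ℝ => C * (t ^ (a + 1 - μ) * Real.exp (-t))) atTop (𝓝 0) := by
      have := (tendsto_rpow_mul_exp_neg_mul_atTop_nhds_zero (a + 1 - μ) 1 one_pos).const_mul C
      simpa using this
    refine squeeze_zero_norm' ?_ h1
    filter_upwards [eventually_gt_atTop 0] with t ht
    exact hC t ht
  have hbot : Tendsto (concomitant a ν x) (𝓝[>] 0) (𝓝 0) := by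
    have h1 : Tendsto (fun t : ℝ => C * (t ^ (a + 1 - μ) * Real.exp (-t))) (𝓝[>] 0) (𝓝 0) := by
      have hc : ContinuousAt (fun t : ℝ => C * (t ^ (a + 1 - μ) * Real.exp (-t))) 0 := by
        have := Real.continuousAt_rpow_const 0 (a + 1 - μ) (Or.inr hs.le)
        have h3 : ContinuousAt (fun t : ℝ => Real.exp (-t)) 0 := by fun_prop
        exact (this.mul h3).const_mul C
      have := hc.tendsto.mono_left (nhdsWithin_le_nhds (s := Ioi 0))
      simpa [Real.zero_rpow hs.ne'] using this
    refine squeeze_zero_norm' ?_ h1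
    filter_upwards [self_mem_nhdsWithin] with t ht
    exact hC t ht
  have hint : IntegrableOn (fun t =>
        (a ^ 2 - ν ^ 2 + (2 * a - 1) * x) * (besselWeight a ν t / (x + t) ^ (0 + 1)) +
        ((2 * a - 1) * x + 2 * x ^ 2) * (besselWeight a ν t / (x + t) ^ (1 + 1)) +
        2 * x ^ 2 * (besselWeight a ν t / (x + t) ^ (2 + 1)) -
        (2 * a + 1) * besselWeight a ν t) (Ioi 0) :=
    ((((hi (0 + 1)).const_mul (a ^ 2 - ν ^ 2 + (2 * a - 1) * x)).add
    ((hi (1 + 1)).const_mul ((2 * a - 1) * x + 2 * x ^ 2))).add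
    ((hi (2 + 1)).const_mul (2 * x ^ 2))).sub (hi0.const_mul (2 * a + 1))
  -- `concomitant a ν x 0` is a junk value; the limit at `0+` is what matters
  have hF := MeasureTheory.integral_Ioi_of_hasDerivAt_of_tendsto
    (f := Function.update (concomitant a ν x) 0 0) (a := 0) (m := 0) ?_ ?_ hint ?_
  rotate_left
  · rw [continuousWithinAt_update_same]
    refine hbot.mono_left (nhdsWithin_mono _ ?_)
    rintro y ⟨hy, hy0⟩
    exact lt_of_le_of_ne hy (Ne.symm hy0)
  · intro t ht
    have ht0 : (0 : ℝ) < t := ht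
    refine (hasDerivAt_concomitant a ν hx ht0).congr_of_eventuallyEq ?_
    filter_upwards [lt_mem_nhds ht0] with y hy
    exact Function.update_of_ne hy.ne' _ _
  · refine htop.congr' ?_
    filter_upwards [eventually_gt_atTop 0] with y hy
    exact (Function.update_of_ne hy.ne' _ _).symm
  rw [Function.update_self, sub_zero, integral_sub, integral_add, integral_add, integral_const_mul,
    integral_const_mul, integral_const_mul, integral_const_mul] at hF
  · unfold stieltjesK
    linarith
  · exact (hi _).const_mul _
  · exact (hi _).const_mul _
  · exact ((hi _).const_mul _).add ((hi _).const_mul _)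
  · exact (hi _).const_mul _
  · exact (((hi _).const_mul _).add ((hi _).const_mul _)).add ((hi _).const_mul _)
  · exact hi0.const_mul _

theorem tendsto_mul_stieltjesK {a ν : ℝ} (h : |ν| < a + 1) :
    Tendsto (fun x => x * stieltjesK a ν 0 x) atTop
      (𝓝 (∫ t in Ioi (0 : ℝ), besselWeight a ν t)) := by
  have e : ∀ x : ℝ, x * stieltjesK a ν 0 x =
      ∫ t in Ioi (0 : ℝ), x * (besselWeight a ν t / (x + t) ^ (0 + 1)) := by
    intro x
    rw [integral_const_mul, stieltjesK]
  simp only [e]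
  refine tendsto_integral_filter_of_dominated_convergence (besselWeight a ν) ?_ ?_
    (integrableOn_besselWeight h) ?_
  · filter_upwards [eventually_gt_atTop 0] with x hx
    exact ((integrableOn_besselWeight_div h _ hx).const_mul x).aestronglyMeasurable
  · filter_upwards [eventually_gt_atTop 0] with x hx
    refine (ae_restrict_iff' measurableSet_Ioi).2 (ae_of_all _ fun t ht => ?_)
    have ht0 : (0 : ℝ) < t := ht
    have := besselWeight_pos a ν ht0
    rw [Real.norm_of_nonneg (by positivity), zero_add, pow_one, mul_div_assoc',
      div_le_iff₀ (by positivity)]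
    nlinarith
  · refine (ae_restrict_iff' measurableSet_Ioi).2 (ae_of_all _ fun t ht => ?_)
    have h1 : Tendsto (fun x : ℝ => (1 + t * x⁻¹)⁻¹) atTop (𝓝 1) := by
      have := ((tendsto_inv_atTop_zero (𝕜 := ℝ)).const_mul t).const_add 1
      simpa using this.inv₀ (by simp)
    have h2 := h1.const_mul (besselWeight a ν t)
    rw [mul_one] at h2
    refine h2.congr' ?_
    filter_upwards [eventually_gt_atTop 0] with x hx
    have ht0 : (0 : ℝ) < t := ht
    field_simp
    ring

/-! ### The remainder for positive argument as a Stieltjes transform -/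

theorem tendsto_exp_neg_mul_coshK (j : ℕ) (ν : ℝ) :
    Tendsto (fun x : ℝ => x ^ (1 / 2 : ℝ) * Real.exp (-x) * coshK j ν x) atTop (𝓝 0) := by
  obtain ⟨C, hC⟩ := exists_coshK_le j (show |ν| < |ν| + 1 by linarith)
  have h1 : Tendsto (fun x : ℝ => C * (x ^ (1 / 2 : ℝ) * Real.exp (-x))) atTop (𝓝 0) := by
    have := (tendsto_rpow_mul_exp_neg_mul_atTop_nhds_zero (1 / 2) 1 one_pos).const_mul C
    simpa using this
  refine squeeze_zero' ?_ ?_ h1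
  · filter_upwards [eventually_gt_atTop 0] with x hx
    have := coshK_nonneg j ν x
    positivity
  · filter_upwards [eventually_ge_atTop 1] with x hx
    have hx0 : 0 < x := by linarith
    have h2 := hC x hx0
    have hC0 : 0 ≤ C := by
      have h3 := (coshK_nonneg j ν x).trans h2
      by_contra hneg
      have := Real.rpow_pos_of_pos hx0 (-(|ν| + 1 + j))
      nlinarith
    have h4 : x ^ (-(|ν| + 1 + j)) ≤ 1 :=
      Real.rpow_le_one_of_one_le_of_nonpos hx
        (by linarith [abs_nonneg ν, j.cast_nonneg (α := ℝ)])
    calc x ^ (1 / 2 : ℝ) * Real.exp (-x) * coshK j ν x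
        ≤ x ^ (1 / 2 : ℝ) * Real.exp (-x) * (C * 1) := by
          gcongr
          exact h2.trans (by gcongr)
      _ = _ := by ring

theorem normK_eq_rpow (ν : ℝ) {x : ℝ} (hx : 0 < x) :
    normK ν x = Real.sqrt (2 / Real.pi) * (x ^ (1 / 2 : ℝ) * Real.exp x * coshK 0 ν x) := by
  rw [normK, show 2 * x / Real.pi = x * (2 / Real.pi) by ring, Real.sqrt_mul hx.le,
    Real.sqrt_eq_rpow x]
  ring

theorem eq_of_hasDerivAt_zero_of_tendsto_atTop {f : ℝ → ℝ} {L : ℝ}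
    (hf : ∀ x : ℝ, 0 < x → HasDerivAt f 0 x) (hL : Tendsto f atTop (𝓝 L)) {x : ℝ}
    (hx : 0 < x) : f x = L := by
  have hconst : ∀ y ∈ Ioi (0 : ℝ), f y = f x := fun y hy =>
    isOpen_Ioi.is_const_of_fderiv_eq_zero (𝕜 := ℝ) isPreconnected_Ioi
      (fun y hy => (hf y hy).differentiableAt.differentiableWithinAt)
      (fun y hy => by simpa using (hf y hy).hasFDerivAt.fderiv) hy hx
  refine tendsto_nhds_unique (tendsto_const_nhds.congr' ?_) hL
  filter_upwards [eventually_gt_atTop 0] with y hy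
  exact (hconst y hy).symm

/-- The only solution of `x² (T'' - 2T') = (ν² - 1/4) T` which tends to `1` and has a bounded
derivative at infinity is `(2x/π)^{1/2} e^x K_ν(x)`. -/
theorem eq_normK_of_ode {ν B : ℝ} {T T1 T2 : ℝ → ℝ} (h1 : ∀ x, 0 < x → HasDerivAt T (T1 x) x)
    (h2 : ∀ x, 0 < x → HasDerivAt T1 (T2 x) x)
    (hode : ∀ x, 0 < x → x ^ 2 * (T2 x - 2 * T1 x) = (ν ^ 2 - 1 / 4) * T x)
    (hB : ∀ x, 1 ≤ x → |T1 x| ≤ B) (hT : Tendsto T atTop (𝓝 1)) {x : ℝ} (hx : 0 < x) :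
    T x = normK ν x := by
  have hr : ∀ (a x : ℝ), 0 < x → HasDerivAt (fun x : ℝ => x ^ a) (a * (x ^ a / x)) x := by
    intro a x hx
    have := Real.hasDerivAt_rpow_const (p := a) (Or.inl hx.ne')
    rwa [Real.rpow_sub_one hx.ne'] at this
  have he : ∀ x : ℝ, HasDerivAt (fun x : ℝ => Real.exp (-x)) (-Real.exp (-x)) x := by
    intro x
    simpa using (hasDerivAt_id' x).neg.exp
  -- the Wronskian of the two solutions, up to a constant
  let W : ℝ → ℝ := fun x => x ^ (1 / 2 : ℝ) * Real.exp (-x) *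
    (coshK 0 ν x * (T1 x - T x - T x * (1 / 2) / x) + coshK 1 ν x * T x)
  have hW : ∀ x, 0 < x → HasDerivAt W 0 x := by
    intro x hx
    have hk0 := hasDerivAt_coshK 0 ν hx
    have hk1 := hasDerivAt_coshK 1 ν hx
    have hko := coshK_ode ν hx
    have hall := ((hr (1 / 2) x hx).fun_mul (he x)).fun_mul
      ((hk0.fun_mul (((h2 x hx).fun_sub (h1 x hx)).fun_sub
        (((h1 x hx).mul_const (1 / 2)).fun_div (hasDerivAt_id' x) hx.ne'))).fun_add
        (hk1.fun_mul (h1 x hx)))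
    refine hall.congr_deriv ?_
    have hK : coshK 2 ν x = coshK 1 ν x / x + (1 + ν ^ 2 / x ^ 2) * coshK 0 ν x := by
      field_simp
      linear_combination hko
    have hT2 : T2 x = 2 * T1 x + (ν ^ 2 - 1 / 4) * T x / x ^ 2 := by
      field_simp
      linear_combination 4 * hode x hx
    simp only [zero_add, one_add_one_eq_two, hK, hT2]
    field_simp
    ring
  have hW0 : ∀ x, 0 < x → W x = 0 := by
    intro x hx
    refine eq_of_hasDerivAt_zero_of_tendsto_atTop hW ?_ hx
    have t0 := tendsto_exp_neg_mul_coshK 0 ν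
    have t1 := tendsto_exp_neg_mul_coshK 1 ν
    have ti : Tendsto (fun x : ℝ => (1 / 2) / x) atTop (𝓝 0) :=
      tendsto_const_nhds.div_atTop tendsto_id
    have tb : Tendsto (fun x : ℝ => x ^ (1 / 2 : ℝ) * Real.exp (-x) * coshK 0 ν x * T1 x) atTop
        (𝓝 0) := by
      refine t0.zero_mul_isBoundedUnder_le ?_
      refine isBoundedUnder_of_eventually_le (a := B) ?_
      filter_upwards [eventually_ge_atTop 1] with x hx
      exact hB x hx
    have := (tb.sub (t0.mul (hT.add (hT.mul ti)))).add (t1.mul hT)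
    simp only [zero_mul, sub_zero, add_zero] at this
    refine this.congr fun x => ?_
    simp only [W]
    ring
  have hq : ∀ x, 0 < x →
      HasDerivAt (fun x => T x / (x ^ (1 / 2 : ℝ) * Real.exp x * coshK 0 ν x)) 0 x := by
    intro x hx
    have hk := coshK_pos 0 ν hx
    have hxp : 0 < x ^ (1 / 2 : ℝ) := by positivity
    have hall := (h1 x hx).fun_div (((hr (1 / 2) x hx).fun_mul (Real.hasDerivAt_exp x)).fun_mul
      (hasDerivAt_coshK 0 ν hx)) (by positivity)
    refine hall.congr_deriv ?_
    have hw := hW0 x hx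
    simp only [W] at hw
    rw [mul_eq_zero] at hw
    have hw := hw.resolve_left (by positivity)
    rw [div_eq_zero_iff]
    left
    rw [zero_add]
    linear_combination (x ^ (1 / 2 : ℝ) * Real.exp x) * hw
  have hlim : Tendsto (fun x => T x / normK ν x) atTop (𝓝 1) := by
    have := hT.div (tendsto_normK ν) one_ne_zero
    rwa [div_one] at this
  have hs : 0 < Real.sqrt (2 / Real.pi) := Real.sqrt_pos.2 (by have := Real.pi_pos; positivity)
  have hq' : ∀ x, 0 < x → HasDerivAt (fun x => T x / normK ν x) 0 x := by
    intro x hx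
    have := (hq x hx).div_const (Real.sqrt (2 / Real.pi))
    rw [zero_div] at this
    refine this.congr_of_eventuallyEq ?_
    filter_upwards [lt_mem_nhds hx] with y hy
    rw [normK_eq_rpow ν hy, div_div, mul_comm (Real.sqrt (2 / Real.pi))]
  have hfin := eq_of_hasDerivAt_zero_of_tendsto_atTop hq' hlim hx
  have hn : 0 < normK ν x := by
    have := coshK_pos 0 ν hx
    rw [normK_eq_rpow ν hx]
    positivity
  rwa [div_eq_one_iff_eq hn.ne'] at hfin

theorem integral_besselWeight_pos {a ν : ℝ} (h : |ν| < a + 1) :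
    0 < ∫ t in Ioi (0 : ℝ), besselWeight a ν t := by
  rw [setIntegral_pos_iff_support_of_nonneg_ae]
  · have : Ioi (0 : ℝ) ⊆ Function.support (besselWeight a ν) := fun t ht =>
      (besselWeight_pos a ν ht).ne'
    rw [inter_eq_self_of_subset_right this]
    simp
  · exact (ae_restrict_iff' measurableSet_Ioi).2 (ae_of_all _ fun t ht =>
      (besselWeight_pos a ν ht).le)
  · exact integrableOn_besselWeight h

/-- The coefficient `a_n(ν)` for real `ν`. -/
noncomputable def coeffReal (n : ℕ) (ν : ℝ) : ℝ :=
  (∏ k ∈ Finset.range n, (4 * ν ^ 2 - (2 * k + 1) ^ 2)) / (8 ^ n * n.factorial)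

theorem coeffA_ofReal (n : ℕ) (ν : ℝ) : coeffA n ν = coeffReal n ν := by
  simp [coeffA, coeffReal]

theorem coeffReal_succ (n : ℕ) (ν : ℝ) :
    2 * (n + 1) * coeffReal (n + 1) ν = (ν ^ 2 - (n + 1 / 2) ^ 2) * coeffReal n ν := by
  have : (n.factorial : ℝ) ≠ 0 := by exact_mod_cast n.factorial_ne_zero
  rw [coeffReal, coeffReal, Finset.prod_range_succ, Nat.factorial_succ]
  push_cast
  field_simp
  ring

/-- The truncated expansion `∑_{n < N} a_n(ν) x^{-n}` for real `ν` and `x`. -/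
noncomputable def hankelSum (N : ℕ) (ν x : ℝ) : ℝ :=
  ∑ n ∈ Finset.range N, coeffReal n ν / x ^ n

theorem hasDerivAt_div_pow (a : ℝ) (n : ℕ) {x : ℝ} (hx : 0 < x) :
    HasDerivAt (fun x : ℝ => a / x ^ n) (-(n * a / x ^ (n + 1))) x := by
  have h1 := (hasDerivAt_const x a).fun_div ((hasDerivAt_id' x).fun_pow n) (by positivity)
  refine h1.congr_deriv ?_
  rcases n with _ | n
  · simp
  · rw [Nat.add_sub_cancel]
    push_cast
    field_simp
    ring

theorem hasDerivAt_hankelSum (N : ℕ) (ν : ℝ) {x : ℝ} (hx : 0 < x) :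
    HasDerivAt (hankelSum N ν) (∑ n ∈ Finset.range N, -(n * coeffReal n ν / x ^ (n + 1))) x :=
  HasDerivAt.fun_sum fun n _ => hasDerivAt_div_pow _ n hx

theorem hasDerivAt_deriv_hankelSum (N : ℕ) (ν : ℝ) {x : ℝ} (hx : 0 < x) :
    HasDerivAt (fun x => ∑ n ∈ Finset.range N, -(n * coeffReal n ν / x ^ (n + 1)))
      (∑ n ∈ Finset.range N, (n + 1) * (n * coeffReal n ν) / x ^ (n + 2)) x := by
  refine HasDerivAt.fun_sum fun n _ => ?_
  refine (hasDerivAt_div_pow (n * coeffReal n ν) (n + 1) hx).fun_neg.congr_deriv ?_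
  push_cast
  ring

/-- Only the last term of the truncated expansion contributes: the other ones telescope, by the
recurrence of the coefficients. -/
theorem hankelSum_ode (N : ℕ) (ν : ℝ) {x : ℝ} (hx : 0 < x) :
    x ^ 2 * ((∑ n ∈ Finset.range N, (n + 1) * (n * coeffReal n ν) / x ^ (n + 2)) -
      2 * ∑ n ∈ Finset.range N, -(n * coeffReal n ν / x ^ (n + 1))) -
      (ν ^ 2 - 1 / 4) * hankelSum N ν x = -(2 * N * coeffReal N ν * x / x ^ N) := by
  unfold hankelSum
  induction N with
  | zero => simp
  | succ n ih =>
    rw [Finset.sum_range_succ, Finset.sum_range_succ, Finset.sum_range_succ]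
    have h := coeffReal_succ n ν
    have e : -(2 * ((n + 1 : ℕ) : ℝ) * coeffReal (n + 1) ν * x / x ^ (n + 1)) =
        -((ν ^ 2 - (n + 1 / 2) ^ 2) * coeffReal n ν) / x ^ n := by
      rw [← h]
      push_cast
      rw [pow_succ]
      field_simp
    have e2 : x ^ 2 * ((n + 1) * (n * coeffReal n ν) / x ^ (n + 2) -
        2 * -(n * coeffReal n ν / x ^ (n + 1))) - (ν ^ 2 - 1 / 4) * (coeffReal n ν / x ^ n) =
        2 * n * coeffReal n ν * x / x ^ n - (ν ^ 2 - (n + 1 / 2) ^ 2) * coeffReal n ν / x ^ n := by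
      field_simp
      ring
    rw [e]
    linear_combination ih + e2

theorem tendsto_hankelSum_succ (N : ℕ) (ν : ℝ) :
    Tendsto (hankelSum (N + 1) ν) atTop (𝓝 1) := by
  have h : Tendsto (hankelSum (N + 1) ν) atTop
      (𝓝 (∑ n ∈ Finset.range (N + 1), if n = 0 then coeffReal 0 ν else 0)) := by
    refine tendsto_finsetSum _ fun n _ => ?_
    split_ifs with hn
    · subst hn
      simp
    · exact tendsto_const_nhds.div_atTop (tendsto_pow_atTop hn)
  simpa [coeffReal] using h

/-- For `x > 0`, the remainder of the expansion of `(2x/π)^{1/2} e^x K_ν(x)` is a multiple of the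
Stieltjes transform of `t^{N-1/2} e^{-t} K_ν(t)`. -/
theorem normK_sub_hankelSum {N : ℕ} {ν : ℝ} (hν : |ν| < N + 1 / 2) {x : ℝ} (hx : 0 < x) :
    normK ν x - hankelSum N ν x =
      coeffReal N ν / (∫ t in Ioi (0 : ℝ), besselWeight (N - 1 / 2) ν t) *
        (x / x ^ N * stieltjesK (N - 1 / 2) ν 0 x) := by
  set a : ℝ := N - 1 / 2 with ha
  have h : |ν| < a + 1 := by rw [ha]; linarith
  set M : ℝ := ∫ t in Ioi (0 : ℝ), besselWeight a ν t with hM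
  have hM0 : 0 < M := integral_besselWeight_pos h
  set c : ℝ := coeffReal N ν / M with hc
  let S : ℕ → ℝ → ℝ := stieltjesK a ν
  have hq : ∀ x : ℝ, 0 < x → HasDerivAt (fun x : ℝ => x / x ^ N) ((1 - N) / x ^ N) x := by
    intro x hx
    have h1 := (hasDerivAt_id' x).fun_mul (hasDerivAt_div_pow 1 N hx)
    have h2 : (fun x : ℝ => x / x ^ N) = fun x => x * (1 / x ^ N) := by
      funext x; ring
    rw [h2]
    refine h1.congr_deriv ?_
    field_simp
    ring
  -- the candidate `T` and its derivatives
  let P1 : ℝ → ℝ := fun x => ∑ n ∈ Finset.range N, -(n * coeffReal n ν / x ^ (n + 1))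
  let P2 : ℝ → ℝ := fun x => ∑ n ∈ Finset.range N, (n + 1) * (n * coeffReal n ν) / x ^ (n + 2)
  let T : ℝ → ℝ := fun x => hankelSum N ν x + c * (x / x ^ N * S 0 x)
  let T1 : ℝ → ℝ := fun x => P1 x + c * ((1 - N) / x ^ N * S 0 x - x / x ^ N * S 1 x)
  let T2 : ℝ → ℝ := fun x => P2 x + c * (-(N * (1 - N) / x ^ (N + 1)) * S 0 x -
    2 * ((1 - N) / x ^ N * S 1 x) + x / x ^ N * (2 * S 2 x))
  have hS0 : ∀ x, 0 < x → HasDerivAt (S 0) (-S 1 x) x := by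
    intro x hx
    simpa using hasDerivAt_stieltjesK h 0 hx
  have hS1 : ∀ x, 0 < x → HasDerivAt (S 1) (-(2 * S 2 x)) x := by
    intro x hx
    have := hasDerivAt_stieltjesK h 1 hx
    norm_num at this
    exact this
  have h1 : ∀ x, 0 < x → HasDerivAt T (T1 x) x := by
    intro x hx
    refine ((hasDerivAt_hankelSum N ν hx).fun_add
      (((hq x hx).fun_mul (hS0 x hx)).const_mul c)).congr_deriv ?_
    simp only [T1, P1]
    ring
  have h2 : ∀ x, 0 < x → HasDerivAt T1 (T2 x) x := by
    intro x hx
    refine ((hasDerivAt_deriv_hankelSum N ν hx).fun_add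
      ((((hasDerivAt_div_pow (1 - N) N hx).fun_mul (hS0 x hx)).fun_sub
        ((hq x hx).fun_mul (hS1 x hx))).const_mul c)).congr_deriv ?_
    simp only [T2, P2]
    ring
  have hode : ∀ x, 0 < x → x ^ 2 * (T2 x - 2 * T1 x) = (ν ^ 2 - 1 / 4) * T x := by
    intro x hx
    have e1 := hankelSum_ode N ν hx
    have e2 := stieltjesK_relation h hx
    have e3 : c * M = coeffReal N ν := div_mul_cancel₀ _ hM0.ne'
    rw [← hM] at e2
    rw [← e3] at e1
    simp only [T, T1, T2, P1, P2]
    have hxN : x ^ N ≠ 0 := by positivity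
    simp only [ha] at e2
    have e4 : x ^ 2 * ((-(N * (1 - N) / x ^ (N + 1)) * S 0 x -
        2 * ((1 - N) / x ^ N * S 1 x) + x / x ^ N * (2 * S 2 x)) -
        2 * ((1 - N) / x ^ N * S 0 x - x / x ^ N * S 1 x)) -
        (ν ^ 2 - 1 / 4) * (x / x ^ N * S 0 x) = x / x ^ N * (2 * N * M) := by
      have e5 : (2 * (N - 1 / 2) + 1) * M = 2 * N * M := by ring
      rw [← e5, ← e2, pow_succ]
      simp only [S, ha]
      generalize stieltjesK (N - 1 / 2) ν 0 x = s0
      generalize stieltjesK (N - 1 / 2) ν 1 x = s1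
      generalize stieltjesK (N - 1 / 2) ν 2 x = s2
      field_simp
      ring
    linear_combination e1 + c * e4
  have hlim : Tendsto T atTop (𝓝 1) := by
    have hl := tendsto_mul_stieltjesK h
    rw [← hM] at hl
    have hT : ∀ x, T x = hankelSum N ν x + c * ((x ^ N)⁻¹ * (x * S 0 x)) := by
      intro x
      simp only [T]
      ring
    rw [tendsto_congr hT]
    rcases Nat.eq_zero_or_pos N with h0 | h0
    · subst h0
      have hc1 : c * M = 1 := by
        rw [hc, div_mul_cancel₀ _ hM0.ne']
        simp [coeffReal]
      have := hl.const_mul c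
      rw [hc1] at this
      simpa [hankelSum] using this
    · obtain ⟨n, rfl⟩ := Nat.exists_eq_succ_of_ne_zero h0.ne'
      have hp : Tendsto (fun x : ℝ => (x ^ (n + 1))⁻¹) atTop (𝓝 0) :=
        tendsto_inv_atTop_zero.comp (tendsto_pow_atTop n.succ_ne_zero)
      have := (tendsto_hankelSum_succ n ν).add ((hp.mul hl).const_mul c)
      simpa using this
  have hB : ∀ x, 1 ≤ x → |T1 x| ≤
      (∑ n ∈ Finset.range N, |n * coeffReal n ν|) + |c| * (|1 - (N : ℝ)| * M + M) := by
    intro x hx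
    have hx0 : 0 < x := by linarith
    have hS : ∀ j, 0 ≤ S j x ∧ x * S j x ≤ M := by
      intro j
      have s0 := stieltjesK_nonneg a ν j hx0
      refine ⟨s0, ?_⟩
      have s1 := stieltjesK_le h j hx0
      rw [le_div_iff₀ (by positivity), ← hM] at s1
      have : x ≤ x ^ (j + 1) := le_self_pow₀ hx (by omega)
      calc x * S j x ≤ x ^ (j + 1) * S j x := by gcongr
        _ = S j x * x ^ (j + 1) := mul_comm _ _
        _ ≤ M := s1
    have hpw : ∀ n : ℕ, (x ^ n)⁻¹ ≤ 1 := fun n => inv_le_one_of_one_le₀ (one_le_pow₀ hx)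
    have b0 : |P1 x| ≤ ∑ n ∈ Finset.range N, |n * coeffReal n ν| := by
      refine (Finset.abs_sum_le_sum_abs _ _).trans (Finset.sum_le_sum fun n _ => ?_)
      rw [abs_neg, abs_div, abs_of_pos (show 0 < x ^ (n + 1) by positivity)]
      exact div_le_self (abs_nonneg _) (one_le_pow₀ hx)
    have b1 : |(1 - N) / x ^ N * S 0 x| ≤ |1 - (N : ℝ)| * M := by
      rw [abs_mul, abs_div, abs_of_pos (show 0 < x ^ N by positivity), abs_of_nonneg (hS 0).1]
      have : S 0 x ≤ M := le_trans (by nlinarith [(hS 0).1]) (hS 0).2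
      have := (hS 0).1
      have : |1 - (N : ℝ)| / x ^ N ≤ |1 - (N : ℝ)| := div_le_self (abs_nonneg _) (one_le_pow₀ hx)
      gcongr
    have b2 : |x / x ^ N * S 1 x| ≤ M := by
      have := (hS 1).1
      rw [abs_of_nonneg (by positivity)]
      calc x / x ^ N * S 1 x = (x ^ N)⁻¹ * (x * S 1 x) := by ring
        _ ≤ 1 * M := by
          have := (hS 1).2
          have := hpw N
          gcongr
        _ = M := one_mul _
    calc |T1 x| ≤ |P1 x| + |c * ((1 - N) / x ^ N * S 0 x - x / x ^ N * S 1 x)| := abs_add_le _ _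
      _ ≤ |P1 x| + |c| * (|(1 - N) / x ^ N * S 0 x| + |x / x ^ N * S 1 x|) := by
          rw [abs_mul]
          gcongr
          exact abs_sub _ _
      _ ≤ _ := by gcongr
  have hfin := eq_normK_of_ode h1 h2 hode hB hlim hx
  rw [← hfin]
  simp only [T, S]
  ring

/-! ### The remainder for positive argument as a mixture of terminants -/

/-- `∫_0^∞ t^{p-1} e^{-bt} / (1 + t/x) dt = b^{-p} Γ(p) Λ_p(bx)`. -/
theorem lintegral_stieltjes_rpow_mul_exp {p : ℝ} (hp : 0 < p) {b : ℝ} (hb : 0 < b) {x : ℝ}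
    (hx : 0 < x) :
    ∫⁻ t in Ioi (0 : ℝ), ENNReal.ofReal (t ^ (p - 1) * Real.exp (-(b * t)) * (x / (x + t))) =
      ENNReal.ofReal (b ^ (-p) * Real.Gamma p * terminantReal p (b * x)) := by
  have h1 : ∀ t ∈ Ioi (0 : ℝ),
      ENNReal.ofReal (t ^ (p - 1) * Real.exp (-(b * t)) * (x / (x + t))) =
      ∫⁻ v in Ioi (0 : ℝ), ENNReal.ofReal (t ^ (p - 1) * Real.exp (-(b * t)) * (b * x)) *
        ENNReal.ofReal (Real.exp (-((b * (x + t)) * v))) := by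
    intro t ht
    have ht0 : (0 : ℝ) < t := ht
    have hxt : 0 < x + t := by linarith
    rw [lintegral_const_mul _ (by fun_prop), lintegral_exp_neg_mul (by positivity),
      ← ENNReal.ofReal_mul (by positivity)]
    congr 1
    field_simp
  rw [setLIntegral_congr_fun measurableSet_Ioi h1, lintegral_lintegral_swap]
  swap
  · refine Measurable.aemeasurable ?_
    fun_prop
  have h2 : ∀ v ∈ Ioi (0 : ℝ), ∫⁻ t in Ioi (0 : ℝ),
      ENNReal.ofReal (t ^ (p - 1) * Real.exp (-(b * t)) * (b * x)) *
        ENNReal.ofReal (Real.exp (-((b * (x + t)) * v))) =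
      ENNReal.ofReal (b ^ (-p) * Real.Gamma p * (b * x) *
        (Real.exp (-(b * x) * v) * (1 + v) ^ (-p))) := by
    intro v hv
    have hv0 : (0 : ℝ) < v := hv
    have h3 : ∀ t ∈ Ioi (0 : ℝ), ENNReal.ofReal (t ^ (p - 1) * Real.exp (-(b * t)) * (b * x)) *
        ENNReal.ofReal (Real.exp (-((b * (x + t)) * v))) =
          ENNReal.ofReal (b * x * Real.exp (-(b * x) * v)) *
          ENNReal.ofReal (t ^ (p - 1) * Real.exp (-((b * (1 + v)) * t))) := by
      intro t ht
      have ht0 : (0 : ℝ) < t := ht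
      rw [← ENNReal.ofReal_mul (by positivity), ← ENNReal.ofReal_mul (by positivity)]
      congr 1
      have : Real.exp (-(b * t)) * Real.exp (-((b * (x + t)) * v)) =
          Real.exp (-(b * x) * v) * Real.exp (-((b * (1 + v)) * t)) := by
        rw [← Real.exp_add, ← Real.exp_add]; ring_nf
      linear_combination (t ^ (p - 1) * (b * x)) * this
    rw [setLIntegral_congr_fun measurableSet_Ioi h3, lintegral_const_mul _ (by fun_prop),
      lintegral_rpow_mul_exp_neg_mul hp (by positivity), ← ENNReal.ofReal_mul (by positivity),
      Real.mul_rpow hb.le (by linarith)]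
    congr 1
    ring
  have hbx : 0 < b * x := by positivity
  rw [setLIntegral_congr_fun measurableSet_Ioi h2, terminantReal,
    ← mul_assoc (b ^ (-p) * _) (b * x), ← integral_const_mul, ofReal_integral_eq_lintegral_ofReal]
  · refine Integrable.const_mul ?_ _
    refine Integrable.mono' (exp_neg_integrableOn_Ioi 0 hbx) ?_ ?_
    · exact (Measurable.aestronglyMeasurable (by fun_prop))
    · refine (ae_restrict_iff' measurableSet_Ioi).2 (ae_of_all _ fun v hv => ?_)
      have hv0 : (0 : ℝ) < v := hv
      rw [Real.norm_of_nonneg (by positivity)]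
      exact mul_le_of_le_one_right (Real.exp_pos _).le
        (Real.rpow_le_one_of_one_le_of_nonpos (by linarith) (by linarith))
  · refine (ae_restrict_iff' measurableSet_Ioi).2 (ae_of_all _ fun v hv => ?_)
    have hv0 : (0 : ℝ) < v := hv
    have := Real.Gamma_pos_of_pos hp
    positivity

/-- The two Laplace representations of the normalized function, in a common form. -/
theorem exists_measure_normK (ν : ℝ) :
    ∃ μ : Measure ℝ, SFinite μ ∧ μ (Iio 1) = 0 ∧ ∀ t : ℝ, 0 < t →
      ENNReal.ofReal (t ^ (-max 0 (1 / 2 - |ν|)) * (Real.exp (-(2 * t)) * normK ν t)) =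
        ∫⁻ r, ENNReal.ofReal (Real.exp (-(2 * t * r))) ∂μ := by
  rcases le_or_gt (1 / 2) |ν| with h | h
  · rw [max_eq_left (by linarith)]
    simpa using exists_measure_normK_of_half_le h
  · rw [max_eq_right (by linarith), neg_sub]
    exact exists_measure_normK_of_lt_half h

theorem measurable_terminantL_comp (p : ℂ) (ζ : ℂ) :
    Measurable fun r : ℝ => terminantL p (ζ + Real.log (2 * r)) :=
  (differentiable_terminantL p).continuous.measurable.comp (by fun_prop)

/-- For `|ν| < N + 1/2`, the remainder on the positive half-line is `a_N(ν) x^{-N}` times an average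
of the values `Λ_p(2xr)`, `r ≥ 1`. -/
theorem exists_measure_remainder {N : ℕ} {ν : ℝ} (hν : |ν| < N + 1 / 2) :
    ∃ ρ : Measure ℝ, IsProbabilityMeasure ρ ∧ ρ (Iio 1) = 0 ∧ ∀ x : ℝ, 0 < x →
      ((normK ν x - hankelSum N ν x : ℝ) : ℂ) = coeffA N ν / x ^ N *
        ∫ r, terminantL ((N + max 0 (1 / 2 - |ν|) : ℝ) : ℂ) (Real.log x + Real.log (2 * r)) ∂ρ := by
  obtain ⟨μ, hsf, hμ1, hμ⟩ := exists_measure_normK ν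
  set q : ℝ := max 0 (1 / 2 - |ν|) with hq
  set p : ℝ := N + q with hpdef
  have hp : 0 < p := by
    rcases Nat.eq_zero_or_pos N with h0 | h0
    · subst h0
      have : 0 < 1 / 2 - |ν| := by simp at hν; linarith
      have := le_max_right 0 (1 / 2 - |ν|)
      simp only [hpdef, Nat.cast_zero, zero_add, hq]
      linarith
    · have : (0 : ℝ) < N := by exact_mod_cast h0
      have := le_max_left 0 (1 / 2 - |ν|)
      linarith
  have h : |ν| < (N - 1 / 2 : ℝ) + 1 := by linarith
  set a : ℝ := N - 1 / 2 with ha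
  have hμae : ∀ᵐ r ∂μ, 1 ≤ r := by
    rw [ae_iff]
    convert hμ1 using 2
    ext r
    simp
  set s : ℝ := Real.sqrt (2 / Real.pi) with hs
  have hs0 : 0 < s := Real.sqrt_pos.2 (by have := Real.pi_pos; positivity)
  have hG := Real.Gamma_pos_of_pos hp
  have hw : ∀ t : ℝ, 0 < t → ENNReal.ofReal (besselWeight a ν t) = ENNReal.ofReal s⁻¹ *
      ∫⁻ r, ENNReal.ofReal (t ^ (p - 1) * Real.exp (-(2 * r * t))) ∂μ := by
    intro t ht
    have e1 : ∀ r : ℝ, ENNReal.ofReal (t ^ (p - 1) * Real.exp (-(2 * r * t))) =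
        ENNReal.ofReal (t ^ (p - 1)) * ENNReal.ofReal (Real.exp (-(2 * t * r))) := by
      intro r
      rw [← ENNReal.ofReal_mul (by positivity)]
      ring_nf
    simp only [e1]
    rw [lintegral_const_mul _ (by fun_prop), ← hμ t ht, ← ENNReal.ofReal_mul (by positivity),
      ← ENNReal.ofReal_mul (by positivity)]
    congr 1
    rw [normK_eq_rpow ν ht, besselWeight]
    have e2 : t ^ a = t ^ (p - 1) * (t ^ (-q) * t ^ (1 / 2 : ℝ)) := by
      rw [← Real.rpow_add ht, ← Real.rpow_add ht]
      congr 1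
      rw [ha, hpdef]; ring
    have e3 : Real.exp (-t) = Real.exp (-(2 * t)) * Real.exp t := by
      rw [← Real.exp_add]; ring_nf
    rw [e2, e3, ← hs]
    field_simp
  -- the weight against a further factor `g`, with the order of integration exchanged
  have hswap : ∀ g : ℝ → ℝ, Measurable g → (∀ t, 0 < t → 0 ≤ g t) →
      ∫⁻ t in Ioi (0 : ℝ), ENNReal.ofReal (besselWeight a ν t * g t) = ENNReal.ofReal s⁻¹ *
        ∫⁻ r, (∫⁻ t in Ioi (0 : ℝ),
          ENNReal.ofReal (t ^ (p - 1) * Real.exp (-(2 * r * t)) * g t)) ∂μ := by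
    intro g hg hg0
    rw [lintegral_lintegral_swap (Measurable.aemeasurable (by fun_prop)),
      ← lintegral_const_mul' _ _ ENNReal.ofReal_ne_top]
    refine setLIntegral_congr_fun measurableSet_Ioi fun t ht => ?_
    have ht0 : (0 : ℝ) < t := ht
    have e1 : ∀ r : ℝ, ENNReal.ofReal (t ^ (p - 1) * Real.exp (-(2 * r * t)) * g t) =
        ENNReal.ofReal (t ^ (p - 1) * Real.exp (-(2 * r * t))) * ENNReal.ofReal (g t) := fun r =>
      ENNReal.ofReal_mul (by positivity)
    simp only [e1]
    rw [lintegral_mul_const _ (by fun_prop), ← mul_assoc, ← hw t ht0,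
      ← ENNReal.ofReal_mul (besselWeight_pos a ν ht0).le]
  set M : ℝ := ∫ t in Ioi (0 : ℝ), besselWeight a ν t with hM
  have hi := integrableOn_besselWeight h
  have hM0 : 0 < M := integral_besselWeight_pos h
  -- the density that makes the mixing measure a probability measure
  let d : ℝ → ENNReal := fun r => ENNReal.ofReal (s⁻¹ / M * ((2 * r) ^ (-p) * Real.Gamma p))
  have hd : Measurable d := by fun_prop
  have hcst : ENNReal.ofReal (s⁻¹ / M) = ENNReal.ofReal M⁻¹ * ENNReal.ofReal s⁻¹ := by
    rw [← ENNReal.ofReal_mul (by positivity)]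
    ring_nf
  have hMinv : ENNReal.ofReal M⁻¹ * ENNReal.ofReal M = 1 := by
    rw [← ENNReal.ofReal_mul (by positivity), inv_mul_cancel₀ hM0.ne', ENNReal.ofReal_one]
  let ρ : Measure ℝ := μ.withDensity d
  have hρμ : ρ ≪ μ := withDensity_absolutelyContinuous _ _
  have hρae : ∀ᵐ r ∂ρ, 1 ≤ r := hρμ.ae_le hμae
  have hprob : ρ univ = 1 := by
    have h1 := hswap (fun _ => 1) measurable_const fun _ _ => zero_le_one
    simp only [mul_one] at h1
    have h2 : ∫⁻ t in Ioi (0 : ℝ), ENNReal.ofReal (besselWeight a ν t) = ENNReal.ofReal M :=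
      (ofReal_integral_eq_lintegral_ofReal hi ((ae_restrict_iff' measurableSet_Ioi).2
        (ae_of_all _ fun t ht => (besselWeight_pos a ν ht).le))).symm
    rw [withDensity_apply _ MeasurableSet.univ, Measure.restrict_univ, ← hMinv, ← h2, h1,
      ← mul_assoc, ← hcst, ← lintegral_const_mul' _ _ ENNReal.ofReal_ne_top]
    refine lintegral_congr_ae ?_
    filter_upwards [hμae] with r hr
    have hr0 : 0 < 2 * r := by linarith
    rw [lintegral_rpow_mul_exp_neg_mul hp hr0, ← ENNReal.ofReal_mul (by positivity)]
  have hP : IsProbabilityMeasure ρ := ⟨hprob⟩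
  refine ⟨ρ, hP, hρμ hμ1, fun x hx => ?_⟩
  have hT : ∫⁻ t in Ioi (0 : ℝ), ENNReal.ofReal (besselWeight a ν t * (x / (x + |t|))) =
      ENNReal.ofReal M * ∫⁻ r, ENNReal.ofReal (terminantReal p (2 * r * x)) ∂ρ := by
    rw [hswap (fun t => x / (x + |t|)) (by fun_prop) (fun t ht => by positivity)]
    have h3 : ENNReal.ofReal s⁻¹ = ENNReal.ofReal M * ENNReal.ofReal (s⁻¹ / M) := by
      rw [← ENNReal.ofReal_mul hM0.le]
      congr 1
      field_simp
    rw [h3, mul_assoc, ← lintegral_const_mul' _ _ ENNReal.ofReal_ne_top,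
      lintegral_withDensity_eq_lintegral_mul₀' hd.aemeasurable]
    · congr 1
      refine lintegral_congr_ae ?_
      filter_upwards [hμae] with r hr
      have hr0 : 0 < 2 * r := by linarith
      have e : ∀ t ∈ Ioi (0 : ℝ), ENNReal.ofReal (t ^ (p - 1) * Real.exp (-(2 * r * t)) *
          (x / (x + |t|))) = ENNReal.ofReal (t ^ (p - 1) * Real.exp (-(2 * r * t)) *
          (x / (x + t))) := by
        intro t ht
        rw [abs_of_pos ht]
      rw [setLIntegral_congr_fun measurableSet_Ioi e, lintegral_stieltjes_rpow_mul_exp hp hr0 hx,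
        ← ENNReal.ofReal_mul (by positivity)]
      simp only [Pi.mul_apply, d]
      rw [← ENNReal.ofReal_mul (by positivity)]
      congr 1
      ring
    · have hm : AEMeasurable (fun r : ℝ => ENNReal.ofReal
          (terminantL p (Real.log x + Real.log (2 * r))).re) ρ :=
        ((Complex.measurable_re.comp
          (measurable_terminantL_comp p (Real.log x))).ennreal_ofReal).aemeasurable
      refine hm.congr ?_
      filter_upwards [hρae] with r hr
      have hr0 : 0 < 2 * r := by linarith
      rw [← Complex.ofReal_add, ← Real.log_mul hx.ne' hr0.ne', terminantL_log hp.le (by positivity),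
        Complex.ofReal_re, mul_comm x]
  have hre : ∫ r, terminantL (p : ℂ) (Real.log x + Real.log (2 * r)) ∂ρ =
      ((∫ r, terminantReal p (2 * r * x) ∂ρ : ℝ) : ℂ) := by
    rw [← integral_complex_ofReal]
    refine integral_congr_ae ?_
    filter_upwards [hρae] with r hr
    have hr0 : 0 < 2 * r := by linarith
    rw [← Complex.ofReal_add, ← Real.log_mul hx.ne' hr0.ne', terminantL_log hp.le (by positivity),
      mul_comm x]
  have hmeas : AEStronglyMeasurable (fun r : ℝ => terminantReal p (2 * r * x)) ρ := by
    have hm : AEStronglyMeasurable (fun r : ℝ =>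
        (terminantL p (Real.log x + Real.log (2 * r))).re) ρ :=
      (Complex.measurable_re.comp
        (measurable_terminantL_comp p (Real.log x))).aestronglyMeasurable
    refine hm.congr ?_
    filter_upwards [hρae] with r hr
    have hr0 : 0 < 2 * r := by linarith
    rw [← Complex.ofReal_add, ← Real.log_mul hx.ne' hr0.ne', terminantL_log hp.le (by positivity),
      Complex.ofReal_re, mul_comm x]
  have hint : ∫ r, terminantReal p (2 * r * x) ∂ρ = M⁻¹ * (x * stieltjesK a ν 0 x) := by
    rw [integral_eq_lintegral_of_nonneg_ae _ hmeas]
    · have h4 : ∫⁻ r, ENNReal.ofReal (terminantReal p (2 * r * x)) ∂ρ =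
          ENNReal.ofReal (M⁻¹ * (x * stieltjesK a ν 0 x)) := by
        rw [← one_mul (∫⁻ r, _ ∂ρ), ← hMinv, mul_assoc, ← hT, ENNReal.ofReal_mul (by positivity),
          stieltjesK, ← integral_const_mul, ofReal_integral_eq_lintegral_ofReal]
        · congr 1
          refine setLIntegral_congr_fun measurableSet_Ioi fun t ht => ?_
          have ht0 : (0 : ℝ) < t := ht
          rw [abs_of_pos ht0]
          congr 1
          rw [zero_add, pow_one]
          ring
        · exact (integrableOn_besselWeight_div h _ hx).const_mul x
        · refine (ae_restrict_iff' measurableSet_Ioi).2 (ae_of_all _ fun t ht => ?_)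
          have ht0 : (0 : ℝ) < t := ht
          have := besselWeight_pos a ν ht0
          positivity
      rw [h4, ENNReal.toReal_ofReal]
      have := stieltjesK_nonneg a ν 0 hx
      positivity
    · filter_upwards [hρae] with r hr
      exact terminantReal_nonneg p (by positivity)
  rw [hre, hint, coeffA_ofReal, normK_sub_hankelSum hν hx]
  push_cast
  rw [← hM, ← ha]
  ring

/-! ### `K_ν(z)` is an entire function of `log z` -/

/-- A series like that of `I_ν(z)`, with bounded coefficients in place of `1 / Γ(ν + k + 1)`, is an
entire function of `log z`. -/
theorem differentiable_tsum_exp {a : ℕ → ℂ} {C : ℝ} (ha : ∀ k, ‖a k‖ ≤ C) (ν : ℂ) :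
    (∀ ζ : ℂ, Summable fun k : ℕ => (k.factorial : ℂ)⁻¹ * a k *
      Complex.exp ((ν + 2 * k) * (ζ - Real.log 2))) ∧
    Differentiable ℂ fun ζ : ℂ => ∑' k : ℕ, (k.factorial : ℂ)⁻¹ * a k *
      Complex.exp ((ν + 2 * k) * (ζ - Real.log 2)) := by
  have key : ∀ R : ℝ, ∃ u : ℕ → ℝ, Summable u ∧ ∀ (k : ℕ) (ζ : ℂ), ‖ζ - Real.log 2‖ ≤ R →
      ‖(k.factorial : ℂ)⁻¹ * a k * Complex.exp ((ν + 2 * k) * (ζ - Real.log 2))‖ ≤ u k := by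
    intro R
    refine ⟨fun k => C * Real.exp (‖ν‖ * R) * (Real.exp (2 * R) ^ k / k.factorial),
      (Real.summable_pow_div_factorial _).mul_left _, fun k ζ hζ => ?_⟩
    have h1 : ‖Complex.exp ((ν + 2 * k) * (ζ - Real.log 2))‖ ≤
        Real.exp (‖ν‖ * R) * Real.exp (2 * R) ^ k := by
      rw [← Real.exp_nat_mul, ← Real.exp_add]
      refine (Complex.norm_exp_le_exp_norm _).trans (Real.exp_le_exp.2 ?_)
      rw [norm_mul]
      have h2 : ‖ν + 2 * k‖ ≤ ‖ν‖ + 2 * k := by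
        refine (norm_add_le _ _).trans ?_
        simp
      calc ‖ν + 2 * k‖ * ‖ζ - Real.log 2‖ ≤ (‖ν‖ + 2 * k) * R := by gcongr
        _ = _ := by ring
    have h3 : ‖(k.factorial : ℂ)⁻¹‖ = (k.factorial : ℝ)⁻¹ := by simp
    have hC : 0 ≤ C := (norm_nonneg _).trans (ha k)
    rw [norm_mul, norm_mul, h3]
    calc (k.factorial : ℝ)⁻¹ * ‖a k‖ * ‖Complex.exp ((ν + 2 * k) * (ζ - Real.log 2))‖
        ≤ (k.factorial : ℝ)⁻¹ * C * (Real.exp (‖ν‖ * R) * Real.exp (2 * R) ^ k) := by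
          gcongr
          exact ha k
      _ = _ := by ring
  constructor
  · intro ζ
    obtain ⟨u, hu, h⟩ := key ‖ζ - Real.log 2‖
    exact Summable.of_norm_bounded hu fun k => h k ζ le_rfl
  · intro ζ
    obtain ⟨u, hu, h⟩ := key (‖ζ - Real.log 2‖ + 1)
    have hd := Complex.differentiableOn_tsum_of_summable_norm hu (U := Metric.ball ζ 1)
      (F := fun (k : ℕ) (ζ : ℂ) => (k.factorial : ℂ)⁻¹ * a k *
        Complex.exp ((ν + 2 * k) * (ζ - Real.log 2)))
      (fun k => Differentiable.differentiableOn (by fun_prop)) Metric.isOpen_ball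
      (fun k w hw => h k w (by
        have h1 := (Metric.mem_ball.1 hw).le
        rw [dist_eq_norm] at h1
        have h2 := norm_add_le (w - ζ) (ζ - Real.log 2)
        rw [sub_add_sub_cancel] at h2
        linarith))
    exact hd.differentiableAt (Metric.isOpen_ball.mem_nhds (Metric.mem_ball_self one_pos))

theorem differentiable_one_div_Gamma_add (k : ℕ) :
    Differentiable ℂ fun ν : ℂ => (Complex.Gamma (ν + k + 1))⁻¹ :=
  Complex.differentiable_one_div_Gamma.comp (f := fun ν : ℂ => ν + k + 1) (by fun_prop)

theorem differentiable_besselI (ν : ℂ) : Differentiable ℂ (besselI ν) := by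
  obtain ⟨C, hC⟩ := bounded_one_div_Gamma ‖ν‖
  exact (differentiable_tsum_exp (fun k => hC k ν le_rfl) ν).2

/-- The derivative of `I_ν(z)` with respect to the order is an entire function of `log z`. -/
theorem differentiable_deriv_besselI (ν : ℂ) :
    Differentiable ℂ fun ζ => deriv (fun μ => besselI μ ζ) ν := by
  obtain ⟨C, hC⟩ := bounded_one_div_Gamma (‖ν‖ + 1)
  have hC' : ∀ k : ℕ, ‖deriv (fun μ : ℂ => (Complex.Gamma (μ + k + 1))⁻¹) ν‖ ≤ C := by
    intro k
    have := Complex.norm_deriv_le_of_forall_mem_sphere_norm_le (c := ν) (R := 1) (C := C) one_pos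
      (differentiable_one_div_Gamma_add k).diffContOnCl (fun z hz => hC k z (by
        have h1 := norm_add_le (z - ν) ν
        rw [mem_sphere_iff_norm] at hz
        rw [sub_add_cancel, hz] at h1
        linarith))
    simpa using this
  obtain ⟨s1, d1⟩ := differentiable_tsum_exp hC' ν
  obtain ⟨s0, d0⟩ := differentiable_tsum_exp (fun k => hC k ν (by linarith)) ν
  have e : (fun ζ => deriv (fun μ => besselI μ ζ) ν) = fun ζ => (∑' k : ℕ, (k.factorial : ℂ)⁻¹ *
      deriv (fun μ : ℂ => (Complex.Gamma (μ + k + 1))⁻¹) ν *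
        Complex.exp ((ν + 2 * k) * (ζ - Real.log 2))) + (ζ - Real.log 2) *
      ∑' k : ℕ, (k.factorial : ℂ)⁻¹ * (Complex.Gamma (ν + k + 1))⁻¹ *
        Complex.exp ((ν + 2 * k) * (ζ - Real.log 2)) := by
    funext ζ
    obtain ⟨u, hu, hb⟩ := besselI_term_bound (‖ν‖ + 1) ζ
    have hs := Complex.hasSum_deriv_of_summable_norm (z := ν) (U := Metric.ball 0 (‖ν‖ + 1))
      (F := fun (k : ℕ) (ν : ℂ) => (k.factorial : ℂ)⁻¹ * (Complex.Gamma (ν + k + 1))⁻¹ *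
        Complex.exp ((ν + 2 * k) * (ζ - Real.log 2))) hu
      (fun k => by
        have := differentiable_one_div_Gamma_add k
        exact Differentiable.differentiableOn (by fun_prop)) Metric.isOpen_ball
      (fun k w hw => hb k w (by simpa using (Metric.mem_ball.1 hw).le)) (by simp)
    have e2 : (fun μ => besselI μ ζ) = fun μ => ∑' k : ℕ, (k.factorial : ℂ)⁻¹ *
        (Complex.Gamma (μ + k + 1))⁻¹ * Complex.exp ((μ + 2 * k) * (ζ - Real.log 2)) := rfl
    rw [e2, ← hs.tsum_eq, ← tsum_mul_left, ← (s1 ζ).tsum_add ((s0 ζ).mul_left _)]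
    refine tsum_congr fun k => ?_
    have h1 := (differentiable_one_div_Gamma_add k ν).hasDerivAt
    have h2 : HasDerivAt (fun μ : ℂ => Complex.exp ((μ + 2 * k) * (ζ - Real.log 2)))
        (Complex.exp ((ν + 2 * k) * (ζ - Real.log 2)) * (1 * (ζ - Real.log 2))) ν :=
      (((hasDerivAt_id' ν).add_const (2 * k : ℂ)).mul_const (ζ - Real.log 2 : ℂ)).cexp
    rw [((h1.const_mul (k.factorial : ℂ)⁻¹).fun_mul h2).deriv]
    ring
  rw [e]
  exact d1.add ((differentiable_id.sub_const (Real.log 2 : ℂ)).mul d0)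

/-- At an integer order, the limit that defines `K_n` is a quotient of derivatives in the order. -/
theorem besselK_int_eq (n : ℤ) (ζ : ℂ) :
    besselK n ζ = Real.pi / 2 * (-deriv (fun μ => besselI μ ζ) (-n) -
      deriv (fun μ => besselI μ ζ) n) / (Complex.cos (Real.pi * n) * Real.pi) := by
  let f : ℂ → ℂ := fun μ => Real.pi / 2 * (besselI (-μ) ζ - besselI μ ζ)
  let g : ℂ → ℂ := fun μ => Complex.sin (Real.pi * μ)
  have hf : HasDerivAt f (Real.pi / 2 * (-deriv (fun μ => besselI μ ζ) (-n) -
      deriv (fun μ => besselI μ ζ) n)) n := by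
    have h1 := besselI_differentiable ζ
    have h2 : HasDerivAt (fun μ => besselI (-μ) ζ)
        (-deriv (fun μ => besselI μ ζ) (-n)) (n : ℂ) := by
      have := (h1 (-n)).hasDerivAt.comp (n : ℂ) (hasDerivAt_neg (n : ℂ))
      rw [mul_neg_one] at this
      exact this
    exact (h2.sub (h1 n).hasDerivAt).const_mul _
  have hg : HasDerivAt g (Complex.cos (Real.pi * n) * Real.pi) n := by
    have h1 : HasDerivAt (fun μ : ℂ => Real.pi * μ) (Real.pi : ℂ) n := by
      simpa using (hasDerivAt_id (n : ℂ)).const_mul (Real.pi : ℂ)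
    exact h1.csin
  have hg0 : Complex.cos (Real.pi * n) * Real.pi ≠ 0 := by
    refine mul_ne_zero ?_ (by exact_mod_cast Real.pi_ne_zero)
    intro h
    have := Complex.sin_sq_add_cos_sq (Real.pi * n)
    rw [h, sin_pi_int] at this
    norm_num at this
  refine tendsto_nhds_unique (besselK_tendsto_int n ζ)
    (((hasDerivAt_iff_tendsto_slope.1 hf).div (hasDerivAt_iff_tendsto_slope.1 hg) hg0).congr' ?_)
  filter_upwards [self_mem_nhdsWithin] with μ hμ
  have hμ' : μ - n ≠ 0 := sub_ne_zero.2 hμ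
  have hfn : f n = 0 := by simp only [f]; rw [besselI_neg_int]; ring
  have hgn : g n = 0 := sin_pi_int n
  simp only [Pi.div_apply, slope_def_field, hfn, hgn, sub_zero]
  rw [div_div_div_cancel_right₀ hμ']
  rfl

theorem differentiable_besselK (ν : ℂ) : Differentiable ℂ (besselK ν) := by
  by_cases h : ∃ n : ℤ, ν = n
  · obtain ⟨n, rfl⟩ := h
    have : besselK n = fun ζ => Real.pi / 2 * (-deriv (fun μ => besselI μ ζ) (-n) -
        deriv (fun μ => besselI μ ζ) n) / (Complex.cos (Real.pi * n) * Real.pi) := by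
      funext ζ
      exact besselK_int_eq n ζ
    rw [this]
    exact (((differentiable_deriv_besselI _).neg.sub (differentiable_deriv_besselI _)).const_mul
      _).div_const _
  · have : besselK ν = fun ζ =>
        Real.pi / 2 * (besselI (-ν) ζ - besselI ν ζ) / Complex.sin (Real.pi * ν) := by
      funext ζ
      rw [besselK, if_neg h]
      rfl
    rw [this]
    exact (((differentiable_besselI _).sub (differentiable_besselI _)).const_mul _).div_const _

/-! ### The remainders as averages of terminants, and the bounds -/

/-- By Cauchy's estimate; `δ` is halved to leave room for the circle. -/
theorem exists_norm_deriv_terminantL_le {p : ℝ} (hp : 0 ≤ p) {δ : ℝ} (hδ : 0 < δ) :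
    ∃ C : ℝ, ∀ ω : ℂ, |ω.im| ≤ 3 * Real.pi / 2 - δ → ‖deriv (terminantL p) ω‖ ≤ C := by
  obtain ⟨C, hC⟩ := exists_norm_terminantL_le hp (half_pos hδ)
  refine ⟨C / (δ / 2), fun ω hω => ?_⟩
  refine Complex.norm_deriv_le_of_forall_mem_sphere_norm_le (half_pos hδ)
    (differentiable_terminantL p).diffContOnCl fun z hz => hC z ?_
  have h1 : |(z - ω).im| ≤ δ / 2 := by
    rw [mem_sphere_iff_norm] at hz
    rw [← hz]
    exact Complex.abs_im_le_norm _
  rw [Complex.sub_im] at h1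
  have h2 := abs_add_le (z.im - ω.im) ω.im
  rw [sub_add_cancel] at h2
  linarith

/-- The average of `Λ_p(2zr)` against a probability measure in `r` is holomorphic for
`|arg z| < 3π/2`. -/
theorem hasDerivAt_integral_terminantL {p : ℝ} (hp : 0 ≤ p) (ρ : Measure ℝ)
    [IsProbabilityMeasure ρ] {ζ : ℂ} (hζ : |ζ.im| < 3 * Real.pi / 2) :
    HasDerivAt (fun ζ : ℂ => ∫ r, terminantL p (ζ + Real.log (2 * r)) ∂ρ)
      (∫ r, deriv (terminantL p) (ζ + Real.log (2 * r)) ∂ρ) ζ := by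
  set δ : ℝ := (3 * Real.pi / 2 - |ζ.im|) / 2 with hδ
  have hδ0 : 0 < δ := by rw [hδ]; linarith
  obtain ⟨C0, hC0⟩ := exists_norm_terminantL_le hp hδ0
  obtain ⟨C, hC⟩ := exists_norm_deriv_terminantL_le hp hδ0
  have him : ∀ z : ℂ, ∀ r : ℝ, (z + Real.log (2 * r)).im = z.im := fun z r => by
    rw [Complex.add_im, Complex.ofReal_im, add_zero]
  have hd : Differentiable ℂ (deriv (terminantL p)) :=
    fun z => ((differentiable_terminantL p).analyticAt z).deriv.differentiableAt
  refine (hasDerivAt_integral_of_dominated_loc_of_deriv_le (bound := fun _ => C)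
    (F' := fun z r => deriv (terminantL p) (z + Real.log (2 * r))) (Metric.ball_mem_nhds ζ hδ0)
    (Eventually.of_forall fun z => (measurable_terminantL_comp p z).aestronglyMeasurable) ?_ ?_ ?_
    (integrable_const C) ?_).2
  · refine (integrable_const C0).mono' (measurable_terminantL_comp p ζ).aestronglyMeasurable
      (ae_of_all _ fun r => hC0 _ ?_)
    rw [him]
    linarith
  · exact (hd.continuous.measurable.comp (by fun_prop)).aestronglyMeasurable
  · refine ae_of_all _ fun r z hz => hC _ ?_
    rw [him]
    have h1 : |(z - ζ).im| ≤ δ := by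
      rw [mem_ball_iff_norm] at hz
      exact (Complex.abs_im_le_norm _).trans hz.le
    rw [Complex.sub_im] at h1
    have h2 := abs_add_le (z.im - ζ.im) ζ.im
    rw [sub_add_cancel] at h2
    linarith
  · refine ae_of_all _ fun r z _ => ?_
    have := ((differentiable_terminantL p) (z + Real.log (2 * r))).hasDerivAt.comp z
      ((hasDerivAt_id' z).add_const (Real.log (2 * r) : ℂ))
    rwa [mul_one] at this

theorem differentiable_remK (N : ℕ) (ν : ℂ) : Differentiable ℂ (remK N ν) := by
  have h1 := differentiable_besselK ν
  have hs : (Real.sqrt (Real.pi / 2) : ℂ) ≠ 0 := by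
    have : 0 < Real.sqrt (Real.pi / 2) := Real.sqrt_pos.2 (by have := Real.pi_pos; positivity)
    exact_mod_cast this.ne'
  refine Differentiable.sub (h1.div (by fun_prop) fun ζ => ?_)
    (Differentiable.fun_sum fun n _ => ?_)
  · exact mul_ne_zero (mul_ne_zero hs (Complex.exp_ne_zero _)) (Complex.exp_ne_zero _)
  · exact (differentiable_const _).div (by fun_prop) fun ζ => pow_ne_zero _ (Complex.exp_ne_zero _)

theorem remK_log (N : ℕ) (ν : ℝ) {x : ℝ} (hx : 0 < x) :
    remK N ν (Real.log x) = ((normK ν x - hankelSum N ν x : ℝ) : ℂ) := by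
  have hsx : Real.exp (-Real.log x / 2) = (Real.sqrt x)⁻¹ := by
    rw [neg_div, Real.exp_neg, Real.exp_half, Real.exp_log hx]
  have hnorm : normK ν x =
      coshK 0 ν x / (Real.sqrt (Real.pi / 2) * Real.exp (-Real.log x / 2) * Real.exp (-x)) := by
    rw [hsx, normK, show 2 * x / Real.pi = (Real.pi / 2)⁻¹ * x by field_simp,
      Real.sqrt_mul (by have := Real.pi_pos; positivity), Real.sqrt_inv, Real.exp_neg]
    field_simp
  rw [remK, besselK_log ν hx, ← Complex.ofReal_exp, Real.exp_log hx, hnorm, hankelSum]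
  push_cast
  simp only [coeffA_ofReal]

/-- For `|ν| < N + 1/2`, the remainder `R_N^{(K)}(z, ν)` is `a_N(ν) z^{-N}` times an average of the
values `Λ_p(2zr)`, `r ≥ 1`, throughout `|arg z| < 3π/2`. -/
theorem exists_measure_remK {N : ℕ} {ν : ℝ} (hν : |ν| < N + 1 / 2) :
    ∃ ρ : Measure ℝ, IsProbabilityMeasure ρ ∧ ρ (Iio 1) = 0 ∧ ∀ ζ : ℂ, |ζ.im| < 3 * Real.pi / 2 →
      remK N ν ζ = coeffA N ν / Complex.exp ζ ^ N *
        ∫ r, terminantL ((N + max 0 (1 / 2 - |ν|) : ℝ) : ℂ) (ζ + Real.log (2 * r)) ∂ρ := by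
  obtain ⟨ρ, hP, hρ, h⟩ := exists_measure_remainder hν
  refine ⟨ρ, hP, hρ, ?_⟩
  set p : ℝ := N + max 0 (1 / 2 - |ν|) with hpdef
  have hp : 0 ≤ p := by positivity
  let S : Set ℂ := {ζ : ℂ | |ζ.im| < 3 * Real.pi / 2}
  have hSo : IsOpen S := isOpen_lt (by fun_prop) continuous_const
  have hSc : Convex ℝ S := by
    have : S = Complex.imLm ⁻¹' Ioo (-(3 * Real.pi / 2)) (3 * Real.pi / 2) := by
      ext ζ
      simp [S, abs_lt]
    rw [this]
    exact (convex_Ioo _ _).linear_preimage _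
  have h0 : (0 : ℂ) ∈ S := by
    have := Real.pi_pos
    simp only [S, mem_ofPred_eq, Complex.zero_im, abs_zero]
    positivity
  have hf : AnalyticOnNhd ℂ (remK N ν) S :=
    (differentiable_remK N ν).differentiableOn.analyticOnNhd hSo
  have hg : AnalyticOnNhd ℂ (fun ζ => coeffA N ν / Complex.exp ζ ^ N *
      ∫ r, terminantL (p : ℂ) (ζ + Real.log (2 * r)) ∂ρ) S := by
    refine DifferentiableOn.analyticOnNhd (fun ζ hζ => ?_) hSo
    refine DifferentiableAt.differentiableWithinAt ?_
    refine DifferentiableAt.mul ?_ (hasDerivAt_integral_terminantL hp ρ hζ).differentiableAt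
    exact (differentiableAt_const _).div (by fun_prop) (pow_ne_zero _ (Complex.exp_ne_zero _))
  refine fun ζ hζ => hf.eqOn_of_preconnected_of_frequently_eq hg hSc.isPreconnected h0 ?_ hζ
  have ht : Tendsto (fun x : ℝ => (x : ℂ)) (𝓝[≠] 0) (𝓝[≠] 0) := by
    refine tendsto_nhdsWithin_iff.2 ⟨?_, ?_⟩
    · exact (Complex.continuous_ofReal.tendsto' 0 0 rfl).mono_left nhdsWithin_le_nhds
    · filter_upwards [self_mem_nhdsWithin] with x hx
      simpa using hx
  refine ht.frequently (Eventually.frequently (Eventually.of_forall fun ξ => ?_))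
  have e := h (Real.exp ξ) (Real.exp_pos ξ)
  have e2 := remK_log N ν (Real.exp_pos ξ)
  rw [Real.log_exp] at e e2
  rw [e2, e, Complex.ofReal_exp]

/-- `‖∫ F dρ‖ ≤ sup_{r ≥ 1} ‖F r‖` for a probability measure `ρ` on `[1, ∞)`. -/
theorem norm_integral_le_iSup {F : ℝ → ℂ} {ρ : Measure ℝ} [IsProbabilityMeasure ρ]
    (hρ : ρ (Iio 1) = 0) (hF : BddAbove (range fun r : Ici (1 : ℝ) => ‖F r‖)) :
    ‖∫ r, F r ∂ρ‖ ≤ ⨆ r : Ici (1 : ℝ), ‖F r‖ := by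
  have hae : ∀ᵐ r ∂ρ, ‖F r‖ ≤ ⨆ r : Ici (1 : ℝ), ‖F r‖ := by
    have h1 : ∀ᵐ r ∂ρ, 1 ≤ r := by
      rw [ae_iff]
      convert hρ using 2
      ext r
      simp
    filter_upwards [h1] with r hr
    exact le_ciSup hF ⟨r, hr⟩
  simpa using norm_integral_le_of_norm_le_const hae

theorem bddAbove_terminantL {p : ℝ} (hp : 0 ≤ p) {ζ : ℂ} (hζ : |ζ.im| < 3 * Real.pi / 2) :
    BddAbove (range fun r : Ici (1 : ℝ) => ‖terminantL p (ζ + Real.log (2 * (r : ℝ)))‖) := by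
  obtain ⟨C, hC⟩ := exists_norm_terminantL_le hp (sub_pos.2 hζ)
  refine ⟨C, ?_⟩
  rintro _ ⟨r, rfl⟩
  refine hC _ ?_
  rw [Complex.add_im, Complex.ofReal_im, add_zero]
  linarith

theorem abs_im_add_lt {ζ : ℂ} (hζ : |ζ.im| < Real.pi) :
    |(ζ + Complex.I * Real.pi / 2).im| < 3 * Real.pi / 2 ∧
      |(ζ - Complex.I * Real.pi / 2).im| < 3 * Real.pi / 2 := by
  have h : (Complex.I * Real.pi / 2).im = Real.pi / 2 := by
    rw [show Complex.I * Real.pi / 2 = ((Real.pi / 2 : ℝ) : ℂ) * Complex.I by push_cast; ring]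
    rw [Complex.mul_I_im, Complex.ofReal_re]
  rw [Complex.add_im, Complex.sub_im, h]
  have := abs_lt.1 hζ
  constructor <;> rw [abs_lt] <;> constructor <;> linarith

theorem bddAbove_terminantP {p : ℝ} (hp : 0 ≤ p) {ζ : ℂ} (hζ : |ζ.im| < Real.pi) :
    BddAbove (range fun r : Ici (1 : ℝ) => ‖terminantP p (ζ + Real.log (2 * (r : ℝ)))‖) := by
  obtain ⟨h1, h2⟩ := abs_im_add_lt hζ
  obtain ⟨C1, hC1⟩ := bddAbove_terminantL hp h1
  obtain ⟨C2, hC2⟩ := bddAbove_terminantL hp h2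
  refine ⟨(C1 + C2) / 2, ?_⟩
  rintro _ ⟨r, rfl⟩
  have e1 := hC1 ⟨r, rfl⟩
  have e2 := hC2 ⟨r, rfl⟩
  simp only at e1 e2 ⊢
  rw [terminantP, norm_div, Complex.norm_ofNat, add_right_comm ζ, add_sub_right_comm ζ]
  have := norm_add_le (terminantL p (ζ + Complex.I * Real.pi / 2 + Real.log (2 * (r : ℝ))))
    (terminantL p (ζ - Complex.I * Real.pi / 2 + Real.log (2 * (r : ℝ))))
  linarith

theorem exp_add_I_mul_pi_div_two (ζ : ℂ) :
    Complex.exp (ζ + Complex.I * Real.pi / 2) = Complex.I * Complex.exp ζ := by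
  rw [Complex.exp_add, show Complex.I * Real.pi / 2 = Real.pi / 2 * Complex.I by ring,
    Complex.exp_pi_div_two_mul_I, mul_comm]

theorem exp_sub_I_mul_pi_div_two (ζ : ℂ) :
    Complex.exp (ζ - Complex.I * Real.pi / 2) = -Complex.I * Complex.exp ζ := by
  rw [sub_eq_add_neg, Complex.exp_add,
    show -(Complex.I * Real.pi / 2) = -Real.pi / 2 * Complex.I by ring,
    Complex.exp_neg_pi_div_two_mul_I, mul_comm]

/-- If `R_N^{(K)}` is `a z^{-N}` times an average of `Λ_p(2zr)`, then `R_N^{(J)}` is, up to a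
factor of modulus `1`, `a z^{-N}` times the average of `Π_p(2zr)`. -/
theorem norm_remJ_eq {N : ℕ} {ν : ℂ} {p : ℝ} (hp : 0 ≤ p) {a : ℂ} {ρ : Measure ℝ}
    [IsProbabilityMeasure ρ]
    (h : ∀ ζ : ℂ, |ζ.im| < 3 * Real.pi / 2 → remK N ν ζ = a / Complex.exp ζ ^ N *
      ∫ r, terminantL p (ζ + Real.log (2 * r)) ∂ρ) {ζ : ℂ} (hζ : |ζ.im| < Real.pi) :
    ‖remJ N ν ζ‖ = ‖a‖ / ‖Complex.exp ζ‖ ^ N *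
      ‖∫ r, terminantP p (ζ + Real.log (2 * r)) ∂ρ‖ := by
  obtain ⟨h1, h2⟩ := abs_im_add_lt hζ
  have hi : ∀ ζ : ℂ, |ζ.im| < 3 * Real.pi / 2 →
      Integrable (fun r => terminantL p (ζ + Real.log (2 * r))) ρ := by
    intro ζ hζ
    obtain ⟨C, hC⟩ := exists_norm_terminantL_le hp (sub_pos.2 hζ)
    refine (integrable_const C).mono' (measurable_terminantL_comp p ζ).aestronglyMeasurable
      (ae_of_all _ fun r => hC _ ?_)
    rw [Complex.add_im, Complex.ofReal_im, add_zero]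
    linarith
  have hP : ∫ r, terminantP p (ζ + Real.log (2 * r)) ∂ρ =
      ((∫ r, terminantL p (ζ + Complex.I * Real.pi / 2 + Real.log (2 * r)) ∂ρ) +
        ∫ r, terminantL p (ζ - Complex.I * Real.pi / 2 + Real.log (2 * r)) ∂ρ) / 2 := by
    rw [← integral_add (hi _ h1) (hi _ h2), ← integral_div]
    refine integral_congr_ae (ae_of_all _ fun r => ?_)
    simp only [terminantP]
    rw [add_right_comm ζ, add_sub_right_comm ζ]
  have hI : (Complex.I : ℂ) ≠ 0 := Complex.I_ne_zero
  have he : Complex.exp ζ ≠ 0 := Complex.exp_ne_zero ζ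
  have key : ∃ c : ℂ, ‖c‖ = 1 ∧ remJ N ν ζ = c * (a / Complex.exp ζ ^ N) *
      ∫ r, terminantP p (ζ + Real.log (2 * r)) ∂ρ := by
    -- `(± i z)^N` supplies the factors `i^N` and `(-i)^N`, and the parity of `N` makes both parts
    -- of `R_N^{(J)}` add up
    rw [remJ, h _ h1, h _ h2, exp_add_I_mul_pi_div_two, exp_sub_I_mul_pi_div_two, hP, mul_pow,
      mul_pow]
    split_ifs with hN
    · refine ⟨(Complex.I ^ N)⁻¹, by simp, ?_⟩
      rw [hN.neg_pow]
      field_simp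
    · refine ⟨(Complex.I ^ (N + 1))⁻¹, by simp, ?_⟩
      rw [(Nat.not_even_iff_odd.1 hN).neg_pow, pow_succ]
      field_simp
      ring
  obtain ⟨c, hc, e⟩ := key
  rw [e, norm_mul, norm_mul, hc, one_mul, norm_div, norm_pow]

end HankelBessel

theorem theorem3 (N : ℕ) (ν : ℝ) (hν : |ν| < (N : ℝ) + 1 / 2) :
    (∀ ζ : ℂ, |ζ.im| < 3 * Real.pi / 2 →
      BddAbove (Set.range fun r : Set.Ici (1 : ℝ) =>
        ‖HankelBessel.terminantL (((N : ℝ) + max 0 (1 / 2 - |ν|) : ℝ) : ℂ)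
          (ζ + Real.log (2 * (r : ℝ)))‖) ∧
      ‖HankelBessel.remK N (ν : ℂ) ζ‖ ≤
        ‖HankelBessel.coeffA N (ν : ℂ)‖ / ‖Complex.exp ζ‖ ^ N *
          ⨆ r : Set.Ici (1 : ℝ),
            ‖HankelBessel.terminantL (((N : ℝ) + max 0 (1 / 2 - |ν|) : ℝ) : ℂ)
              (ζ + Real.log (2 * (r : ℝ)))‖) ∧
    (∀ ζ : ℂ, |ζ.im| < Real.pi →
      BddAbove (Set.range fun r : Set.Ici (1 : ℝ) =>
        ‖HankelBessel.terminantP (((N : ℝ) + max 0 (1 / 2 - |ν|) : ℝ) : ℂ)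
          (ζ + Real.log (2 * (r : ℝ)))‖) ∧
      ‖HankelBessel.remJ N (ν : ℂ) ζ‖ ≤
        ‖HankelBessel.coeffA N (ν : ℂ)‖ / ‖Complex.exp ζ‖ ^ N *
          ⨆ r : Set.Ici (1 : ℝ),
            ‖HankelBessel.terminantP (((N : ℝ) + max 0 (1 / 2 - |ν|) : ℝ) : ℂ)
              (ζ + Real.log (2 * (r : ℝ)))‖) := by
  obtain ⟨ρ, hP, hρ, h⟩ := HankelBessel.exists_measure_remK hν
  have hp : 0 ≤ (N : ℝ) + max 0 (1 / 2 - |ν|) := by positivity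
  refine ⟨fun ζ hζ => ⟨HankelBessel.bddAbove_terminantL hp hζ, ?_⟩,
    fun ζ hζ => ⟨HankelBessel.bddAbove_terminantP hp hζ, ?_⟩⟩
  · rw [h ζ hζ, norm_mul, norm_div, norm_pow]
    gcongr
    exact HankelBessel.norm_integral_le_iSup hρ (HankelBessel.bddAbove_terminantL hp hζ)
  · rw [HankelBessel.norm_remJ_eq hp h hζ]
    gcongr
    exact HankelBessel.norm_integral_le_iSup hρ (HankelBessel.bddAbove_terminantP hp hζ)
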